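/- Let $n\ge 1$, let $f_a(z)=\sum_{i=0}^n z_i^{n+1}-a\prod_{i=0}^n z_i$ be the Dwork family on $\mathbb C^{n+1}$, with $a\in S=\mathbb C\setminus\{a^{n+1}=(n+1)^{n+1}\}$, and put $b=a^{n+1}/(n+1)^{n+1}$, $\theta=a\,\frac{d}{da}$. For $\mathbf m\in\mathbb N^{n+1}$ let $s[\mathbf z^{\mathbf m}\Omega]$ be the Gelfand–Leray residue of $\prod_i z_i^{m_i}\,dz_0\wedge\cdots\wedge dz_n$ on the fibres $\{f_a=t\}$, for a fixed $t\neq0$; its period integrals are the functions $a\mapsto\int_{\gamma_a}s[\mathbf z^{\mathbf m}\Omega]$, where $\gamma_a\in H_n(\{f_a=t\};\mathbb C)$ is locally constant in $a$. Write $${}_rG_s(\alpha;\beta;z)=\sum_{k\ge0}\frac{\prod_{i=1}^r(\alpha_i)_k}{\prod_{j=1}^s(\beta_j)_k}z^k,\qquad (\alpha)_k=\alpha(\alpha+1)\cdots(\alpha+k-1).$$ Let $A$ be the set of $\delta\in\{0,\dots,n\}$ with $\delta+m_i+1\not\equiv0 \pmod{n+1}$ for all $i$, and for $\delta\in A$ let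 $$\phi_\delta(a)=a^\delta\cdot{}_{n+1}G_{n+1}\Bigl(\tfrac{\delta+m_0+1}{n+1},\dots,\tfrac{\delta+m_n+1}{n+1};\ \tfrac{\delta+1}{n+1},\dots,\tfrac{\delta+n+1}{n+1};\ b\Bigr),$$ a series that converges for $|b|<1$, i.e. for $|a|<n+1$. (1) On every connected open subset of the disc $|a|<n+1$, every period integral of $s[\mathbf z^{\mathbf m}\Omega]$ is a $\mathbb C$-linear combination of the $\phi_\delta$, $\delta\in A$. More generally, for every $a_1\in S$ and every path in $S$ from $0$ to $a_1$, the germ at $a_1$ of any period integral is the analytic continuation along the path of a $\mathbb C$-linear combination of the $\phi_\delta$, $\delta\in A$. (2) If $0\le m_i\le n-1$ for all $i$, the $\phi_\delta$, $\delta\in A$, span the solution space of the reduced Picard–Fuchs equation $$\prod_{\delta\in A}(\theta-\delta)\,y=b\,\frac{\prod_{i=0}^n(\theta+m_i+1)}{\prod_{v\in\{m_0,\dots,m_n\}}(\theta+v+1)}\,y$$ (the denominator runs over the distinct values $v$ of the $m_i$, and the quotient is a polynomial in $\theta$): on every connected open subset of $|a|<n+1$, the holomorphic solutions are exactly the $\mathbb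 C$-linear combinations of the $\phi_\delta$, $\delta\in A$. -/

import Mathlib

open scoped ContDiff Topology

noncomputable section

/-- The Dwork polynomial `f_a(z) = ∑ z_i ^ (n+1) - a ∏ z_i` on `ℂ ^ (n+1)`. -/
def dwork (n : ℕ) (a : ℂ) (z : Fin (n + 1) → ℂ) : ℂ :=
  ∑ i, z i ^ (n + 1) - a * ∏ i, z i

/-- The parameter space `S = ℂ - {a ^ (n+1) = (n+1) ^ (n+1)}`. -/
def dworkBase (n : ℕ) : Set ℂ :=
  {a | a ^ (n + 1) ≠ ((n : ℂ) + 1) ^ (n + 1)}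

/-- The Gelfand-Leray residue of `z ^ m dz_0 ∧ ⋯ ∧ dz_n` at a point `z` of the fibre `f_a = t`
(`t ≠ 0`), evaluated on tangent vectors `v_1, …, v_n` of the fibre. It is the contraction
of `z ^ m dz_0 ∧ ⋯ ∧ dz_n` with a vector `w` such that `df_a(w) = 1`; by homogeneity
`w = z / ((n+1) t)` is such a vector. The result does not depend on `w`, see
`gelfandLeray_spec`. -/
def gelfandLeray (n : ℕ) (m : Fin (n + 1) → ℕ) (t : ℂ) (z : Fin (n + 1) → ℂ)
    (v : Fin n → Fin (n + 1) → ℂ) : ℂ :=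
  (∏ i, z i ^ m i) *
    (Matrix.of (Fin.cons z v : Fin (n + 1) → Fin (n + 1) → ℂ)).det / (((n : ℂ) + 1) * t)

theorem dwork_differentiable (n : ℕ) (a : ℂ) : Differentiable ℂ (dwork n a) := by
  unfold dwork
  fun_prop

/-- Euler's identity. -/
theorem dwork_euler (n : ℕ) (a : ℂ) (z : Fin (n + 1) → ℂ) :
    fderiv ℂ (dwork n a) z z = ((n : ℂ) + 1) * dwork n a z := by
  have h1 : HasDerivAt (fun s : ℂ => s • z) z 1 := by
    simpa using (hasDerivAt_id (1 : ℂ)).smul_const z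
  have h2 : HasFDerivAt (dwork n a) (fderiv ℂ (dwork n a) z) ((fun s : ℂ => s • z) 1) := by
    simpa using (dwork_differentiable n a z).hasFDerivAt
  have h3 := h2.comp_hasDerivAt (1 : ℂ) h1
  have h4 : (dwork n a ∘ fun s : ℂ => s • z) = fun s => s ^ (n + 1) * dwork n a z := by
    funext s
    simp only [dwork, Function.comp, Pi.smul_apply, smul_eq_mul, mul_pow, Finset.prod_mul_distrib,
      Finset.prod_const, Finset.card_univ, Fintype.card_fin, ← Finset.mul_sum]
    ring
  rw [h4] at h3
  have h5 := ((hasDerivAt_pow (n + 1) (1 : ℂ)).mul_const (dwork n a z))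
  have h6 := h3.unique h5
  simpa using h6

/-- The defining property of the Gelfand-Leray residue `ω'`: `df_a ∧ ω' = z ^ m dz_0 ∧ ⋯ ∧ dz_n`
along the fibre `f_a = t`. -/
theorem gelfandLeray_spec (n : ℕ) (m : Fin (n + 1) → ℕ) (a t : ℂ) (ht : t ≠ 0)
    (z : Fin (n + 1) → ℂ) (hz : dwork n a z = t) (w : Fin (n + 1) → ℂ)
    (v : Fin n → Fin (n + 1) → ℂ) (hv : ∀ i, fderiv ℂ (dwork n a) z (v i) = 0) :
    fderiv ℂ (dwork n a) z w * gelfandLeray n m t z v =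
      (∏ i, z i ^ m i) *
        (Matrix.of (Fin.cons w v : Fin (n + 1) → Fin (n + 1) → ℂ)).det := by
  have hn : ((n : ℂ) + 1) ≠ 0 := by exact_mod_cast Nat.succ_ne_zero n
  have hE := dwork_euler n a z
  rw [hz] at hE
  set L := fderiv ℂ (dwork n a) z with hL
  have key : ∀ u, (∀ i, L (v i) = 0) → L u = 0 →
      (Matrix.of (Fin.cons u v : Fin (n + 1) → Fin (n + 1) → ℂ)).det = 0 := by
    intro u hv hu
    apply Matrix.exists_mulVec_eq_zero_iff.mp
    have hsum : ∀ x : Fin (n + 1) → ℂ, L x = ∑ i, x i * L (Pi.single i 1) := by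
      intro x
      conv_lhs => rw [pi_eq_sum_univ' x]
      simp [map_sum, map_smul]
    refine ⟨fun i => L (Pi.single i 1), ?_, ?_⟩
    · intro h0
      have := hsum z
      rw [hE] at this
      have h1 : ∀ i, L (Pi.single i 1) = 0 := fun i => congrFun h0 i
      simp only [h1, mul_zero, Finset.sum_const_zero] at this
      exact mul_ne_zero hn ht this
    · funext i
      simp only [Matrix.mulVec, dotProduct, Matrix.of_apply, ← hsum]
      refine Fin.cases ?_ (fun j => ?_) i
      · simpa using hu
      · simpa using hv j
  have hc : ∀ (u u' : Fin (n + 1) → ℂ) (c : ℂ),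
      (Matrix.of (Fin.cons (u - c • u') v : Fin (n + 1) → Fin (n + 1) → ℂ)).det =
      (Matrix.of (Fin.cons u v : Fin (n + 1) → Fin (n + 1) → ℂ)).det -
      c * (Matrix.of (Fin.cons u' v : Fin (n + 1) → Fin (n + 1) → ℂ)).det := by
    intro u u' c
    have h : ∀ x, (Matrix.of (Fin.cons x v : Fin (n + 1) → Fin (n + 1) → ℂ)) =
        (Matrix.of (Fin.cons 0 v : Fin (n + 1) → Fin (n + 1) → ℂ)).updateRow 0 x := by
      intro x
      ext i j
      refine Fin.cases ?_ (fun k => ?_) i <;> simp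
    rw [h (u - c • u'), h u, h u', sub_eq_add_neg, ← neg_smul, Matrix.det_updateRow_add,
      Matrix.det_updateRow_smul]
    ring
  have h0 := key (w - (L w / (((n : ℂ) + 1) * t)) • z) hv (by
    rw [map_sub, map_smul, hE, smul_eq_mul]
    field_simp
    ring)
  rw [hc, sub_eq_zero] at h0
  rw [h0, gelfandLeray]
  ring

/-- The face `x_i = ε` of a family of cubes over `V`, as a family of cubes of one dimension less. -/
def cubeFace {E : Type*} {k : ℕ} (V : Set ℂ) (σ : ℂ → (Fin (k + 1) → ℝ) → E)
    (i : Fin (k + 1)) (ε : ℝ) : V → (Fin k → unitInterval) → E :=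
  fun a x => σ a (i.insertNth ε fun l => (x l : ℝ))

/-- A family of cubes is degenerate if it does not depend on one of the cube's coordinates. -/
def DegenerateCube {E : Type*} {k : ℕ} {V : Set ℂ} (τ : V → (Fin k → unitInterval) → E) : Prop :=
  ∃ l : Fin k, ∀ a x y, (∀ l', l' ≠ l → x l' = y l') → τ a x = τ a y

/-- `∑ j, c_j σ_j` is a cycle of cubical singular chains: its boundary
`∑ j, ∑ i, (-1) ^ i c_j (σ_j|_{x_i = 1} - σ_j|_{x_i = 0})` is a combination of degenerate cubes.
Every chain of dimension zero is a cycle. -/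
def IsCubicalCycle {E : Type*} (V : Set ℂ) {N : ℕ} (c : Fin N → ℂ) :
    (n : ℕ) → (Fin N → ℂ → (Fin n → ℝ) → E) → Prop
  | 0, _ => True
  | k + 1, σ =>
    (∑ j, ∑ i : Fin (k + 1), (-1 : ℂ) ^ (i : ℕ) •
        (Finsupp.single (cubeFace V (σ j) i 1) (c j)
          - Finsupp.single (cubeFace V (σ j) i 0) (c j)) :
        (V → (Fin k → unitInterval) → E) →₀ ℂ)
      ∈ Submodule.span ℂ {s | ∃ τ : V → (Fin k → unitInterval) → E,
          DegenerateCube τ ∧ s = Finsupp.single τ 1}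

/-- A locally constant `n`-dimensional homology class (with complex coefficients) of the Milnor
fibres `{f_a = t}`, for `a` in an open set `V`, given by a cycle that moves smoothly with `a`
inside the fibres: a finite combination of singular cubes `σ_j(a, ·)` in `{f_a = t}`, smooth in
`a` and in the point of the cube, which form a cycle. (Only the values on the unit cube matter; a
cube that is smooth up to its boundary is the restriction of a smooth map on `ℝ ^ n`.) -/
structure FlatCycle (n : ℕ) (t : ℂ) (V : Set ℂ) where
  /-- the number of cubes -/
  N : ℕ
  /-- the coefficients of the cubes -/
  coeff : Fin N → ℂ
  /-- the cubes -/
  cube : Fin N → ℂ → (Fin n → ℝ) → Fin (n + 1) → ℂ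
  smooth : ∀ j, ContDiffOn ℝ ∞ (fun p : ℂ × (Fin n → ℝ) => cube j p.1 p.2) (V ×ˢ Set.univ)
  mem_fibre : ∀ j, ∀ a ∈ V, ∀ x ∈ Set.Icc (0 : Fin n → ℝ) 1, dwork n a (cube j a x) = t
  cycle : IsCubicalCycle V coeff n cube

/-- The period integral of the geometric section `s[z ^ m Ω]` over a locally constant homology
class: the integral of the Gelfand-Leray residue over the cycle in the fibre `{f_a = t}`. -/
def FlatCycle.period {n : ℕ} {t : ℂ} {V : Set ℂ} (γ : FlatCycle n t V)
    (m : Fin (n + 1) → ℕ) (a : ℂ) : ℂ :=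
  ∑ j, γ.coeff j * ∫ x in Set.Icc (0 : Fin n → ℝ) 1,
    gelfandLeray n m t (γ.cube j a x) fun i => fderiv ℝ (γ.cube j a) x (Pi.single i 1)

/-- The `k`-th term of the series `_rG_s(α; β; z)`. -/
def gTerm {r s : ℕ} (α : Fin r → ℂ) (β : Fin s → ℂ) (z : ℂ) (k : ℕ) : ℂ :=
  (∏ i, (ascPochhammer ℂ k).eval (α i)) / (∏ j, (ascPochhammer ℂ k).eval (β j)) * z ^ k

/-- The series `_rG_s(α; β; z) = ∑ k, ∏ (α_i)_k / ∏ (β_j)_k z ^ k`. -/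
def gSeries {r s : ℕ} (α : Fin r → ℂ) (β : Fin s → ℂ) (z : ℂ) : ℂ :=
  ∑' k, gTerm α β z k

/-- The upper parameters `(δ + m_i + 1) / (n + 1)`, `i = 0, …, n`. -/
def upperParam (n : ℕ) (m : Fin (n + 1) → ℕ) (δ : ℕ) (i : Fin (n + 1)) : ℂ :=
  ((δ : ℂ) + m i + 1) / ((n : ℂ) + 1)

/-- The lower parameters `(δ + j) / (n + 1)`, `j = 1, …, n + 1`. -/
def lowerParam (n : ℕ) (δ : ℕ) (j : Fin (n + 1)) : ℂ :=
  ((δ : ℂ) + ((j : ℕ) + 1)) / ((n : ℂ) + 1)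

/-- The coordinate `b = a ^ (n+1) / (n+1) ^ (n+1)`. -/
def bCoord (n : ℕ) (a : ℂ) : ℂ := a ^ (n + 1) / ((n : ℂ) + 1) ^ (n + 1)

/-- The function `a ^ δ · _{n+1}G_{n+1}((δ + m_i + 1) / (n+1); (δ + j) / (n+1); b)`. -/
def periodFun (n : ℕ) (m : Fin (n + 1) → ℕ) (δ : ℕ) (a : ℂ) : ℂ :=
  a ^ δ * gSeries (upperParam n m δ) (lowerParam n δ) (bCoord n a)

/-- The `δ ∈ {0, …, n}` with `δ + m_i + 1 ≠ 0` in `ℤ / (n+1)` for all `i`. -/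
def admissible (n : ℕ) (m : Fin (n + 1) → ℕ) : Finset ℕ :=
  (Finset.range (n + 1)).filter fun δ => ∀ i, ((δ + m i + 1 : ℕ) : ZMod (n + 1)) ≠ 0

/-- The operator `θ = a d/da`. -/
def theta (y : ℂ → ℂ) : ℂ → ℂ := fun a => a * deriv y a

/-- `p(θ) y` for a polynomial `p`. -/
def thetaPoly (p : Polynomial ℂ) (y : ℂ → ℂ) (a : ℂ) : ℂ :=
  p.sum fun k c => c * (theta^[k] y) a

/-- The reduced Picard-Fuchs operator. If all `m_i ≤ n`, put `R(θ) = ∏ (θ + v - n)`, the product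
over the *distinct* values `v` of the `m_i`. Since `R(θ) a ^ (n+1) = a ^ (n+1) ∏ (θ + v + 1)`, the
Picard-Fuchs operator `∏_{i=0}^n (θ + i - n) - b ∏_{i=0}^n (θ + m_i + 1)` is the composition of
`R(θ)` (on the left) with the operator below, whose first product runs over the factors `θ - δ` with
`δ ∉ {n - m_i}`, and whose second product runs over the `m_i` with each distinct value left out
once. Its order is `n + 1` minus the number of distinct `m_i`. -/
def reducedPicardFuchs (n : ℕ) (m : Fin (n + 1) → ℕ) (y : ℂ → ℂ) (a : ℂ) : ℂ :=
  thetaPoly (∏ δ ∈ admissible n m, (Polynomial.X - Polynomial.C (δ : ℂ))) y a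
    - bCoord n a *
      thetaPoly (((Finset.univ.val.map m - (Finset.univ.val.map m).dedup).map
        fun v => Polynomial.X + Polynomial.C ((v : ℂ) + 1)).prod) y a

/-- The germ of `h` at the end of the path `p` is the analytic continuation along `p` of the germ
of `g` at its beginning. -/
def IsContinuationAlong {a₀ a₁ : ℂ} (p : Path a₀ a₁) (g h : ℂ → ℂ) : Prop :=
  ∃ F : unitInterval → ℂ → ℂ,
    (∀ s, AnalyticAt ℂ (F s) (p s)) ∧
    (∀ s, ∀ᶠ s' in 𝓝 s, F s' =ᶠ[𝓝 (p s')] F s) ∧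
    F 0 =ᶠ[𝓝 a₀] g ∧ F 1 =ᶠ[𝓝 a₁] h

end

noncomputable section

/-! ### Determinants as differential forms -/

/-! Write `1` for `(1, …, 1)`. Multiplied by `Γ(|m|/(n+1) + 1) t^(-|m|/(n+1))`, the periods become
functions `h_m` with the relations that differentiation and integration by parts would give for `∫
exp(-f_a) z^m dz` (`PeriodRelations`): `h_m' = h_{m+1}`; `(m_p + 1) h_m = (n+1) h_{m+(n+1)e_p} - a
h_{m+1}`; and, if `q_p = 0`, `(n+1) h_{q+n e_p} = a h_{q'}`, where `q'` is `q + 1` with its `p`-th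
entry replaced by `0`.

On actual cycles these relations are Stokes' theorem (`stokes_of_isCubicalCycle`). The two algebraic
ones come from the exact forms `d(z^q ι_E ι_p Ω)`, with `E` the Euler field. The derivative comes
from Cartan's formula for `z^m ι_E Ω` pulled back to parameter times cube (`fderiv_eulerForm_fam`,
`hasDerivAt_period`): a cycle moving inside `{f_a = t}` has `df_a(velocity) = ∏ z_i`, which raises
every exponent by one.

Using the first algebraic relation once in each coordinate expresses `((n+1)^(n+1) - a^(n+1))
h_{m+(n+1)1}` through `h_m, …, h_{m+n1}`. So these functions solve a linear system that is
holomorphic on `S`, and they continue along every path in `S` to the origin; the relations survive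
by uniqueness of continuation (`PeriodRelations.exists_continuation`).

At `a = 0` the `k`-th derivative of `h_m` is `h_{m+k1}(0)`, and the relations lose their second
term. The Taylor coefficients then obey a two-term recursion of step `n+1`, which is that of the
series, so each residue class `δ` of exponents contributes a multiple of `φ_δ`. The classes with
`n+1 ∣ δ + m_i + 1` for some `i` drop out because `h_{q+n e_p}(0) = 0`
(`eventuallyEq_sum_periodFun`).

For the reduced equation, `θ` acts on `a^δ b^j` as `δ + (n+1)j`, so the recursion with its common
factors cancelled says that the `φ_δ` are solutions. The order of the equation is `|A|`, its leading
coefficient `1 - b` has no zero in the disc, and the `φ_δ` are independent since they start with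
distinct powers of `a`. They match all initial values at any `a ≠ 0` (`exists_initial_values`),
hence give all solutions. -/

/-- The form `dz_0 ∧ ⋯ ∧ dz_n`, as a real alternating form. -/
def volForm (n : ℕ) : (Fin (n + 1) → ℂ) [⋀^Fin (n + 1)]→L[ℝ] ℂ :=
  ContinuousAlternatingMap.restrictScalars ℝ
    ({ toMultilinearMap := (Matrix.detRowAlternating (R := ℂ) (n := Fin (n + 1))).toMultilinearMap
       cont := by
        change Continuous fun v : Fin (n + 1) → Fin (n + 1) → ℂ => Matrix.det (Matrix.of v)
        exact Continuous.matrix_det (by fun_prop)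
       map_eq_zero_of_eq' := Matrix.detRowAlternating.map_eq_zero_of_eq' } :
      (Fin (n + 1) → ℂ) [⋀^Fin (n + 1)]→L[ℂ] ℂ)

/-- The alternating sum `∑ j, (-1) ^ j L(u_j) det(u_0, …, û_j, …, u_{n+1})` vanishes. -/
theorem sum_apply_mul_volForm_removeNth (n : ℕ) (L : (Fin (n + 1) → ℂ) →L[ℂ] ℂ)
    (u : Fin (n + 2) → Fin (n + 1) → ℂ) :
    ∑ j : Fin (n + 2), (-1 : ℂ) ^ (j : ℕ) * L (u j) * volForm n (j.removeNth u) = 0 := by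
  -- Prefixing each `u i` with `L (u i)` makes the first column a combination of the others; the sum
  -- is the expansion of the vanishing determinant along that column.
  let M : Matrix (Fin (n + 2)) (Fin (n + 2)) ℂ := Matrix.of fun i => Fin.cons (L (u i)) (u i)
  have h0 : M.det = 0 := by
    apply Matrix.exists_mulVec_eq_zero_iff.mp
    refine ⟨Fin.cons (-1) fun k => L (Pi.single k 1), ?_, ?_⟩
    · intro h
      simpa using congrFun h 0
    · funext i
      have hsum : L (u i) = ∑ k, u i k * L (Pi.single k 1) := by
        conv_lhs => rw [pi_eq_sum_univ' (u i)]
        simp [map_sum, map_smul]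
      simp [Matrix.mulVec, dotProduct, Fin.sum_univ_succ (n := n + 1), M, ← hsum]
  rw [Matrix.det_succ_column_zero] at h0
  exact h0

/-- As forms, `L ∧ Ω = 0` by degree; contraction with `z` gives `L ∧ ι_z Ω = L(z) Ω`. It is used
with `L` the differential of a monomial. -/
theorem apply_mul_volForm (n : ℕ) (L : (Fin (n + 1) → ℂ) →L[ℂ] ℂ) (z : Fin (n + 1) → ℂ)
    (v : Fin (n + 1) → Fin (n + 1) → ℂ) :
    ∑ i : Fin (n + 1), (-1 : ℂ) ^ (i : ℕ) * L (v i) * volForm n (Matrix.vecCons z (i.removeNth v)) =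
      L z * volForm n v := by
  have h := sum_apply_mul_volForm_removeNth n L (Matrix.vecCons z v)
  rw [Fin.sum_univ_succ] at h
  have h1 : ∀ i : Fin (n + 1), Fin.removeNth i.succ (Matrix.vecCons z v) =
      Matrix.vecCons z (i.removeNth v) := by
    intro i
    funext j
    refine Fin.cases ?_ (fun j => ?_) j <;> simp [Fin.removeNth]
  have h2 : Fin.removeNth 0 (Matrix.vecCons z v) = v := rfl
  simp only [h1, h2, Matrix.cons_val_zero, Matrix.cons_val_succ, Fin.val_zero, pow_zero, one_mul,
    Fin.val_succ, pow_succ] at h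
  rw [eq_comm, ← sub_eq_zero, ← h, sub_eq_add_neg, ← Finset.sum_neg_distrib]
  congr 1
  exact Finset.sum_congr rfl fun i _ => by ring

/-- The preceding identity for contraction with `e`, evaluated on the tuple `(z, v)`, with the term
of `z` moved to the other side. -/
theorem apply_mul_volForm₂ (k : ℕ) (L : (Fin (k + 2) → ℂ) →L[ℂ] ℂ) (e z : Fin (k + 2) → ℂ)
    (v : Fin (k + 1) → Fin (k + 2) → ℂ) :
    ∑ i : Fin (k + 1), (-1 : ℂ) ^ (i : ℕ) * L (v i) *
        volForm (k + 1) (Matrix.vecCons e (Matrix.vecCons z (i.removeNth v))) =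
      L z * volForm (k + 1) (Matrix.vecCons e v) - L e * volForm (k + 1) (Matrix.vecCons z v) := by
  have h := apply_mul_volForm (k + 1) L e (Matrix.vecCons z v)
  rw [Fin.sum_univ_succ] at h
  have h1 : ∀ i : Fin (k + 1), Fin.removeNth i.succ (Matrix.vecCons z v) =
      Matrix.vecCons z (i.removeNth v) := by
    intro i
    funext j
    refine Fin.cases ?_ (fun j => ?_) j <;> simp [Fin.removeNth]
  have h2 : Fin.removeNth 0 (Matrix.vecCons z v) = v := rfl
  simp only [h1, h2, Matrix.cons_val_zero, Matrix.cons_val_succ, Fin.val_zero, pow_zero, one_mul,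
    Fin.val_succ, pow_succ] at h
  simp only [mul_neg_one, neg_mul, Finset.sum_neg_distrib] at h
  rw [← h]
  ring

theorem neg_one_pow_mul_volForm_vecCons_removeNth (n : ℕ) (v : Fin (n + 1) → Fin (n + 1) → ℂ)
    (i : Fin (n + 1)) :
    (-1 : ℂ) ^ (i : ℕ) * volForm n (Matrix.vecCons (v i) (i.removeNth v)) = volForm n v := by
  have h := (volForm n).toAlternatingMap.map_insertNth i (v i) (i.removeNth v)
  rw [Fin.insertNth_self_removeNth] at h
  have h' : volForm n v =
      (-1 : ℤ) ^ (i : ℕ) • volForm n (Matrix.vecCons (v i) (i.removeNth v)) := by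
    simpa using h
  rw [h']
  simp

/-! ### Monomials -/

/-- The monomial `z ^ m`. -/
def monom {n : ℕ} (m : Fin (n + 1) → ℕ) (z : Fin (n + 1) → ℂ) : ℂ := ∏ i, z i ^ m i

theorem contDiff_monom {n : ℕ} (m : Fin (n + 1) → ℕ) {𝕜 : Type*} [NontriviallyNormedField 𝕜]
    [NormedAlgebra 𝕜 ℂ] {r : WithTop ℕ∞} : ContDiff 𝕜 r (monom m) := by
  unfold monom
  fun_prop

theorem differentiable_monom {n : ℕ} (m : Fin (n + 1) → ℕ) : Differentiable ℂ (monom m) :=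
  (contDiff_monom m (𝕜 := ℂ) (r := 1)).differentiable one_ne_zero

theorem monom_add {n : ℕ} (m q : Fin (n + 1) → ℕ) (z : Fin (n + 1) → ℂ) :
    monom (m + q) z = monom m z * monom q z := by
  simp [monom, pow_add, Finset.prod_mul_distrib]

theorem monom_one {n : ℕ} (z : Fin (n + 1) → ℂ) : monom 1 z = ∏ i, z i := by
  simp [monom]

theorem monom_single {n : ℕ} (p : Fin (n + 1)) (k : ℕ) (z : Fin (n + 1) → ℂ) :
    monom (Pi.single p k) z = z p ^ k := by
  rw [monom, Finset.prod_eq_single p]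
  · simp
  · intro i _ hi
    simp [Pi.single_eq_of_ne hi]
  · simp

/-- Euler's identity: differentiate `(s z)^m = s^|m| z^m` at `s = 1`. -/
theorem fderiv_monom_self {n : ℕ} (m : Fin (n + 1) → ℕ) (z : Fin (n + 1) → ℂ) :
    fderiv ℂ (monom m) z z = ((∑ i, m i : ℕ) : ℂ) * monom m z := by
  have h1 : HasDerivAt (fun s : ℂ => s • z) z 1 := by
    simpa using (hasDerivAt_id (1 : ℂ)).smul_const z
  have h2 : HasFDerivAt (monom m) (fderiv ℂ (monom m) z) ((fun s : ℂ => s • z) 1) := by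
    simpa using (differentiable_monom m z).hasFDerivAt
  have h3 := h2.comp_hasDerivAt (1 : ℂ) h1
  have h4 : (monom m ∘ fun s : ℂ => s • z) = fun s => s ^ (∑ i, m i) * monom m z := by
    funext s
    simp [monom, mul_pow, Finset.prod_mul_distrib, Finset.prod_pow_eq_pow_sum]
  rw [h4] at h3
  have h5 := ((hasDerivAt_pow (∑ i, m i) (1 : ℂ)).mul_const (monom m z))
  simpa using h3.unique h5

theorem hasDerivAt_add_smul_single {n : ℕ} (z : Fin (n + 1) → ℂ) (p : Fin (n + 1)) :
    HasDerivAt (fun s : ℂ => z + s • Pi.single (M := fun _ => ℂ) p (1 : ℂ))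
      (Pi.single p (1 : ℂ)) 0 := by
  simpa using ((hasDerivAt_id (0 : ℂ)).smul_const (Pi.single (M := fun _ => ℂ) p (1 : ℂ))).const_add z

/-- `∂ z ^ (m + e_p) / ∂ z_p = (m_p + 1) z ^ m`. -/
theorem fderiv_monom_add_single {n : ℕ} (m : Fin (n + 1) → ℕ) (p : Fin (n + 1))
    (z : Fin (n + 1) → ℂ) :
    fderiv ℂ (monom (m + Pi.single p 1)) z (Pi.single p 1) = ((m p : ℂ) + 1) * monom m z := by
  have h2 : HasFDerivAt (monom (m + Pi.single p 1)) (fderiv ℂ (monom (m + Pi.single p 1)) z)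
      ((fun s : ℂ => z + s • Pi.single (M := fun _ => ℂ) p (1 : ℂ)) 0) := by
    simpa using (differentiable_monom _ z).hasFDerivAt
  have h3 := h2.comp_hasDerivAt (0 : ℂ) (hasDerivAt_add_smul_single z p)
  have h4 : (monom (m + Pi.single p 1) ∘
      fun s : ℂ => z + s • Pi.single (M := fun _ => ℂ) p (1 : ℂ)) =
      fun s => (z p + s) ^ (m p + 1) * ∏ i ∈ Finset.univ.erase p, z i ^ m i := by
    funext s
    rw [Function.comp_apply, monom, ← Finset.mul_prod_erase _ _ (Finset.mem_univ p)]
    congr 1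
    · simp
    · refine Finset.prod_congr rfl fun i hi => ?_
      have hi : i ≠ p := Finset.ne_of_mem_erase hi
      simp [Pi.single_eq_of_ne hi]
  rw [h4] at h3
  have h5 := (((hasDerivAt_id (0 : ℂ)).const_add (z p)).pow (m p + 1)).mul_const
    (∏ i ∈ Finset.univ.erase p, z i ^ m i)
  have h6 := h3.unique h5
  rw [h6, monom, ← Finset.mul_prod_erase _ _ (Finset.mem_univ p)]
  simp
  ring

/-- `∂ z ^ m / ∂ z_p = 0` if `m_p = 0`. -/
theorem fderiv_monom_of_eq_zero {n : ℕ} (m : Fin (n + 1) → ℕ) (p : Fin (n + 1)) (hp : m p = 0)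
    (z : Fin (n + 1) → ℂ) : fderiv ℂ (monom m) z (Pi.single p 1) = 0 := by
  have h2 : HasFDerivAt (monom m) (fderiv ℂ (monom m) z)
      ((fun s : ℂ => z + s • Pi.single (M := fun _ => ℂ) p (1 : ℂ)) 0) := by
    simpa using (differentiable_monom _ z).hasFDerivAt
  have h3 := h2.comp_hasDerivAt (0 : ℂ) (hasDerivAt_add_smul_single z p)
  have h4 : (monom m ∘ fun s : ℂ => z + s • Pi.single (M := fun _ => ℂ) p (1 : ℂ)) =
      fun _ => monom m z := by
    funext s
    rw [Function.comp_apply, monom, monom]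
    refine Finset.prod_congr rfl fun i _ => ?_
    rcases eq_or_ne i p with rfl | hi
    · simp [hp]
    · simp [Pi.single_eq_of_ne hi]
  rw [h4] at h3
  exact h3.unique (hasDerivAt_const _ _)

/-- `∂ f_a / ∂ z_p = (n + 1) z_p ^ n - a ∏_{i ≠ p} z_i`. -/
theorem fderiv_dwork_single (n : ℕ) (a : ℂ) (z : Fin (n + 1) → ℂ) (p : Fin (n + 1)) :
    fderiv ℂ (dwork n a) z (Pi.single p 1) =
      ((n : ℂ) + 1) * z p ^ n - a * ∏ i ∈ Finset.univ.erase p, z i := by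
  have h2 : HasFDerivAt (dwork n a) (fderiv ℂ (dwork n a) z)
      ((fun s : ℂ => z + s • Pi.single (M := fun _ => ℂ) p (1 : ℂ)) 0) := by
    simpa using (dwork_differentiable n a z).hasFDerivAt
  have h3 := h2.comp_hasDerivAt (0 : ℂ) (hasDerivAt_add_smul_single z p)
  have h4 : (dwork n a ∘ fun s : ℂ => z + s • Pi.single (M := fun _ => ℂ) p (1 : ℂ)) =
      fun s => (z p + s) ^ (n + 1) + ∑ i ∈ Finset.univ.erase p, z i ^ (n + 1)
        - a * ((z p + s) * ∏ i ∈ Finset.univ.erase p, z i) := by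
    funext s
    rw [Function.comp_apply, dwork, ← Finset.mul_prod_erase _ _ (Finset.mem_univ p),
      ← Finset.add_sum_erase _ _ (Finset.mem_univ p)]
    congr 2
    · simp
    · refine Finset.sum_congr rfl fun i hi => ?_
      have hi : i ≠ p := Finset.ne_of_mem_erase hi
      simp [Pi.single_eq_of_ne hi]
    · congr 1
      · simp
      · refine Finset.prod_congr rfl fun i hi => ?_
        have hi : i ≠ p := Finset.ne_of_mem_erase hi
        simp [Pi.single_eq_of_ne hi]
  rw [h4] at h3
  have h6 : HasDerivAt (fun s : ℂ => z p + s) 1 0 := (hasDerivAt_id (0 : ℂ)).const_add (z p)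
  have h5 := ((h6.pow (n + 1)).add_const (∑ i ∈ Finset.univ.erase p, z i ^ (n + 1))).sub
    ((h6.mul_const (∏ i ∈ Finset.univ.erase p, z i)).const_mul a)
  rw [h3.unique h5]
  simp

/-! ### The forms whose exterior derivatives give the relations between the periods -/

/-- The form `z ^ m ι_E (dz_0 ∧ ⋯ ∧ dz_n)`, where `E` is the Euler vector field. -/
def eulerForm {n : ℕ} (m : Fin (n + 1) → ℕ) (z : Fin (n + 1) → ℂ) :
    (Fin (n + 1) → ℂ) [⋀^Fin n]→L[ℝ] ℂ :=
  monom m z • (volForm n).curryLeft z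

theorem eulerForm_apply {n : ℕ} (m : Fin (n + 1) → ℕ) (z : Fin (n + 1) → ℂ)
    (v : Fin n → Fin (n + 1) → ℂ) :
    eulerForm m z v = monom m z * volForm n (Matrix.vecCons z v) := rfl

theorem contDiff_eulerForm {n : ℕ} (m : Fin (n + 1) → ℕ) : ContDiff ℝ ∞ (eulerForm m) :=
  (contDiff_monom m).smul (volForm n).curryLeft.contDiff

/-- The form `z ^ m ι_E ι_w (dz_0 ∧ ⋯ ∧ dz_n)`, where `E` is the Euler vector field. -/
def eulerForm₂ {k : ℕ} (m : Fin (k + 2) → ℕ) (w : Fin (k + 2) → ℂ) (z : Fin (k + 2) → ℂ) :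
    (Fin (k + 2) → ℂ) [⋀^Fin k]→L[ℝ] ℂ :=
  monom m z • ((volForm (k + 1)).curryLeft w).curryLeft z

theorem contDiff_eulerForm₂ {k : ℕ} (m : Fin (k + 2) → ℕ) (w : Fin (k + 2) → ℂ) :
    ContDiff ℝ ∞ (eulerForm₂ m w) :=
  (contDiff_monom m).smul ((volForm (k + 1)).curryLeft w).curryLeft.contDiff

theorem hasFDerivAt_monom_real {n : ℕ} (m : Fin (n + 1) → ℕ) (z : Fin (n + 1) → ℂ) :
    HasFDerivAt (monom m) ((fderiv ℂ (monom m) z).restrictScalars ℝ) z :=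
  (differentiable_monom m z).hasFDerivAt.restrictScalars ℝ

/-- `d (z ^ m ι_E Ω) = (|m| + n + 1) z ^ m Ω`. -/
theorem extDeriv_eulerForm {n : ℕ} (m : Fin (n + 1) → ℕ) (z : Fin (n + 1) → ℂ)
    (v : Fin (n + 1) → Fin (n + 1) → ℂ) :
    extDeriv (eulerForm m) z v =
      (((∑ i, m i : ℕ) : ℂ) + n + 1) * (monom m z * volForm n v) := by
  rw [extDeriv_apply ((contDiff_eulerForm m).differentiable (by simp) z)]
  have key : ∀ i : Fin (n + 1), fderiv ℝ (eulerForm m · (i.removeNth v)) z (v i) =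
      monom m z * volForm n (Matrix.vecCons (v i) (i.removeNth v)) +
      fderiv ℂ (monom m) z (v i) * volForm n (Matrix.vecCons z (i.removeNth v)) := by
    intro i
    -- The Euler field at a point is the point itself, so for fixed tangent vectors the contracted
    -- volume form is linear in the point and is its own derivative.
    let Λ : (Fin (n + 1) → ℂ) →L[ℝ] ℂ :=
      (ContinuousAlternatingMap.apply ℝ (Fin (n + 1) → ℂ) ℂ (i.removeNth v)) ∘L (volForm n).curryLeft
    have h1 : HasFDerivAt Λ Λ z := Λ.hasFDerivAt
    have h2 := (hasFDerivAt_monom_real m z).mul h1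
    have h3 : (eulerForm m · (i.removeNth v)) = fun y => monom m y * Λ y := rfl
    rw [h3, HasFDerivAt.fderiv (f := fun y => monom m y * Λ y) h2]
    simp [Λ, mul_comm]
  -- Derivatives of the Euler field give `n + 1` copies of `z^m Ω`; derivatives of the monomial give
  -- `d(z^m) ∧ ι_E Ω`, which is `|m| z^m Ω` by Euler's identity.
  simp only [key, smul_add, Finset.sum_add_distrib]
  have hA : ∑ i : Fin (n + 1), (-1 : ℤ) ^ (i : ℕ) •
      (monom m z * volForm n (Matrix.vecCons (v i) (i.removeNth v))) =
      ((n : ℂ) + 1) * (monom m z * volForm n v) := by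
    have : ∀ i : Fin (n + 1), (-1 : ℤ) ^ (i : ℕ) •
      (monom m z * volForm n (Matrix.vecCons (v i) (i.removeNth v))) =
        monom m z * volForm n v := by
      intro i
      rw [← neg_one_pow_mul_volForm_vecCons_removeNth n v i]
      simp
      ring
    simp [this]
  have hB := apply_mul_volForm n (fderiv ℂ (monom m) z) z v
  rw [fderiv_monom_self] at hB
  have hC : ∑ i : Fin (n + 1), (-1 : ℤ) ^ (i : ℕ) •
      (fderiv ℂ (monom m) z (v i) * volForm n (Matrix.vecCons z (i.removeNth v))) =
      ((∑ i, m i : ℕ) : ℂ) * monom m z * volForm n v := by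
    rw [← hB]
    refine Finset.sum_congr rfl fun i _ => ?_
    simp
    ring
  rw [hA, hC]
  ring

/-- `d (z ^ m ι_E ι_w Ω) = (|m| + n) z ^ m ι_w Ω - w(z ^ m) ι_E Ω`. -/
theorem extDeriv_eulerForm₂ {k : ℕ} (m : Fin (k + 2) → ℕ) (w z : Fin (k + 2) → ℂ)
    (v : Fin (k + 1) → Fin (k + 2) → ℂ) :
    extDeriv (eulerForm₂ m w) z v =
      (((∑ i, m i : ℕ) : ℂ) + k + 1) * (monom m z * volForm (k + 1) (Matrix.vecCons w v))
        - fderiv ℂ (monom m) z w * volForm (k + 1) (Matrix.vecCons z v) := by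
  rw [extDeriv_apply ((contDiff_eulerForm₂ m w).differentiable (by simp) z)]
  have key : ∀ i : Fin (k + 1), fderiv ℝ (eulerForm₂ m w · (i.removeNth v)) z (v i) =
      monom m z * volForm (k + 1) (Matrix.vecCons w (Matrix.vecCons (v i) (i.removeNth v))) +
      fderiv ℂ (monom m) z (v i) *
        volForm (k + 1) (Matrix.vecCons w (Matrix.vecCons z (i.removeNth v))) := by
    intro i
    let Λ : (Fin (k + 2) → ℂ) →L[ℝ] ℂ :=
      (ContinuousAlternatingMap.apply ℝ (Fin (k + 2) → ℂ) ℂ (i.removeNth v)) ∘L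
        ((volForm (k + 1)).curryLeft w).curryLeft
    have h1 : HasFDerivAt Λ Λ z := Λ.hasFDerivAt
    have h2 := (hasFDerivAt_monom_real m z).mul h1
    have h3 : (eulerForm₂ m w · (i.removeNth v)) = fun y => monom m y * Λ y := rfl
    rw [h3, HasFDerivAt.fderiv (f := fun y => monom m y * Λ y) h2]
    simp [Λ]
    ring
  simp only [key, smul_add, Finset.sum_add_distrib]
  have hins : ∀ i : Fin (k + 1),
      (-1 : ℤ) ^ (i : ℕ) •
        volForm (k + 1) (Matrix.vecCons w (Matrix.vecCons (v i) (i.removeNth v))) =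
      volForm (k + 1) (Matrix.vecCons w v) := by
    intro i
    have h := ((volForm (k + 1)).curryLeft w).toAlternatingMap.neg_one_pow_smul_map_insertNth
      i (v i) (i.removeNth v)
    rw [Fin.insertNth_self_removeNth] at h
    have h' : (-1 : ℤ) ^ (i : ℕ) • volForm (k + 1) (Matrix.vecCons w v) =
        volForm (k + 1) (Matrix.vecCons w (Matrix.vecCons (v i) (i.removeNth v))) := by
      simpa using h
    rw [← h', smul_smul, ← pow_add, Even.neg_one_pow ⟨_, rfl⟩, one_smul]
  have hA : ∑ i : Fin (k + 1), (-1 : ℤ) ^ (i : ℕ) •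
      (monom m z * volForm (k + 1) (Matrix.vecCons w (Matrix.vecCons (v i) (i.removeNth v)))) =
      ((k : ℂ) + 1) * (monom m z * volForm (k + 1) (Matrix.vecCons w v)) := by
    simp only [← mul_smul_comm, hins]
    simp
  have hB := apply_mul_volForm₂ k (fderiv ℂ (monom m) z) w z v
  rw [fderiv_monom_self] at hB
  have hC : ∑ i : Fin (k + 1), (-1 : ℤ) ^ (i : ℕ) •
      (fderiv ℂ (monom m) z (v i) *
        volForm (k + 1) (Matrix.vecCons w (Matrix.vecCons z (i.removeNth v)))) =
      ((∑ i, m i : ℕ) : ℂ) * monom m z * volForm (k + 1) (Matrix.vecCons w v)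
        - fderiv ℂ (monom m) z w * volForm (k + 1) (Matrix.vecCons z v) := by
    rw [← hB]
    refine Finset.sum_congr rfl fun i _ => ?_
    simp
    ring
  rw [hA, hC]
  ring

/-! ### Stokes' theorem for families of cubical cycles -/

section Stokes

variable {E : Type*} [NormedAddCommGroup E] [NormedSpace ℝ E] {k : ℕ} {V : Set ℂ}

/-- The insertion of a zero at the place `i`, as a continuous linear map. -/
def insertZero (i : Fin (k + 1)) : (Fin k → ℝ) →L[ℝ] (Fin (k + 1) → ℝ) :=
  ContinuousLinearMap.pi
    (i.insertNth (α := fun _ => (Fin k → ℝ) →L[ℝ] ℝ) 0 fun l => ContinuousLinearMap.proj l)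

theorem insertZero_apply (i : Fin (k + 1)) (y : Fin k → ℝ) :
    insertZero i y = i.insertNth (α := fun _ => ℝ) 0 y := by
  funext j
  refine i.succAboveCases ?_ (fun l => ?_) j <;> simp [insertZero]

theorem insertNth_eq_add_insertZero (i : Fin (k + 1)) (ε : ℝ) (y : Fin k → ℝ) :
    i.insertNth (α := fun _ => ℝ) ε y =
      i.insertNth (α := fun _ => ℝ) ε (0 : Fin k → ℝ) + insertZero i y := by
  funext j
  rw [insertZero_apply]
  refine i.succAboveCases ?_ (fun l => ?_) j <;> simp

theorem insertZero_single (i : Fin (k + 1)) (l : Fin k) :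
    insertZero i (Pi.single l 1) = Pi.single (i.succAbove l) 1 := by
  rw [insertZero_apply]
  funext j
  refine i.succAboveCases ?_ (fun l' => ?_) j
  · simp [(Fin.succAbove_ne i l).symm]
  · simp [Pi.single_apply]

theorem hasFDerivAt_insertNth (i : Fin (k + 1)) (ε : ℝ) (y : Fin k → ℝ) :
    HasFDerivAt (fun y : Fin k → ℝ => i.insertNth (α := fun _ => ℝ) ε y) (insertZero i) y := by
  have h : (fun y : Fin k → ℝ => i.insertNth (α := fun _ => ℝ) ε y) = fun y =>
      i.insertNth (α := fun _ => ℝ) ε (0 : Fin k → ℝ) + insertZero i y :=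
    funext (insertNth_eq_add_insertZero i ε)
  rw [h]
  exact (insertZero i).hasFDerivAt.const_add _

open Classical in
/-- The extension of a family of cubes to all parameters and all points of `ℝ ^ k`. -/
def cubeExtend (τ : V → (Fin k → unitInterval) → E) (p : ℂ × (Fin k → ℝ)) : E :=
  if h : p.1 ∈ V then τ ⟨p.1, h⟩ fun l => Set.projIcc 0 1 zero_le_one (p.2 l) else 0

/-- The integral over a family of cubes of a density `κ` in the point, in the derivative with
respect to the parameter in the direction `h`, and in the derivatives with respect to the
coordinates of the cube. -/
def cubeIntegral (κ : E × E × (Fin k → E) → ℂ) (h a : ℂ)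
    (τ : V → (Fin k → unitInterval) → E) : ℂ :=
  ∫ x in Set.univ.pi fun _ => Set.Ioo (0 : ℝ) 1, κ (cubeExtend τ (a, x),
    fderiv ℝ (cubeExtend τ) (a, x) (h, 0),
    fun l => fderiv ℝ (cubeExtend τ) (a, x) (0, Pi.single l 1))

/-- Differentiability is not assumed because degenerate cubes are arbitrary functions; in the other
case `fderiv` has the default value zero. -/
theorem fderiv_eq_zero_of_forall_add_smul {F : Type*} [NormedAddCommGroup F] [NormedSpace ℝ F]
    (f : F → E) (p v : F) (h : ∀ s : ℝ, f (p + s • v) = f p) : fderiv ℝ f p v = 0 := by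
  by_cases hd : DifferentiableAt ℝ f p
  · have h1 : HasDerivAt (fun s : ℝ => p + s • v) v 0 := by
      simpa using ((hasDerivAt_id (0 : ℝ)).smul_const v).const_add p
    have h2 : HasFDerivAt f (fderiv ℝ f p) ((fun s : ℝ => p + s • v) 0) := by
      simpa using hd.hasFDerivAt
    have h3 := h2.comp_hasDerivAt (0 : ℝ) h1
    have h4 : (f ∘ fun s : ℝ => p + s • v) = fun _ => f p := funext h
    rw [h4] at h3
    exact h3.unique (hasDerivAt_const _ _)
  · rw [fderiv_zero_of_not_differentiableAt hd]
    rfl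

/-- Clamping each coordinate separately keeps the extension independent of the idle coordinate, so
one tangent vector vanishes identically. -/
theorem cubeIntegral_of_degenerate (κ : E × E × (Fin k → E) → ℂ)
    (hκ : ∀ z u v, (∃ l, v l = 0) → κ (z, u, v) = 0) (h a : ℂ)
    (τ : V → (Fin k → unitInterval) → E) (hτ : DegenerateCube τ) : cubeIntegral κ h a τ = 0 := by
  obtain ⟨l, hl⟩ := hτ
  have h0 : ∀ x : Fin k → ℝ, fderiv ℝ (cubeExtend τ) (a, x) (0, Pi.single l 1) = 0 := by
    intro x
    apply fderiv_eq_zero_of_forall_add_smul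
    intro s
    have hp : (a, x) + s • ((0 : ℂ), (Pi.single l 1 : Fin k → ℝ)) =
        (a, x + s • Pi.single l 1) := by simp
    rw [hp]
    by_cases ha : a ∈ V
    · simp only [cubeExtend, dif_pos ha]
      apply hl
      intro l' hl'
      simp [Pi.single_eq_of_ne hl']
    · simp only [cubeExtend, dif_neg ha]
  have h1 : ∀ x : Fin k → ℝ, κ (cubeExtend τ (a, x), fderiv ℝ (cubeExtend τ) (a, x) (h, 0),
      fun l => fderiv ℝ (cubeExtend τ) (a, x) (0, Pi.single l 1)) = 0 :=
    fun x => hκ _ _ _ ⟨l, h0 x⟩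
  simp [cubeIntegral, h1]

/-- A face in a chain only remembers its values on the closed cube. On the open cube its clamped
extension agrees with the smooth family, so derivatives are recovered there, and the boundary is a
null set. -/
theorem cubeIntegral_cubeFace (hV : IsOpen V) (κ : E × E × (Fin k → E) → ℂ) (h : ℂ) {a : ℂ}
    (ha : a ∈ V) (σ : ℂ → (Fin (k + 1) → ℝ) → E)
    (hσ : DifferentiableOn ℝ (fun p : ℂ × (Fin (k + 1) → ℝ) => σ p.1 p.2) (V ×ˢ Set.univ))
    (i : Fin (k + 1)) (ε : ℝ) :
    cubeIntegral κ h a (cubeFace V σ i ε) =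
      ∫ y in Set.Icc (0 : Fin k → ℝ) 1, κ (σ a (i.insertNth ε y),
        fderiv ℝ (fun p : ℂ × (Fin (k + 1) → ℝ) => σ p.1 p.2) (a, i.insertNth ε y) (h, 0),
        fun l => fderiv ℝ (fun p : ℂ × (Fin (k + 1) → ℝ) => σ p.1 p.2) (a, i.insertNth ε y)
          (0, Pi.single (i.succAbove l) 1)) := by
  have hae : (Set.univ.pi fun _ : Fin k => Set.Ioo (0 : ℝ) 1)
      =ᵐ[MeasureTheory.volume] Set.Icc (0 : Fin k → ℝ) 1 :=
    MeasureTheory.Measure.univ_pi_Ioo_ae_eq_Icc (f := (0 : Fin k → ℝ)) (g := 1)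
  rw [cubeIntegral, ← MeasureTheory.setIntegral_congr_set hae]
  have hopen : IsOpen (Set.univ.pi fun _ : Fin k => Set.Ioo (0 : ℝ) 1) :=
    isOpen_set_pi Set.finite_univ fun _ _ => isOpen_Ioo
  refine MeasureTheory.setIntegral_congr_fun hopen.measurableSet fun y hy => ?_
  have hext : ∀ p ∈ V ×ˢ (Set.univ.pi fun _ : Fin k => Set.Ioo (0 : ℝ) 1),
      cubeExtend (cubeFace V σ i ε) p = σ p.1 (i.insertNth ε p.2) := by
    rintro ⟨b, x⟩ ⟨hb, hx⟩
    have hb : b ∈ V := hb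
    rw [cubeExtend, dif_pos hb, cubeFace]
    have : (fun l => ((Set.projIcc (0 : ℝ) 1 zero_le_one (x l) : unitInterval) : ℝ)) = x := by
      funext l
      rw [Set.projIcc_of_mem zero_le_one (Set.Ioo_subset_Icc_self (hx l trivial))]
    simp only [this]
  have hmem : (a, y) ∈ V ×ˢ (Set.univ.pi fun _ : Fin k => Set.Ioo (0 : ℝ) 1) := ⟨ha, hy⟩
  have hev : cubeExtend (cubeFace V σ i ε) =ᶠ[𝓝 (a, y)]
      fun p => σ p.1 (i.insertNth ε p.2) :=
    Filter.eventually_of_mem ((hV.prod hopen).mem_nhds hmem) hext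
  have hd : HasFDerivAt (fun p : ℂ × (Fin (k + 1) → ℝ) => σ p.1 p.2)
      (fderiv ℝ (fun p : ℂ × (Fin (k + 1) → ℝ) => σ p.1 p.2) (a, i.insertNth ε y))
      (a, i.insertNth ε y) :=
    (hσ.differentiableAt ((hV.prod isOpen_univ).mem_nhds ⟨ha, trivial⟩)).hasFDerivAt
  have hins : HasFDerivAt (fun p : ℂ × (Fin k → ℝ) =>
      ((p.1, i.insertNth ε p.2) : ℂ × (Fin (k + 1) → ℝ)))
      ((ContinuousLinearMap.fst ℝ ℂ (Fin k → ℝ)).prod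
        ((insertZero i).comp (ContinuousLinearMap.snd ℝ ℂ (Fin k → ℝ)))) (a, y) :=
    hasFDerivAt_fst.prodMk (HasFDerivAt.comp (g := fun y : Fin k → ℝ =>
      i.insertNth (α := fun _ => ℝ) ε y) (f := Prod.snd) (a, y) (hasFDerivAt_insertNth i ε y)
      hasFDerivAt_snd)
  have hD := (HasFDerivAt.comp (a, y) (by exact hd) hins).congr_of_eventuallyEq hev
  simp only [hD.fderiv, hext _ hmem]
  simp [insertZero_single]

/-- Stokes' theorem for a family of cubical cycles. -/
theorem stokes_of_isCubicalCycle (hV : IsOpen V) {N : ℕ} (c : Fin N → ℂ)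
    (σ : Fin N → ℂ → (Fin (k + 1) → ℝ) → E)
    (hσ : ∀ j, ContDiffOn ℝ ∞ (fun p : ℂ × (Fin (k + 1) → ℝ) => σ j p.1 p.2) (V ×ˢ Set.univ))
    (hcyc : IsCubicalCycle V c (k + 1) σ) (κ : E × E × (Fin k → E) → ℂ) (hκ1 : ContDiff ℝ 1 κ)
    (hκ : ∀ z u v, (∃ l, v l = 0) → κ (z, u, v) = 0) (h : ℂ) {a : ℂ} (ha : a ∈ V) :
    ∑ j, c j * ∫ x in Set.Icc (0 : Fin (k + 1) → ℝ) 1, ∑ i : Fin (k + 1), (-1 : ℂ) ^ (i : ℕ) *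
      fderiv ℝ (fun x => κ (σ j a x,
        fderiv ℝ (fun p : ℂ × (Fin (k + 1) → ℝ) => σ j p.1 p.2) (a, x) (h, 0),
        fun l => fderiv ℝ (fun p : ℂ × (Fin (k + 1) → ℝ) => σ j p.1 p.2) (a, x)
          (0, Pi.single (i.succAbove l) 1))) x (Pi.single i 1) = 0 := by
  have hsm : ∀ j (i : Fin (k + 1)), ContDiff ℝ 1 (fun x => κ (σ j a x,
        fderiv ℝ (fun p : ℂ × (Fin (k + 1) → ℝ) => σ j p.1 p.2) (a, x) (h, 0),
        fun l => fderiv ℝ (fun p : ℂ × (Fin (k + 1) → ℝ) => σ j p.1 p.2) (a, x)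
          (0, Pi.single (i.succAbove l) 1))) := by
    intro j i
    have h1 : ContDiffOn ℝ 1 (fderiv ℝ (fun p : ℂ × (Fin (k + 1) → ℝ) => σ j p.1 p.2))
        (V ×ˢ Set.univ) :=
      (hσ j).fderiv_of_isOpen (hV.prod isOpen_univ) (by norm_cast)
    have h2 : ContDiff ℝ 1 fun x : Fin (k + 1) → ℝ => (a, x) := contDiff_prodMk_right a
    have h3 : ContDiff ℝ 1 fun x : Fin (k + 1) → ℝ =>
        fderiv ℝ (fun p : ℂ × (Fin (k + 1) → ℝ) => σ j p.1 p.2) (a, x) :=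
      contDiffOn_univ.1 (h1.comp h2.contDiffOn fun x _ => ⟨ha, trivial⟩)
    have h4 : ContDiff ℝ 1 fun x : Fin (k + 1) → ℝ => σ j a x :=
      contDiffOn_univ.1 (((hσ j).of_le (by norm_cast)).comp h2.contDiffOn
        fun x _ => ⟨ha, trivial⟩)
    refine hκ1.comp (h4.prodMk ((h3.clm_apply contDiff_const).prodMk ?_))
    exact contDiff_pi.2 fun l => h3.clm_apply contDiff_const
  have hdiv : ∀ j, ∫ x in Set.Icc (0 : Fin (k + 1) → ℝ) 1,
      ∑ i : Fin (k + 1), (-1 : ℂ) ^ (i : ℕ) *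
      fderiv ℝ (fun x => κ (σ j a x,
        fderiv ℝ (fun p : ℂ × (Fin (k + 1) → ℝ) => σ j p.1 p.2) (a, x) (h, 0),
        fun l => fderiv ℝ (fun p : ℂ × (Fin (k + 1) → ℝ) => σ j p.1 p.2) (a, x)
          (0, Pi.single (i.succAbove l) 1))) x (Pi.single i 1) =
      ∑ i : Fin (k + 1), (-1 : ℂ) ^ (i : ℕ) * (cubeIntegral κ h a (cubeFace V (σ j) i 1)
        - cubeIntegral κ h a (cubeFace V (σ j) i 0)) := by
    intro j
    have hσd := (hσ j).differentiableOn (by simp)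
    simp only [cubeIntegral_cubeFace hV κ h ha (σ j) hσd]
    have hs : ∀ i : Fin (k + 1), ContDiff ℝ 1 (fun x => (-1 : ℂ) ^ (i : ℕ) * κ (σ j a x,
        fderiv ℝ (fun p : ℂ × (Fin (k + 1) → ℝ) => σ j p.1 p.2) (a, x) (h, 0),
        fun l => fderiv ℝ (fun p : ℂ × (Fin (k + 1) → ℝ) => σ j p.1 p.2) (a, x)
          (0, Pi.single (i.succAbove l) 1))) := fun i => contDiff_const.mul (hsm j i)
    -- The vector field has `i`-th component `(-1)^i κ`, with the `i`-th tangent vector left out of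
    -- `κ`; its flux through the faces is the integral of `κ` over the cubical boundary.
    have := MeasureTheory.integral_divergence_of_hasFDerivAt_off_countable'
      (0 : Fin (k + 1) → ℝ) 1 (fun _ => zero_le_one) _ (fun i => fderiv ℝ _) ∅ Set.countable_empty
      (fun i => (hs i).continuous.continuousOn)
      (fun x _ i => ((hs i).differentiable one_ne_zero x).hasFDerivAt)
      (by
        refine ContinuousOn.integrableOn_compact isCompact_Icc ?_
        refine (continuous_finsetSum _ fun i _ => ?_).continuousOn
        exact ((hs i).continuous_fderiv one_ne_zero).clm_apply continuous_const)
    have hcm : ∀ (i : Fin (k + 1)) x, fderiv ℝ (fun x => (-1 : ℂ) ^ (i : ℕ) * κ (σ j a x,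
        fderiv ℝ (fun p : ℂ × (Fin (k + 1) → ℝ) => σ j p.1 p.2) (a, x) (h, 0),
        fun l => fderiv ℝ (fun p : ℂ × (Fin (k + 1) → ℝ) => σ j p.1 p.2) (a, x)
          (0, Pi.single (i.succAbove l) 1))) x (Pi.single i 1) = (-1 : ℂ) ^ (i : ℕ) *
        fderiv ℝ (fun x => κ (σ j a x,
        fderiv ℝ (fun p : ℂ × (Fin (k + 1) → ℝ) => σ j p.1 p.2) (a, x) (h, 0),
        fun l => fderiv ℝ (fun p : ℂ × (Fin (k + 1) → ℝ) => σ j p.1 p.2) (a, x)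
          (0, Pi.single (i.succAbove l) 1))) x (Pi.single i 1) := by
      intro i x
      rw [fderiv_const_mul ((hsm j i).differentiable one_ne_zero x)]
      rfl
    simp only [hcm] at this
    rw [this]
    refine Finset.sum_congr rfl fun i _ => ?_
    rw [MeasureTheory.integral_const_mul, MeasureTheory.integral_const_mul, mul_sub]
    rfl
  simp only [hdiv]
  -- Extended linearly to chains, `cubeIntegral` kills the span of the degenerate cubes, which
  -- contains the boundary of a cycle.
  have hL : ∀ s ∈ Submodule.span ℂ {s | ∃ τ : V → (Fin k → unitInterval) → E,
      DegenerateCube τ ∧ s = Finsupp.single τ 1},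
      Finsupp.linearCombination ℂ (cubeIntegral κ h a (V := V)) s = 0 := by
    intro s hs
    have : Submodule.span ℂ {s | ∃ τ : V → (Fin k → unitInterval) → E,
        DegenerateCube τ ∧ s = Finsupp.single τ 1} ≤
        LinearMap.ker (Finsupp.linearCombination ℂ (cubeIntegral κ h a (V := V))) := by
      rw [Submodule.span_le]
      rintro _ ⟨τ, hτ, rfl⟩
      simp [cubeIntegral_of_degenerate κ hκ h a τ hτ]
    exact this hs
  have := hL _ hcyc
  simp only [map_sum, map_smul, map_sub, Finsupp.linearCombination_single, smul_eq_mul] at this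
  rw [← this]
  refine Finset.sum_congr rfl fun j _ => ?_
  rw [Finset.mul_sum]
  exact Finset.sum_congr rfl fun i _ => by ring

end Stokes

/-! ### Differential and algebraic relations between the periods -/

/-- Differentiation under the integral sign; continuity of the derivative on the compact product of
a closed ball and `K` supplies the dominating constant. -/
theorem hasFDerivAt_setIntegral_of_contDiffOn {G : Type*} [NormedAddCommGroup G] [NormedSpace ℝ G]
    [MeasurableSpace G] [BorelSpace G] [SecondCountableTopology G] (μ : MeasureTheory.Measure G)
    [MeasureTheory.IsFiniteMeasureOnCompacts μ] {K : Set G} (hK : IsCompact K) {V : Set ℂ}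
    (hV : IsOpen V) {f : ℂ × G → ℂ} (hf : ContDiffOn ℝ 1 f (V ×ˢ Set.univ)) {a : ℂ} (ha : a ∈ V) :
    ∃ D : ℂ →L[ℝ] ℂ, HasFDerivAt (fun b => ∫ x in K, f (b, x) ∂μ) D a ∧
      ∀ h, D h = ∫ x in K, fderiv ℝ f (a, x) (h, 0) ∂μ := by
  obtain ⟨r, hr, hball⟩ := Metric.isOpen_iff.1 hV a ha
  have hsub : Metric.closedBall a (r / 2) ⊆ V :=
    (Metric.closedBall_subset_ball (by linarith)).trans hball
  have hcf : ContinuousOn (fderiv ℝ f) (V ×ˢ Set.univ) :=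
    hf.continuousOn_fderiv_of_isOpen (hV.prod isOpen_univ) le_rfl
  have hcomp : IsCompact (Metric.closedBall a (r / 2) ×ˢ K) :=
    (isCompact_closedBall a (r / 2)).prod hK
  obtain ⟨C, hC⟩ := hcomp.exists_bound_of_continuousOn
    (hcf.mono fun p hp => ⟨hsub hp.1, trivial⟩)
  have hslice : ∀ b ∈ V, Continuous fun x => f (b, x) := fun b hb =>
    continuousOn_univ.1 (hf.continuousOn.comp (by fun_prop) fun x _ => ⟨hb, trivial⟩)
  have hslice' : Continuous fun x =>
      (fderiv ℝ f (a, x)).comp (ContinuousLinearMap.inl ℝ ℂ G) := by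
    have : Continuous fun x => fderiv ℝ f (a, x) :=
      continuousOn_univ.1 (hcf.comp (by fun_prop) fun x _ => ⟨ha, trivial⟩)
    exact this.clm_comp continuous_const
  have hint : MeasureTheory.IntegrableOn (fun x =>
      (fderiv ℝ f (a, x)).comp (ContinuousLinearMap.inl ℝ ℂ G)) K μ :=
    hslice'.continuousOn.integrableOn_compact hK
  refine ⟨∫ x in K, (fderiv ℝ f (a, x)).comp (ContinuousLinearMap.inl ℝ ℂ G) ∂μ, ?_, ?_⟩
  · refine hasFDerivAt_integral_of_dominated_of_fderiv_le (bound := fun _ => C)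
      (F' := fun b x => (fderiv ℝ f (b, x)).comp (ContinuousLinearMap.inl ℝ ℂ G))
      (Metric.ball_mem_nhds a (half_pos hr)) ?_ ?_ ?_ ?_ ?_ ?_
    · filter_upwards [hV.mem_nhds ha] with b hb
      exact (hslice b hb).aestronglyMeasurable
    · exact (hslice a ha).continuousOn.integrableOn_compact hK
    · exact hslice'.aestronglyMeasurable
    · refine MeasureTheory.ae_restrict_of_forall_mem hK.measurableSet fun x hx b hb => ?_
      refine (ContinuousLinearMap.opNorm_comp_le _ _).trans ?_
      have h1 := hC (b, x) ⟨Metric.ball_subset_closedBall hb, hx⟩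
      have h2 := ContinuousLinearMap.norm_inl_le_one ℝ ℂ G
      calc _ ≤ ‖fderiv ℝ f (b, x)‖ * 1 := by gcongr
        _ ≤ C := by simpa using h1
    · exact MeasureTheory.integrableOn_const hK.measure_ne_top
    · refine Filter.Eventually.of_forall fun x b hb => ?_
      have hbV : b ∈ V := hsub (Metric.ball_subset_closedBall hb)
      have h1 : HasFDerivAt f (fderiv ℝ f (b, x)) (b, x) :=
        ((hf.differentiableOn one_ne_zero).differentiableAt
          ((hV.prod isOpen_univ).mem_nhds ⟨hbV, trivial⟩)).hasFDerivAt
      exact h1.comp b (hasFDerivAt_prodMk_left b x)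
  · intro h
    rw [ContinuousLinearMap.integral_apply hint]
    rfl

/-- Cycles move only real-smoothly with `a`. Holomorphy of a period comes from here, once its real
differential is known to be multiplication by a complex number. -/
theorem HasFDerivAt.hasDerivAt_of_real {f : ℂ → ℂ} {D : ℂ →L[ℝ] ℂ} {a c : ℂ}
    (hf : HasFDerivAt f D a) (hD : ∀ h, D h = h * c) : HasDerivAt f c a := by
  rw [hasDerivAt_iff_hasFDerivAt]
  refine hasFDerivAt_of_restrictScalars ℝ hf ?_
  ext
  simp [hD]

theorem gelfandLeray_eq (n : ℕ) (m : Fin (n + 1) → ℕ) (t : ℂ) (z : Fin (n + 1) → ℂ)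
    (v : Fin n → Fin (n + 1) → ℂ) :
    gelfandLeray n m t z v = eulerForm m z v / (((n : ℂ) + 1) * t) := rfl

theorem gelfandLeray_eq_mul (n : ℕ) (m : Fin (n + 1) → ℕ) (t : ℂ) (z : Fin (n + 1) → ℂ)
    (v : Fin n → Fin (n + 1) → ℂ) :
    gelfandLeray n m t z v = monom m z * gelfandLeray n 0 t z v := by
  simp [gelfandLeray, monom, mul_div_assoc]

namespace FlatCycle

variable {n : ℕ} {t : ℂ} {V : Set ℂ} (γ : FlatCycle n t V)

/-- The `j`-th cube as a function of the parameter and the point. -/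
def fam (j : Fin γ.N) (p : ℂ × (Fin n → ℝ)) : Fin (n + 1) → ℂ := γ.cube j p.1 p.2

/-- The tangent vectors of the `j`-th cube. -/
def tangent (j : Fin γ.N) (a : ℂ) (x : Fin n → ℝ) (l : Fin n) : Fin (n + 1) → ℂ :=
  fderiv ℝ (γ.fam j) (a, x) (0, Pi.single l 1)

theorem contDiffAt_fam (hV : IsOpen V) (j : Fin γ.N) {a : ℂ} (ha : a ∈ V) (x : Fin n → ℝ) :
    ContDiffAt ℝ ∞ (γ.fam j) (a, x) :=
  (γ.smooth j).contDiffAt ((hV.prod isOpen_univ).mem_nhds ⟨ha, trivial⟩)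

theorem hasFDerivAt_fam (hV : IsOpen V) (j : Fin γ.N) {a : ℂ} (ha : a ∈ V) (x : Fin n → ℝ) :
    HasFDerivAt (γ.fam j) (fderiv ℝ (γ.fam j) (a, x)) (a, x) :=
  ((γ.contDiffAt_fam hV j ha x).differentiableAt (by simp)).hasFDerivAt

theorem contDiff_cube (hV : IsOpen V) (j : Fin γ.N) {a : ℂ} (ha : a ∈ V) :
    ContDiff ℝ ∞ (γ.cube j a) :=
  contDiff_iff_contDiffAt.2 fun x =>
    (γ.contDiffAt_fam hV j ha x).comp x (contDiff_prodMk_right a).contDiffAt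

theorem hasFDerivAt_cube (hV : IsOpen V) (j : Fin γ.N) {a : ℂ} (ha : a ∈ V) (x : Fin n → ℝ) :
    HasFDerivAt (γ.cube j a)
      ((fderiv ℝ (γ.fam j) (a, x)).comp (ContinuousLinearMap.inr ℝ ℂ (Fin n → ℝ))) x :=
  (γ.hasFDerivAt_fam hV j ha x).comp x (hasFDerivAt_prodMk_right a x)

theorem tangent_eq (hV : IsOpen V) (j : Fin γ.N) {a : ℂ} (ha : a ∈ V) (x : Fin n → ℝ)
    (l : Fin n) : γ.tangent j a x l = fderiv ℝ (γ.cube j a) x (Pi.single l 1) := by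
  rw [(γ.hasFDerivAt_cube hV j ha x).fderiv]
  rfl

theorem contDiffOn_fderiv_fam (hV : IsOpen V) (j : Fin γ.N) :
    ContDiffOn ℝ 1 (fderiv ℝ (γ.fam j)) (V ×ˢ Set.univ) :=
  (γ.smooth j).fderiv_of_isOpen (hV.prod isOpen_univ) (by norm_cast)

/-- The derivative of the equation `f_a = t` along a cube. -/
theorem fderiv_dwork_fam (hV : IsOpen V) (j : Fin γ.N) {a : ℂ} (ha : a ∈ V) {x : Fin n → ℝ}
    (hx : x ∈ Set.univ.pi fun _ : Fin n => Set.Ioo (0 : ℝ) 1) (w : ℂ × (Fin n → ℝ)) :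
    fderiv ℂ (dwork n a) (γ.cube j a x) (fderiv ℝ (γ.fam j) (a, x) w) =
      w.1 * ∏ i, γ.cube j a x i := by
  have hF := γ.hasFDerivAt_fam hV j ha x
  have hopen : IsOpen (Set.univ.pi fun _ : Fin n => Set.Ioo (0 : ℝ) 1) :=
    isOpen_set_pi Set.finite_univ fun _ _ => isOpen_Ioo
  have h1 : HasFDerivAt (fun p => dwork n a (γ.fam j p))
      (((fderiv ℂ (dwork n a) (γ.cube j a x)).restrictScalars ℝ).comp
        (fderiv ℝ (γ.fam j) (a, x))) (a, x) :=
    HasFDerivAt.comp (g := dwork n a) (f := γ.fam j) (a, x)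
      ((dwork_differentiable n a (γ.cube j a x)).hasFDerivAt.restrictScalars ℝ) hF
  -- On the moving cube `f_b = t`; freezing the parameter of `f` at `a` adds `(b - a) ∏ z_i`, whose
  -- derivative at `b = a` sees only the factor `b - a`.
  have h2 : (fun p => dwork n a (γ.fam j p)) =ᶠ[𝓝 (a, x)]
      fun p => t + (p.1 - a) * monom 1 (γ.fam j p) := by
    filter_upwards [(hV.prod hopen).mem_nhds ⟨ha, hx⟩] with p hp
    have h3 := γ.mem_fibre j p.1 hp.1 p.2
      ⟨fun i => (hp.2 i trivial).1.le, fun i => (hp.2 i trivial).2.le⟩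
    rw [monom_one]
    simp only [dwork, fam] at h3 ⊢
    linear_combination h3
  have h4 : DifferentiableAt ℝ (fun p => monom 1 (γ.fam j p)) (a, x) :=
    ((contDiff_monom (𝕜 := ℝ) (r := 1) 1).differentiable one_ne_zero _).comp (a, x)
      hF.differentiableAt
  have h5 : HasFDerivAt (fun p : ℂ × (Fin n → ℝ) => p.1 - a)
      (ContinuousLinearMap.fst ℝ ℂ (Fin n → ℝ)) (a, x) := hasFDerivAt_fst.sub_const a
  have h6 := (h5.mul h4.hasFDerivAt).const_add t
  have h7 := h1.unique (h6.congr_of_eventuallyEq h2)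
  have h8 := congrArg (fun L => L w) h7
  simp only [ContinuousLinearMap.comp_apply, ContinuousLinearMap.coe_restrictScalars'] at h8
  rw [h8]
  simp [monom_one, fam, mul_comm]

theorem fderiv_dwork_tangent (hV : IsOpen V) (j : Fin γ.N) {a : ℂ} (ha : a ∈ V) {x : Fin n → ℝ}
    (hx : x ∈ Set.univ.pi fun _ : Fin n => Set.Ioo (0 : ℝ) 1) (l : Fin n) :
    fderiv ℂ (dwork n a) (γ.cube j a x) (γ.tangent j a x l) = 0 := by
  rw [tangent, γ.fderiv_dwork_fam hV j ha hx]
  simp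

/-! ### Integration over a flat cycle and its vanishing on exact forms. -/

/-- The integral of a function of the points of the cubes and their tangent vectors. -/
def integral (F : (j : Fin γ.N) → (Fin n → ℝ) → ℂ) : ℂ :=
  ∑ j, γ.coeff j * ∫ x in Set.Icc (0 : Fin n → ℝ) 1, F j x

/-- The fibre equation is assumed on the closed cube only, so it can be differentiated just in the
interior; the boundary does not affect integrals. -/
theorem integral_congr {F F' : (j : Fin γ.N) → (Fin n → ℝ) → ℂ}
    (h : ∀ j, ∀ x ∈ Set.univ.pi fun _ : Fin n => Set.Ioo (0 : ℝ) 1, F j x = F' j x) :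
    γ.integral F = γ.integral F' := by
  have hae : (Set.univ.pi fun _ : Fin n => Set.Ioo (0 : ℝ) 1)
      =ᵐ[MeasureTheory.volume] Set.Icc (0 : Fin n → ℝ) 1 :=
    MeasureTheory.Measure.univ_pi_Ioo_ae_eq_Icc (f := (0 : Fin n → ℝ)) (g := 1)
  have hopen : IsOpen (Set.univ.pi fun _ : Fin n => Set.Ioo (0 : ℝ) 1) :=
    isOpen_set_pi Set.finite_univ fun _ _ => isOpen_Ioo
  refine Finset.sum_congr rfl fun j _ => ?_
  congr 1
  rw [← MeasureTheory.setIntegral_congr_set hae, ← MeasureTheory.setIntegral_congr_set hae]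
  exact MeasureTheory.setIntegral_congr_fun hopen.measurableSet fun x hx => h j x hx


theorem integral_const_mul (c : ℂ) (F : (j : Fin γ.N) → (Fin n → ℝ) → ℂ) :
    γ.integral (fun j x => c * F j x) = c * γ.integral F := by
  simp only [integral, MeasureTheory.integral_const_mul, Finset.mul_sum]
  exact Finset.sum_congr rfl fun j _ => by ring

theorem integral_sub {F F' : (j : Fin γ.N) → (Fin n → ℝ) → ℂ} (hF : ∀ j, Continuous (F j))
    (hF' : ∀ j, Continuous (F' j)) :
    γ.integral (fun j x => F j x - F' j x) = γ.integral F - γ.integral F' := by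
  rw [integral, integral, integral, ← Finset.sum_sub_distrib]
  refine Finset.sum_congr rfl fun j _ => ?_
  rw [MeasureTheory.integral_sub ((hF j).continuousOn.integrableOn_compact isCompact_Icc)
    ((hF' j).continuousOn.integrableOn_compact isCompact_Icc), mul_sub]

/-- The Gelfand-Leray residue on the `j`-th cube. -/
def residue (m : Fin (n + 1) → ℕ) (a : ℂ) (j : Fin γ.N) (x : Fin n → ℝ) : ℂ :=
  gelfandLeray n m t (γ.cube j a x) (γ.tangent j a x)

theorem period_eq (hV : IsOpen V) (m : Fin (n + 1) → ℕ) {a : ℂ} (ha : a ∈ V) :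
    γ.period m a = γ.integral (γ.residue m a) := by
  refine Finset.sum_congr rfl fun j _ => ?_
  congr 2
  funext x
  rw [residue]
  congr 1
  funext l
  rw [γ.tangent_eq hV j ha]

theorem contDiff_eulerForm_apply (m : Fin (n + 1) → ℕ) : ContDiff ℝ 1
    fun p : (Fin (n + 1) → ℂ) × (Fin n → Fin (n + 1) → ℂ) => eulerForm m p.1 p.2 := by
  have h : ContDiff ℝ 1 fun p : (Fin (n + 1) → ℂ) × (Fin n → Fin (n + 1) → ℂ) =>
      (Matrix.vecCons p.1 p.2 : Fin (n + 1) → Fin (n + 1) → ℂ) := by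
    refine contDiff_pi.2 fun i => ?_
    refine Fin.cases ?_ (fun l => ?_) i
    · exact contDiff_fst
    · exact (contDiff_apply ℝ (Fin (n + 1) → ℂ) l).comp contDiff_snd
  exact ((contDiff_monom m).comp contDiff_fst).mul
    ((volForm n).toContinuousMultilinearMap.contDiff.comp h)

theorem contDiffOn_eulerForm_apply (m : Fin (n + 1) → ℕ) {F : Type*} [NormedAddCommGroup F]
    [NormedSpace ℝ F] {s : Set F} {f : F → Fin (n + 1) → ℂ} {g : F → Fin n → Fin (n + 1) → ℂ}
    (hf : ContDiffOn ℝ 1 f s) (hg : ContDiffOn ℝ 1 g s) :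
    ContDiffOn ℝ 1 (fun p => eulerForm m (f p) (g p)) s := by
  have h1 := hf.prodMk hg
  have h2 := ContDiff.comp_contDiffOn
    (g := fun p : (Fin (n + 1) → ℂ) × (Fin n → Fin (n + 1) → ℂ) => eulerForm m p.1 p.2)
    (contDiff_eulerForm_apply m) h1
  exact h2

theorem contDiffOn_eulerForm_fam (hV : IsOpen V) (m : Fin (n + 1) → ℕ) (j : Fin γ.N) :
    ContDiffOn ℝ 1 (fun p => eulerForm m (γ.fam j p)
      fun l => fderiv ℝ (γ.fam j) p (0, Pi.single l 1)) (V ×ˢ Set.univ) := by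
  have h1 : ContDiffOn ℝ 1 (γ.fam j) (V ×ˢ Set.univ) := (γ.smooth j).of_le (by norm_cast)
  have h2 : ContDiffOn ℝ 1 (fun p => fun l : Fin n =>
      fderiv ℝ (γ.fam j) p (0, Pi.single l 1)) (V ×ˢ Set.univ) :=
    contDiffOn_pi.2 fun l => (γ.contDiffOn_fderiv_fam hV j).clm_apply contDiffOn_const
  exact contDiffOn_eulerForm_apply m h1 h2

theorem continuous_residue (hV : IsOpen V) (m : Fin (n + 1) → ℕ) {a : ℂ} (ha : a ∈ V)
    (j : Fin γ.N) : Continuous (γ.residue m a j) := by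
  have h : Continuous fun x : Fin n → ℝ => eulerForm m (γ.cube j a x) (γ.tangent j a x) :=
    continuousOn_univ.1 ((γ.contDiffOn_eulerForm_fam hV m j).continuousOn.comp
      (f := fun x : Fin n → ℝ => (a, x)) (by fun_prop) fun x _ => ⟨ha, trivial⟩)
  exact h.div_const _

theorem residue_eq_mul (m : Fin (n + 1) → ℕ) (a : ℂ) (j : Fin γ.N) (x : Fin n → ℝ) :
    γ.residue m a j x = monom m (γ.cube j a x) * γ.residue 0 a j x :=
  gelfandLeray_eq_mul n m t _ _

theorem eulerForm_eq_residue (ht : t ≠ 0) (m : Fin (n + 1) → ℕ) (a : ℂ) (j : Fin γ.N)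
    (x : Fin n → ℝ) :
    eulerForm m (γ.cube j a x) (γ.tangent j a x) = ((n : ℂ) + 1) * t * γ.residue m a j x := by
  have hn : ((n : ℂ) + 1) ≠ 0 := by exact_mod_cast Nat.succ_ne_zero n
  rw [residue, gelfandLeray_eq]
  field_simp

/-- The Gelfand-Leray residue determines the volume form. -/
theorem monom_mul_volForm (hV : IsOpen V) (ht : t ≠ 0) (m : Fin (n + 1) → ℕ) {a : ℂ} (ha : a ∈ V)
    (j : Fin γ.N) {x : Fin n → ℝ} (hx : x ∈ Set.univ.pi fun _ : Fin n => Set.Ioo (0 : ℝ) 1)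
    (w : Fin (n + 1) → ℂ) :
    monom m (γ.cube j a x) * volForm n (Matrix.vecCons w (γ.tangent j a x)) =
      fderiv ℂ (dwork n a) (γ.cube j a x) w * γ.residue m a j x :=
  (gelfandLeray_spec n m a t ht (γ.cube j a x) (γ.mem_fibre j a ha x
    ⟨fun i => (hx i trivial).1.le, fun i => (hx i trivial).2.le⟩) w (γ.tangent j a x)
    fun i => γ.fderiv_dwork_tangent hV j ha hx i).symm

/-- The integral of `d (z ^ q ι_E ι_p Ω)` vanishes. -/
theorem integral_extDeriv_eulerForm₂ {k : ℕ} (γ : FlatCycle (k + 1) t V) (hV : IsOpen V)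
    (ht : t ≠ 0) (q : Fin (k + 2) → ℕ) (p : Fin (k + 2)) {a : ℂ} (ha : a ∈ V) :
    γ.integral (fun j x => (((∑ i, q i : ℕ) : ℂ) + k + 1) *
        (fderiv ℂ (dwork (k + 1) a) (γ.cube j a x) (Pi.single p 1) * γ.residue q a j x)
      - ((k : ℂ) + 2) * t *
        (fderiv ℂ (monom q) (γ.cube j a x) (Pi.single p 1) * γ.residue 0 a j x)) = 0 := by
  let w : Fin (k + 2) → ℂ := Pi.single p 1
  have hκ1 : ContDiff ℝ 1 fun y : (Fin (k + 2) → ℂ) × (Fin (k + 2) → ℂ) ×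
      (Fin k → Fin (k + 2) → ℂ) => eulerForm₂ q w y.1 y.2.2 := by
    have h : ContDiff ℝ 1 fun y : (Fin (k + 2) → ℂ) × (Fin (k + 2) → ℂ) ×
      (Fin k → Fin (k + 2) → ℂ) =>
        (Matrix.vecCons w (Matrix.vecCons y.1 y.2.2) : Fin (k + 2) → Fin (k + 2) → ℂ) := by
      refine contDiff_pi.2 fun i => ?_
      refine Fin.cases contDiff_const (fun l => Fin.cases contDiff_fst (fun l => ?_) l) i
      exact (contDiff_apply ℝ (Fin (k + 2) → ℂ) l).comp (contDiff_snd.comp contDiff_snd)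
    exact ((contDiff_monom q).comp contDiff_fst).mul
      ((volForm (k + 1)).toContinuousMultilinearMap.contDiff.comp h)
  -- The density does not involve the parameter derivative, so the direction `0` serves.
  have hst := stokes_of_isCubicalCycle hV γ.coeff γ.cube γ.smooth γ.cycle
    (fun y => eulerForm₂ q w y.1 y.2.2) hκ1
    (fun z u v ⟨l, hl⟩ => (eulerForm₂ q w z).toContinuousMultilinearMap.map_coord_zero l hl) 0 ha
  rw [← hst]
  refine (γ.integral_congr fun j x hx => ?_).trans rfl
  have hc := γ.contDiff_cube hV j ha
  have hw : DifferentiableAt ℝ (eulerForm₂ q w) (γ.cube j a x) :=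
    (contDiff_eulerForm₂ q w).differentiable (by simp) _
  -- The exterior derivative commutes with pullback to the cube; on the coordinate vectors the
  -- derivative of the pulled-back form is the integrand in Stokes' theorem.
  have hpb := extDeriv_pullback hw (hc.contDiffAt (x := x))
    (by rw [minSmoothness_of_isRCLikeNormedField]; norm_cast)
  have hpb' := congrArg (fun L => L fun l => (Pi.single l 1 : Fin (k + 1) → ℝ)) hpb
  have hT : ∀ y (l : Fin (k + 1)), fderiv ℝ (γ.cube j a) y (Pi.single l 1) = γ.tangent j a y l :=
    fun y l => (γ.tangent_eq hV j ha y l).symm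
  have hd : DifferentiableAt ℝ (fun x => (eulerForm₂ q w (γ.cube j a x)).compContinuousLinearMap
      (fderiv ℝ (γ.cube j a) x)) x := by
    refine DifferentiableAt.continuousAlternatingMapCompContinuousLinearMap ?_ ?_
    · exact ((contDiff_eulerForm₂ q w).differentiable (by simp) _).comp x
        (hc.differentiable (by simp) x)
    · exact (hc.fderiv_right (m := 1) (by norm_cast)).differentiable one_ne_zero x
  rw [extDeriv_apply hd] at hpb'
  simp only [ContinuousAlternatingMap.compContinuousLinearMap_apply, Function.comp_def, hT,
    extDeriv_eulerForm₂] at hpb'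
  have e1 := γ.monom_mul_volForm hV ht q ha j hx w
  have e2 := γ.eulerForm_eq_residue ht 0 a j x
  rw [eulerForm_apply] at e2
  have e3 : volForm (k + 1) (Matrix.vecCons (γ.cube j a x) (γ.tangent j a x)) =
      ((k : ℂ) + 2) * t * γ.residue 0 a j x := by
    simp only [monom, Pi.zero_apply, pow_zero, Finset.prod_const_one, one_mul] at e2
    rw [e2]
    push_cast
    ring
  have e4 : (fun i => γ.tangent j a x i) = γ.tangent j a x := rfl
  rw [e4, e1, e3] at hpb'
  calc _ = _ := by ring
    _ = _ := hpb'.symm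
    _ = _ := by
      refine Finset.sum_congr rfl fun i _ => ?_
      simp only [Fin.removeNth, hT]
      simp
      rfl

end FlatCycle

/-! ### Relations between periods, and their derivatives in the parameter. -/

namespace FlatCycle

variable {n : ℕ} {t : ℂ} {V : Set ℂ}

theorem fderiv_dwork_mul_monom (n : ℕ) (a : ℂ) (z : Fin (n + 1) → ℂ) (m : Fin (n + 1) → ℕ)
    (p : Fin (n + 1)) :
    fderiv ℂ (dwork n a) z (Pi.single p 1) * monom m z =
      ((n : ℂ) + 1) * monom (m + Pi.single p n) z
        - a * ((∏ i ∈ Finset.univ.erase p, z i) * monom m z) := by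
  rw [fderiv_dwork_single, monom_add, monom_single]
  ring

/-- Exactness for `q = m + e_p`: `∂_p f_a · z^q = (n+1) z^(m+(n+1)e_p) - a z^(m+1)` and `∂_p z^q =
(m_p + 1) z^m`, with `n = k + 1`. -/
theorem period_relation {k : ℕ} (γ : FlatCycle (k + 1) t V) (hV : IsOpen V) (ht : t ≠ 0)
    (m : Fin (k + 2) → ℕ) (p : Fin (k + 2)) {a : ℂ} (ha : a ∈ V) :
    (((∑ i, m i : ℕ) : ℂ) + k + 2) *
        (((k : ℂ) + 2) * γ.period (m + Pi.single p (k + 2)) a - a * γ.period (m + 1) a) =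
      ((k : ℂ) + 2) * t * ((m p : ℂ) + 1) * γ.period m a := by
  have h := γ.integral_extDeriv_eulerForm₂ hV ht (m + Pi.single p 1) p ha
  have hq : ((∑ i, (m + Pi.single p 1 : Fin (k + 2) → ℕ) i : ℕ) : ℂ) + k + 1 =
      ((∑ i, m i : ℕ) : ℂ) + k + 2 := by
    simp [Finset.sum_add_distrib]
    ring
  have hF : (fun (j : Fin γ.N) (x : Fin (k + 1) → ℝ) =>
      (((∑ i, (m + Pi.single p 1 : Fin (k + 2) → ℕ) i : ℕ) : ℂ) + k + 1) *
        (fderiv ℂ (dwork (k + 1) a) (γ.cube j a x) (Pi.single p 1) *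
          γ.residue (m + Pi.single p 1) a j x)
      - ((k : ℂ) + 2) * t *
        (fderiv ℂ (monom (m + Pi.single p 1)) (γ.cube j a x) (Pi.single p 1) *
          γ.residue 0 a j x)) =
      fun j x => ((((∑ i, m i : ℕ) : ℂ) + k + 2) *
        (((k : ℂ) + 2) * γ.residue (m + Pi.single p (k + 2)) a j x - a * γ.residue (m + 1) a j x))
        - ((k : ℂ) + 2) * t * ((m p : ℂ) + 1) * γ.residue m a j x := by
    funext j x
    have h1 := fderiv_dwork_mul_monom (k + 1) a (γ.cube j a x) (m + Pi.single p 1) p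
    have h2 : (m + Pi.single p 1 + Pi.single p (k + 1) : Fin (k + 2) → ℕ) =
        m + Pi.single p (k + 2) := by
      rw [add_assoc, ← Pi.single_add, add_comm 1 (k + 1)]
    have h3 : (∏ i ∈ Finset.univ.erase p, γ.cube j a x i) *
        monom (m + Pi.single p 1) (γ.cube j a x) = monom (m + 1) (γ.cube j a x) := by
      rw [monom_add, monom_add, monom_single, monom_one,
        ← Finset.mul_prod_erase _ _ (Finset.mem_univ p)]
      ring
    rw [h2, h3] at h1
    rw [hq, γ.residue_eq_mul (m + Pi.single p 1), ← mul_assoc (fderiv ℂ _ _ _), h1,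
      fderiv_monom_add_single, γ.residue_eq_mul (m + Pi.single (M := fun _ => ℕ) p (k + 2)),
      γ.residue_eq_mul (m + 1), γ.residue_eq_mul m]
    push_cast
    ring
  have hc := fun q => γ.continuous_residue hV q ha
  rw [hF, γ.integral_sub, γ.integral_const_mul, γ.integral_sub, γ.integral_const_mul,
    γ.integral_const_mul, γ.integral_const_mul, sub_eq_zero] at h
  · rw [γ.period_eq hV _ ha, γ.period_eq hV _ ha, γ.period_eq hV _ ha, h]
  · exact fun j => continuous_const.mul (hc _ j)
  · exact fun j => continuous_const.mul (hc _ j)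
  · exact fun j => continuous_const.mul
      ((continuous_const.mul (hc _ j)).sub (continuous_const.mul (hc _ j)))
  · exact fun j => continuous_const.mul (hc _ j)

/-- When `z_p` does not occur in `z^q`, the term with `∂_p z^q` is absent and the positive factor
`|q| + k + 1` cancels. At `a = 0` this forces periods to vanish, which is what excludes the
inadmissible `δ`. -/
theorem period_relation_of_eq_zero {k : ℕ} (γ : FlatCycle (k + 1) t V) (hV : IsOpen V) (ht : t ≠ 0)
    (q : Fin (k + 2) → ℕ) (p : Fin (k + 2)) (hp : q p = 0) {a : ℂ} (ha : a ∈ V) :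
    ((k : ℂ) + 2) * γ.period (q + Pi.single p (k + 1)) a =
      a * γ.period (Function.update (q + 1) p 0) a := by
  have h := γ.integral_extDeriv_eulerForm₂ hV ht q p ha
  have hF : (fun (j : Fin γ.N) (x : Fin (k + 1) → ℝ) => (((∑ i, q i : ℕ) : ℂ) + k + 1) *
        (fderiv ℂ (dwork (k + 1) a) (γ.cube j a x) (Pi.single p 1) * γ.residue q a j x)
      - ((k : ℂ) + 2) * t *
        (fderiv ℂ (monom q) (γ.cube j a x) (Pi.single p 1) * γ.residue 0 a j x)) =
      fun j x => (((∑ i, q i : ℕ) : ℂ) + k + 1) *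
        (((k : ℂ) + 2) * γ.residue (q + Pi.single p (k + 1)) a j x
          - a * γ.residue (Function.update (q + 1) p 0) a j x) := by
    funext j x
    have h1 := fderiv_dwork_mul_monom (k + 1) a (γ.cube j a x) q p
    have h3 : (∏ i ∈ Finset.univ.erase p, γ.cube j a x i) * monom q (γ.cube j a x) =
        monom (Function.update (q + 1) p 0) (γ.cube j a x) := by
      rw [monom, monom, ← Finset.mul_prod_erase _ _ (Finset.mem_univ p),
        ← Finset.mul_prod_erase Finset.univ (fun i => _ ^ Function.update (q + 1) p 0 i)
          (Finset.mem_univ p), hp, Function.update_self, pow_zero, one_mul, one_mul,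
        ← Finset.prod_mul_distrib]
      refine Finset.prod_congr rfl fun i hi => ?_
      rw [Function.update_of_ne (Finset.ne_of_mem_erase hi), Pi.add_apply, Pi.one_apply, pow_succ,
        mul_comm]
    rw [h3] at h1
    rw [γ.residue_eq_mul q, ← mul_assoc (fderiv ℂ (dwork (k + 1) a) _ _), h1,
      fderiv_monom_of_eq_zero q p hp, γ.residue_eq_mul (q + Pi.single (M := fun _ => ℕ) p (k + 1)),
      γ.residue_eq_mul (Function.update (q + 1) p 0)]
    push_cast
    ring
  have hc := fun q => γ.continuous_residue hV q ha
  rw [hF, γ.integral_const_mul, γ.integral_sub, γ.integral_const_mul,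
    γ.integral_const_mul] at h
  · have h0 : (((∑ i, q i : ℕ) : ℂ) + k + 1) ≠ 0 := by
      exact_mod_cast Nat.succ_ne_zero ((∑ i, q i) + k)
    rw [γ.period_eq hV _ ha, γ.period_eq hV _ ha]
    exact sub_eq_zero.1 ((mul_eq_zero.1 h).resolve_left h0)
  · exact fun j => continuous_const.mul (hc _ j)
  · exact fun j => continuous_const.mul (hc _ j)

/-- Cartan's formula for the pullback of `z ^ m ι_E Ω` to the parameter space. -/
theorem fderiv_eulerForm_fam {k : ℕ} (γ : FlatCycle (k + 1) t V) (hV : IsOpen V) (ht : t ≠ 0)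
    (m : Fin (k + 2) → ℕ) (j : Fin γ.N) (h : ℂ) {a : ℂ} (ha : a ∈ V) {x : Fin (k + 1) → ℝ}
    (hx : x ∈ Set.univ.pi fun _ : Fin (k + 1) => Set.Ioo (0 : ℝ) 1) :
    fderiv ℝ (fun p => eulerForm m (γ.fam j p)
      (fun l => fderiv ℝ (γ.fam j) p (0, Pi.single l 1))) (a, x) (h, 0) =
      h * (((∑ i, m i : ℕ) : ℂ) + k + 2) * γ.residue (m + 1) a j x +
      ∑ i : Fin (k + 1), (-1 : ℂ) ^ (i : ℕ) * fderiv ℝ (fun x => eulerForm m (γ.cube j a x)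
        (Matrix.vecCons (fderiv ℝ (γ.fam j) (a, x) (h, 0)) fun l =>
          fderiv ℝ (γ.fam j) (a, x) (0, Pi.single (i.succAbove l) 1))) x (Pi.single i 1) := by
  have hc := γ.contDiffAt_fam hV j ha x
  have hw : DifferentiableAt ℝ (eulerForm m) (γ.fam j (a, x)) :=
    (contDiff_eulerForm m).differentiable (by simp) _
  have hpb := extDeriv_pullback hw hc (by rw [minSmoothness_of_isRCLikeNormedField]; norm_cast)
  let e : Fin (k + 1) → ℂ × (Fin (k + 1) → ℝ) := fun l => (0, Pi.single l 1)
  have hd : DifferentiableAt ℝ (fun p => (eulerForm m (γ.fam j p)).compContinuousLinearMap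
      (fderiv ℝ (γ.fam j) p)) (a, x) := by
    refine DifferentiableAt.continuousAlternatingMapCompContinuousLinearMap ?_ ?_
    · exact hw.comp (a, x) (hc.differentiableAt (by simp))
    · exact (hc.fderiv_right (m := 1) (by norm_cast)).differentiableAt one_ne_zero
  -- Evaluated on `(∂_h, ∂_1, …, ∂_{k+1})`, the first term of the exterior derivative is the
  -- parameter derivative sought; the others form a divergence on the cube.
  have hpb' := congrArg (fun L => L (Matrix.vecCons ((h, 0) : ℂ × (Fin (k + 1) → ℝ)) e)) hpb
  rw [extDeriv_apply hd] at hpb'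
  -- The exterior derivative is a multiple of `z^m Ω`, and the velocity satisfies `df_a(velocity) =
  -- h ∏ z_i`; hence the residue of `z^(m+1)`.
  have hrhs : (extDeriv (eulerForm m) (γ.fam j (a, x))).compContinuousLinearMap
      (fderiv ℝ (γ.fam j) (a, x)) (Matrix.vecCons ((h, 0) : ℂ × (Fin (k + 1) → ℝ)) e) =
      h * (((∑ i, m i : ℕ) : ℂ) + k + 2) * γ.residue (m + 1) a j x := by
    rw [ContinuousAlternatingMap.compContinuousLinearMap_apply, extDeriv_eulerForm]
    have h1 : (fderiv ℝ (γ.fam j) (a, x) ∘ Matrix.vecCons ((h, 0) : ℂ × (Fin (k + 1) → ℝ)) e) =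
        Matrix.vecCons (fderiv ℝ (γ.fam j) (a, x) (h, 0)) (γ.tangent j a x) := by
      funext i
      refine Fin.cases rfl (fun l => rfl) i
    have h2 := γ.monom_mul_volForm hV ht m ha j hx (fderiv ℝ (γ.fam j) (a, x) (h, 0))
    rw [γ.fderiv_dwork_fam hV j ha hx] at h2
    rw [h1]
    have h3 : γ.fam j (a, x) = γ.cube j a x := rfl
    rw [h3, h2, γ.residue_eq_mul (m + 1), γ.residue_eq_mul m, monom_add, monom_one]
    push_cast
    ring
  have hpb'' := hpb'.trans hrhs
  rw [Fin.sum_univ_succ] at hpb''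
  rw [← hpb'', eq_comm, add_assoc, ← sub_eq_zero]
  have hz : (fderiv ℝ (fun p => (eulerForm m (γ.fam j p)).compContinuousLinearMap
      (fderiv ℝ (γ.fam j) p) (Fin.removeNth 0 (Matrix.vecCons ((h, 0) : ℂ × (Fin (k + 1) → ℝ)) e)))
      (a, x)) = fderiv ℝ (fun p => eulerForm m (γ.fam j p)
      (fun l => fderiv ℝ (γ.fam j) p (0, Pi.single l 1))) (a, x) := rfl
  have hs : ∀ i : Fin (k + 1), fderiv ℝ (fun p => (eulerForm m (γ.fam j p)).compContinuousLinearMap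
      (fderiv ℝ (γ.fam j) p) (Fin.removeNth i.succ (Matrix.vecCons ((h, 0) : ℂ × (Fin (k + 1) → ℝ)) e)))
      (a, x) (e i) = fderiv ℝ (fun x => eulerForm m (γ.cube j a x)
        (Matrix.vecCons (fderiv ℝ (γ.fam j) (a, x) (h, 0)) fun l =>
          fderiv ℝ (γ.fam j) (a, x) (0, Pi.single (i.succAbove l) 1))) x (Pi.single i 1) := by
    intro i
    have hdi : DifferentiableAt ℝ (fun p => (eulerForm m (γ.fam j p)).compContinuousLinearMap
      (fderiv ℝ (γ.fam j) p) (Fin.removeNth i.succ (Matrix.vecCons ((h, 0) : ℂ × (Fin (k + 1) → ℝ)) e)))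
      (a, x) := hd.continuousAlternatingMap_apply_const _
    have hcomp := hdi.hasFDerivAt.comp x (hasFDerivAt_prodMk_right a x)
    have hfun : ((fun p => (eulerForm m (γ.fam j p)).compContinuousLinearMap
      (fderiv ℝ (γ.fam j) p) (Fin.removeNth i.succ (Matrix.vecCons ((h, 0) : ℂ × (Fin (k + 1) → ℝ)) e)))
      ∘ fun x => (a, x)) = fun x => eulerForm m (γ.cube j a x)
        (Matrix.vecCons (fderiv ℝ (γ.fam j) (a, x) (h, 0)) fun l =>
          fderiv ℝ (γ.fam j) (a, x) (0, Pi.single (i.succAbove l) 1)) := by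
      funext y
      rw [Function.comp_apply, ContinuousAlternatingMap.compContinuousLinearMap_apply]
      congr 1
      funext l
      refine Fin.cases ?_ (fun l => ?_) l
      · simp [Fin.removeNth]
      · simp [Fin.removeNth, e]
    rw [hfun] at hcomp
    rw [hcomp.fderiv]
    rfl
  simp only [hz, Matrix.cons_val_zero, Matrix.cons_val_succ, hs, Fin.val_zero, pow_zero,
    one_smul, Fin.val_succ, pow_succ]
  rw [add_comm, sub_eq_zero, ← sub_eq_zero]
  simp

/-- Cartan's formula splits the derivative of the integrand into a residue and a divergence; the
divergence integrates to zero by Stokes. The remaining term is `h` times a constant, so the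
derivative is complex. -/
theorem hasDerivAt_period {k : ℕ} (γ : FlatCycle (k + 1) t V) (hV : IsOpen V) (ht : t ≠ 0)
    (m : Fin (k + 2) → ℕ) {a : ℂ} (ha : a ∈ V) :
    HasDerivAt (γ.period m)
      ((((∑ i, m i : ℕ) : ℂ) + k + 2) / (((k : ℂ) + 2) * t) * γ.period (m + 1) a) a := by
  have hk : ((k : ℂ) + 2) ≠ 0 := by exact_mod_cast Nat.succ_ne_zero (k + 1)
  choose D hD hDh using fun j => hasFDerivAt_setIntegral_of_contDiffOn MeasureTheory.volume
    (isCompact_Icc (a := (0 : Fin (k + 1) → ℝ)) (b := 1)) hV (γ.contDiffOn_eulerForm_fam hV m j) ha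
  have h1 : HasFDerivAt (fun b => ∑ j, γ.coeff j * ∫ x in Set.Icc (0 : Fin (k + 1) → ℝ) 1,
      eulerForm m (γ.fam j (b, x)) fun l => fderiv ℝ (γ.fam j) (b, x) (0, Pi.single l 1))
      (∑ j, γ.coeff j • D j) a :=
    HasFDerivAt.fun_sum fun j _ => (hD j).const_mul (γ.coeff j)
  have h2 : ∀ h : ℂ, (∑ j, γ.coeff j • D j) h =
      h * ((((∑ i, m i : ℕ) : ℂ) + k + 2) * γ.period (m + 1) a) := by
    intro h
    have hκ1 : ContDiff ℝ 1 fun y : (Fin (k + 2) → ℂ) × (Fin (k + 2) → ℂ) ×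
        (Fin k → Fin (k + 2) → ℂ) => eulerForm m y.1 (Matrix.vecCons y.2.1 y.2.2) := by
      have hg : ContDiff ℝ 1 fun y : (Fin (k + 2) → ℂ) × (Fin (k + 2) → ℂ) ×
        (Fin k → Fin (k + 2) → ℂ) => (Matrix.vecCons y.2.1 y.2.2 : Fin (k + 1) → _) := by
        refine contDiff_pi.2 fun i => ?_
        refine Fin.cases (contDiff_fst.comp contDiff_snd) (fun l => ?_) i
        exact (contDiff_apply ℝ (Fin (k + 2) → ℂ) l).comp (contDiff_snd.comp contDiff_snd)
      exact contDiffOn_univ.1 (contDiffOn_eulerForm_apply m contDiff_fst.contDiffOn hg.contDiffOn)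
    have hst := stokes_of_isCubicalCycle hV γ.coeff γ.cube γ.smooth γ.cycle
      (fun y => eulerForm m y.1 (Matrix.vecCons y.2.1 y.2.2)) hκ1
      (fun z u v ⟨l, hl⟩ => (eulerForm m z).toContinuousMultilinearMap.map_coord_zero l.succ hl)
      h ha
    have h3 : (∑ j, γ.coeff j • D j) h = γ.integral fun j x =>
        fderiv ℝ (fun p => eulerForm m (γ.fam j p)
          (fun l => fderiv ℝ (γ.fam j) p (0, Pi.single l 1))) (a, x) (h, 0) := by
      simp [hDh, integral]
    have hc1 : ∀ j, Continuous fun x : Fin (k + 1) → ℝ =>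
        fderiv ℝ (fun p => eulerForm m (γ.fam j p)
          (fun l => fderiv ℝ (γ.fam j) p (0, Pi.single l 1))) (a, x) (h, 0) := by
      intro j
      have := (γ.contDiffOn_eulerForm_fam hV m j).continuousOn_fderiv_of_isOpen
        (hV.prod isOpen_univ) le_rfl
      have h4 : Continuous fun x : Fin (k + 1) → ℝ => fderiv ℝ (fun p => eulerForm m (γ.fam j p)
          (fun l => fderiv ℝ (γ.fam j) p (0, Pi.single l 1))) (a, x) :=
        continuousOn_univ.1 (this.comp (f := fun x : Fin (k + 1) → ℝ => (a, x)) (by fun_prop)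
          fun x _ => ⟨ha, trivial⟩)
      exact h4.clm_apply continuous_const
    have hc2 : ∀ j, Continuous fun x : Fin (k + 1) → ℝ =>
        h * (((∑ i, m i : ℕ) : ℂ) + k + 2) * γ.residue (m + 1) a j x := fun j =>
      continuous_const.mul (γ.continuous_residue hV (m + 1) ha j)
    have h5 : γ.integral (fun j x => fderiv ℝ (fun p => eulerForm m (γ.fam j p)
          (fun l => fderiv ℝ (γ.fam j) p (0, Pi.single l 1))) (a, x) (h, 0) -
          h * (((∑ i, m i : ℕ) : ℂ) + k + 2) * γ.residue (m + 1) a j x) = 0 := by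
      refine Eq.trans ?_ hst
      refine (γ.integral_congr fun j x hx => ?_).trans rfl
      rw [γ.fderiv_eulerForm_fam hV ht m j h ha hx]
      exact add_sub_cancel_left _ _
    rw [γ.integral_sub hc1 hc2, sub_eq_zero, γ.integral_const_mul] at h5
    rw [h3, h5, γ.period_eq hV _ ha]
    ring
  have h3 := (h1.hasDerivAt_of_real h2).div_const (((k : ℂ) + 2) * t)
  have h4 : γ.period m =ᶠ[𝓝 a] fun b => (∑ j, γ.coeff j * ∫ x in Set.Icc (0 : Fin (k + 1) → ℝ) 1,
      eulerForm m (γ.fam j (b, x)) fun l => fderiv ℝ (γ.fam j) (b, x) (0, Pi.single l 1))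
      / (((k : ℂ) + 2) * t) := by
    filter_upwards [hV.mem_nhds ha] with b hb
    have h6 : ∀ (j : Fin γ.N) (x : Fin (k + 1) → ℝ), eulerForm m (γ.fam j (b, x))
        (fun l => fderiv ℝ (γ.fam j) (b, x) (0, Pi.single l 1)) =
        ((k : ℂ) + 2) * t * γ.residue m b j x := by
      intro j x
      have := γ.eulerForm_eq_residue ht m b j x
      push_cast at this
      have h8 : (k : ℂ) + 1 + 1 = k + 2 := by ring
      rw [h8] at this
      exact this
    have h7 := γ.integral_const_mul (((k : ℂ) + 2) * t) (γ.residue m b)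
    simp only [h6]
    rw [γ.period_eq hV _ hb, eq_div_iff (mul_ne_zero hk ht), mul_comm, ← h7]
    rfl
  rw [div_mul_eq_mul_div]
  exact h3.congr_of_eventuallyEq h4

end FlatCycle

/-! ### Linear differential equations in the complex domain -/

section PowerSeries

variable {E : Type*} [NormedAddCommGroup E] [NormedSpace ℂ E]

theorem summable_norm_pow_smul_of_norm_le {c : ℕ → E} {C K : ℝ} (hK : 0 < K)
    (hc : ∀ k, ‖c k‖ ≤ C * K ^ k) {z : ℂ} (hz : ‖z‖ < 1 / K) :
    Summable fun k => ‖z ^ k • c k‖ := by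
  have h1 : ‖z‖ * K < 1 := by rwa [lt_div_iff₀ hK] at hz
  refine Summable.of_nonneg_of_le (fun k => norm_nonneg _) (fun k => ?_)
    ((summable_geometric_of_lt_one (by positivity) h1).mul_left C)
  rw [norm_smul, norm_pow, mul_pow]
  calc ‖z‖ ^ k * ‖c k‖ ≤ ‖z‖ ^ k * (C * K ^ k) := by gcongr; exact hc k
    _ = _ := by ring

theorem hasDerivAt_tsum_pow_smul [CompleteSpace E] {c : ℕ → E} {C K : ℝ} (hK : 0 < K)
    (hc : ∀ k, ‖c k‖ ≤ C * K ^ k) {z : ℂ} (hz : ‖z‖ < 1 / K) :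
    HasDerivAt (fun z : ℂ => ∑' k, z ^ k • c k) (∑' k : ℕ, z ^ k • (((k : ℂ) + 1) • c (k + 1))) z := by
  obtain ⟨r, hzr, hrK⟩ := exists_between hz
  have hr : 0 < r := (norm_nonneg z).trans_lt hzr
  have hrK1 : r * K < 1 := by rwa [lt_div_iff₀ hK] at hrK
  have hC : 0 ≤ C := by simpa using (norm_nonneg _).trans (hc 0)
  have hu : Summable fun k : ℕ => (k : ℝ) * r ^ (k - 1) * (C * K ^ k) := by
    rw [← summable_nat_add_iff 1]
    have h1 : Summable fun k : ℕ => (k : ℝ) ^ 1 * (r * K) ^ k :=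
      summable_pow_mul_geometric_of_norm_lt_one 1 (by
        rw [Real.norm_of_nonneg (by positivity)]; exact hrK1)
    have h2 : Summable fun k : ℕ => (r * K) ^ k :=
      summable_geometric_of_lt_one (by positivity) hrK1
    refine ((h1.add h2).mul_left (C * K)).congr fun k => ?_
    simp only [Nat.add_sub_cancel, mul_pow, pow_succ]
    push_cast
    ring
  have hd := hasDerivAt_tsum_of_isPreconnected (u := fun k : ℕ => (k : ℝ) * r ^ (k - 1) * (C * K ^ k))
    (g := fun k z => z ^ k • c k) (g' := fun k z => ((k : ℂ) * z ^ (k - 1)) • c k)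
    (t := Metric.ball (0 : ℂ) r) (y₀ := 0) (y := z) hu Metric.isOpen_ball
    (convex_ball _ _).isPreconnected (fun k y _ => (hasDerivAt_pow k y).smul_const (c k))
    (fun k y hy => by
      have hy : ‖y‖ ≤ r := by simpa using (Metric.mem_ball.1 hy).le
      rw [norm_smul, norm_mul, norm_pow, Complex.norm_natCast]
      gcongr
      exact hc k) (Metric.mem_ball_self hr)
    (summable_of_ne_finset_zero (s := {0}) fun k hk => by
      rw [zero_pow (by simpa using hk), zero_smul]) (by simpa using hzr)
  have hs : Summable fun k : ℕ => ((k : ℂ) * z ^ (k - 1)) • c k := by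
    refine Summable.of_norm_bounded hu fun k => ?_
    rw [norm_smul, norm_mul, norm_pow, Complex.norm_natCast]
    gcongr
    exact hc k
  rw [hs.tsum_eq_zero_add] at hd
  simp only [Nat.cast_zero, zero_mul, zero_smul, zero_add, Nat.add_sub_cancel] at hd
  refine hd.congr_deriv (tsum_congr fun k => ?_)
  rw [smul_smul]
  push_cast
  rw [mul_comm]

end PowerSeries

/-! ### Local fundamental solutions by power series. -/

section FundamentalSolution

variable {𝔸 : Type*} [NormedRing 𝔸] [NormedAlgebra ℂ 𝔸]

/-- The coefficients of the power series solution of `Φ' = A Φ`, `Φ(0) = 1`. -/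
def odeCoeff (A : ℕ → 𝔸) : ℕ → 𝔸
  | 0 => 1
  | k + 1 => ((k : ℂ) + 1)⁻¹ • ∑ i : Fin (k + 1), A (k - i) * odeCoeff A i

theorem odeCoeff_succ (A : ℕ → 𝔸) (k : ℕ) :
    odeCoeff A (k + 1) = ((k : ℂ) + 1)⁻¹ • ∑ i ∈ Finset.range (k + 1), A (k - i) * odeCoeff A i := by
  rw [odeCoeff, Finset.sum_range]

/-- Each of the `k + 1` terms of the recursion is bounded by `‖1‖ K^(k+1)`, and the factor `1/(k+1)`
absorbs their number. -/
theorem norm_odeCoeff_le (A : ℕ → 𝔸) {C K : ℝ} (hK : 0 < K) (hCK : C ≤ K)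
    (hA : ∀ k, ‖A k‖ ≤ C * K ^ k) (k : ℕ) : ‖odeCoeff A k‖ ≤ ‖(1 : 𝔸)‖ * K ^ k := by
  induction k using Nat.strong_induction_on with
  | _ k ih =>
    cases k with
    | zero => simp [odeCoeff]
    | succ k =>
      have hC : 0 ≤ C := by simpa using (norm_nonneg _).trans (hA 0)
      rw [odeCoeff_succ, norm_smul, norm_inv]
      have hk : ‖(k : ℂ) + 1‖ = (k : ℝ) + 1 := by
        rw [← Nat.cast_succ, Complex.norm_natCast]; push_cast; ring
      rw [hk, inv_mul_le_iff₀ (by positivity)]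
      calc ‖∑ i ∈ Finset.range (k + 1), A (k - i) * odeCoeff A i‖
          ≤ ∑ i ∈ Finset.range (k + 1), ‖(1 : 𝔸)‖ * K ^ (k + 1) := by
            refine norm_sum_le_of_le _ fun i hi => ?_
            have hik : i ≤ k := Nat.lt_succ_iff.1 (Finset.mem_range.1 hi)
            calc ‖A (k - i) * odeCoeff A i‖ ≤ ‖A (k - i)‖ * ‖odeCoeff A i‖ := norm_mul_le _ _
              _ ≤ (K * K ^ (k - i)) * (‖(1 : 𝔸)‖ * K ^ i) := by
                gcongr
                · exact (hA _).trans (by gcongr)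
                · exact ih i (Nat.lt_succ_of_le hik)
              _ = ‖(1 : 𝔸)‖ * (K ^ (k - i) * K ^ i * K) := by ring
              _ = ‖(1 : 𝔸)‖ * K ^ (k + 1) := by rw [← pow_add, Nat.sub_add_cancel hik, pow_succ]
        _ = ((k : ℝ) + 1) * (‖(1 : 𝔸)‖ * K ^ (k + 1)) := by simp

theorem exists_fundamentalSolution [CompleteSpace 𝔸] {A : ℂ → 𝔸} {z₀ : ℂ}
    (hA : AnalyticAt ℂ A z₀) :
    ∃ Φ : ℂ → 𝔸, (∀ᶠ z in 𝓝 z₀, HasDerivAt Φ (A z * Φ z) z) ∧ Φ z₀ = 1 := by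
  obtain ⟨p, hp⟩ := hA
  obtain ⟨r, hr⟩ := id hp
  obtain ⟨ρ, hρ0, hρr⟩ := ENNReal.lt_iff_exists_nnreal_btwn.1 hr.r_pos
  have hρ0 : 0 < ρ := by exact_mod_cast hρ0
  obtain ⟨C, hC, hbound⟩ :=
    p.norm_le_div_pow_of_pos_of_lt_radius hρ0 (hρr.trans_le hr.r_le)
  -- `1/ρ` governs the growth of the coefficients of `A`; `C ≤ K` is what the induction in
  -- `norm_odeCoeff_le` needs.
  set K : ℝ := max C (1 / ρ) with hKdef
  have hK : 0 < K := lt_max_of_lt_left hC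
  have hcoef : ∀ k, ‖p.coeff k‖ ≤ C * K ^ k := by
    intro k
    rw [← p.norm_apply_eq_norm_coef]
    refine (hbound k).trans ?_
    rw [div_eq_mul_one_div, ← one_div_pow]
    gcongr
    exact le_max_right _ _
  have hy := norm_odeCoeff_le p.coeff hK (le_max_left _ _) hcoef
  refine ⟨fun z => ∑' k, (z - z₀) ^ k • odeCoeff p.coeff k, ?_, ?_⟩
  · have h1 := hasFPowerSeriesAt_iff.1 hp
    have h2 : ∀ᶠ z in 𝓝 z₀, HasSum (fun n => (z - z₀) ^ n • p.coeff n) (A z) := by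
      have : Filter.Tendsto (fun z : ℂ => z - z₀) (𝓝 z₀) (𝓝 0) := by
        have : Continuous fun z : ℂ => z - z₀ := by fun_prop
        simpa using this.tendsto z₀
      filter_upwards [this.eventually h1] with z hz
      simpa using hz
    filter_upwards [h2, Metric.ball_mem_nhds z₀ (one_div_pos.2 hK)] with z hz hball
    have hzK : ‖z - z₀‖ < 1 / K := by simpa [dist_eq_norm] using hball
    have h3 := (hasDerivAt_tsum_pow_smul hK hy hzK).comp_sub_const z z₀
    refine h3.congr_deriv ?_
    rw [← hz.tsum_eq, tsum_mul_tsum_eq_tsum_sum_range_of_summable_norm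
      (summable_norm_pow_smul_of_norm_le hK hcoef hzK)
      (summable_norm_pow_smul_of_norm_le hK hy hzK)]
    refine tsum_congr fun k => ?_
    have hk : ((k : ℂ) + 1) ≠ 0 := by exact_mod_cast Nat.succ_ne_zero k
    rw [odeCoeff_succ, smul_inv_smul₀ hk, Finset.smul_sum, ← Finset.sum_range_reflect]
    refine Finset.sum_congr rfl fun i hi => ?_
    have hik : i ≤ k := Nat.lt_succ_iff.1 (Finset.mem_range.1 hi)
    have e1 : k + 1 - 1 - i = k - i := by omega
    have e2 : k - (k - i) = i := by omega
    rw [e1, e2, smul_mul_smul_comm, ← pow_add, Nat.add_sub_of_le hik]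
  · change ∑' k, (z₀ - z₀) ^ k • odeCoeff p.coeff k = 1
    rw [tsum_eq_single 0 fun k hk => by simp [hk]]
    simp [odeCoeff]

end FundamentalSolution

section LocalSystem

variable {X : Type*} [NormedAddCommGroup X] [NormedSpace ℂ X] [CompleteSpace X]

/-- `Y` solves the linear differential equation `Y' = A Y` at all points near `z`. -/
def IsSolutionNear (A : ℂ → X →L[ℂ] X) (Y : ℂ → X) (z : ℂ) : Prop :=
  ∀ᶠ w in 𝓝 z, HasDerivAt Y (A w (Y w)) w

/-- Variation of constants: where `Φ` is invertible, `Φ⁻¹ Y` has derivative zero for every solution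
`Y`. One ball serves for solutions near any of its points, not only near the centre, as is needed
for continuation along a path. -/
theorem exists_local_solutions {A : ℂ → X →L[ℂ] X} {z₀ : ℂ} (hA : AnalyticAt ℂ A z₀) :
    ∃ r > 0, ∃ Φ : ℂ → X →L[ℂ] X, Φ z₀ = 1 ∧
      (∀ z ∈ Metric.ball z₀ r, ∀ c, HasDerivAt (fun w => Φ w c) (A z (Φ z c)) z) ∧
      ∀ z ∈ Metric.ball z₀ r, ∀ Y, IsSolutionNear A Y z → ∃ c, Y =ᶠ[𝓝 z] fun w => Φ w c := by
  obtain ⟨Φ, hΦ, hΦ0⟩ := exists_fundamentalSolution hA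
  have hunit : ∀ᶠ z in 𝓝 z₀, IsUnit (Φ z) := by
    have hc : ContinuousAt Φ z₀ := hΦ.self_of_nhds.continuousAt
    refine hc.eventually ?_
    rw [hΦ0]
    exact Units.isOpen.mem_nhds isUnit_one
  obtain ⟨r, hr, hball⟩ := Metric.eventually_nhds_iff_ball.1 (hΦ.and hunit)
  refine ⟨r, hr, Φ, hΦ0, fun z hz c => ?_, fun z hz Y hY => ?_⟩
  · exact (hball z hz).1.clm_apply (hasDerivAt_const z c) |>.congr_deriv (by simp)
  · have h1 : ∀ᶠ w in 𝓝 z, HasDerivAt (fun w => Ring.inverse (Φ w) (Y w)) 0 w := by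
      filter_upwards [hY, Metric.isOpen_ball.mem_nhds hz] with w hYw hw
      obtain ⟨hd, u, hu⟩ := hball w hw
      have h2 : HasFDerivAt (Ring.inverse : (X →L[ℂ] X) → _) _ (Φ w) :=
        hu ▸ hasFDerivAt_ringInverse (𝕜 := ℂ) u
      have h3 := (h2.comp_hasDerivAt w hd).clm_apply hYw
      refine h3.congr_deriv ?_
      have h4 : Ring.inverse (Φ w) = ((u⁻¹ : (X →L[ℂ] X)ˣ) : X →L[ℂ] X) := by
        rw [← hu, Ring.inverse_unit]
      have h5 : (Φ w * ((u⁻¹ : (X →L[ℂ] X)ˣ) : X →L[ℂ] X)) = 1 := by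
        rw [← hu]; exact u.mul_inv
      have h6 : Φ w (((u⁻¹ : (X →L[ℂ] X)ˣ) : X →L[ℂ] X) (Y w)) = Y w := by
        exact DFunLike.congr_fun h5 (Y w)
      simp [h4, h6]
    obtain ⟨ε, hε, hε'⟩ := Metric.eventually_nhds_iff_ball.1 (h1.and (Metric.isOpen_ball.mem_nhds hz))
    refine ⟨Ring.inverse (Φ z) (Y z), ?_⟩
    filter_upwards [Metric.ball_mem_nhds z hε] with w hw
    have hconst := (convex_ball z ε).is_const_of_fderivWithin_eq_zero (𝕜 := ℂ)
      (f := fun w => Ring.inverse (Φ w) (Y w))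
      (fun w hw => (hε' w hw).1.differentiableAt.differentiableWithinAt)
      (fun w hw => by
        rw [fderivWithin_of_isOpen Metric.isOpen_ball hw, (hε' w hw).1.hasFDerivAt.fderiv]
        ext
        simp) hw (Metric.mem_ball_self hε)
    obtain ⟨-, u, hu⟩ := hball w (hε' w hw).2
    have hconst : Ring.inverse (Φ w) (Y w) = Ring.inverse (Φ z) (Y z) := hconst
    rw [← hconst, ← hu, Ring.inverse_unit]
    exact (DFunLike.congr_fun u.mul_inv (Y w)).symm

theorem IsSolutionNear.eventuallyEq_zero {A : ℂ → X →L[ℂ] X} {z₀ : ℂ} (hA : AnalyticAt ℂ A z₀)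
    {Y : ℂ → X} (hY : IsSolutionNear A Y z₀) (h0 : Y z₀ = 0) : Y =ᶠ[𝓝 z₀] 0 := by
  obtain ⟨r, hr, Φ, hΦ0, -, h⟩ := exists_local_solutions hA
  obtain ⟨c, hc⟩ := h z₀ (Metric.mem_ball_self hr) Y hY
  have h1 := hc.self_of_nhds
  have h2 : c = 0 := by simpa [h0, hΦ0] using h1.symm
  filter_upwards [hc] with w hw
  rw [hw, h2]
  simp

end LocalSystem

/-! ### Analytic continuation along paths -/

theorem Path.eventually_eventually_nhds {a₀ a₁ : ℂ} (p : Path a₀ a₁) {P : ℂ → Prop}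
    {s : unitInterval} (h : ∀ᶠ z in 𝓝 (p s), P z) : ∀ᶠ s' in 𝓝 s, ∀ᶠ z in 𝓝 (p s'), P z :=
  p.continuous.continuousAt.eventually (_root_.eventually_eventually_nhds.2 h)

/-- The set of times at which the germs agree is open by local constancy, and its complement is open
by the identity theorem on a ball; the unit interval is connected. -/
theorem eventuallyEq_along_path {a₀ a₁ : ℂ} (p : Path a₀ a₁) {F G : unitInterval → ℂ → ℂ}
    (hF : ∀ s, AnalyticAt ℂ (F s) (p s)) (hG : ∀ s, AnalyticAt ℂ (G s) (p s))
    (hF' : ∀ s, ∀ᶠ s' in 𝓝 s, F s' =ᶠ[𝓝 (p s')] F s)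
    (hG' : ∀ s, ∀ᶠ s' in 𝓝 s, G s' =ᶠ[𝓝 (p s')] G s) {s₀ : unitInterval}
    (h0 : F s₀ =ᶠ[𝓝 (p s₀)] G s₀) (s : unitInterval) : F s =ᶠ[𝓝 (p s)] G s := by
  have hclopen : IsClopen {s | F s =ᶠ[𝓝 (p s)] G s} := by
    constructor
    · rw [← isOpen_compl_iff, isOpen_iff_mem_nhds]
      intro s hs
      obtain ⟨ε, hε, hball⟩ := Metric.eventually_nhds_iff_ball.1
        ((hF s).eventually_analyticAt.and (hG s).eventually_analyticAt)
      filter_upwards [hF' s, hG' s,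
        p.continuous.continuousAt (Metric.ball_mem_nhds (p s) hε)] with s' h1 h2 h3 h4
      have h5 : F s =ᶠ[𝓝 (p s')] G s := h1.symm.trans (Filter.EventuallyEq.trans h4 h2)
      have h6 := AnalyticOnNhd.eqOn_of_preconnected_of_eventuallyEq
        (fun z hz => (hball z hz).1) (fun z hz => (hball z hz).2)
        (convex_ball (p s) ε).isPreconnected h3 h5
      exact hs (h6.eventuallyEq_of_mem (Metric.ball_mem_nhds _ hε))
    · rw [isOpen_iff_mem_nhds]
      intro s hs
      filter_upwards [hF' s, hG' s, p.eventually_eventually_nhds hs] with s' h1 h2 h3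
      exact h1.trans (Filter.EventuallyEq.trans h3 h2.symm)
  exact Set.eq_univ_iff_forall.1 (hclopen.eq_univ ⟨s₀, h0⟩) s

namespace IsContinuationAlong

variable {a₀ a₁ : ℂ} {p : Path a₀ a₁} {g h g' h' : ℂ → ℂ}

theorem analyticAt_left (H : IsContinuationAlong p g h) : AnalyticAt ℂ g a₀ := by
  obtain ⟨F, hF, -, h0, -⟩ := H
  have := hF 0
  rw [p.source] at this
  exact this.congr h0

theorem unique_left (H : IsContinuationAlong p g h) (H' : IsContinuationAlong p g' h')
    (hh : h =ᶠ[𝓝 a₁] h') : g =ᶠ[𝓝 a₀] g' := by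
  obtain ⟨F, hF, hF', h0, h1⟩ := H
  obtain ⟨G, hG, hG', k0, k1⟩ := H'
  have := eventuallyEq_along_path p hF hG hF' hG' (s₀ := 1)
    (by rw [p.target]; exact h1.trans (hh.trans k1.symm)) 0
  rw [p.source] at this
  exact h0.symm.trans (this.trans k0)

theorem unique_right (H : IsContinuationAlong p g h) (H' : IsContinuationAlong p g' h')
    (hg : g =ᶠ[𝓝 a₀] g') : h =ᶠ[𝓝 a₁] h' := by
  obtain ⟨F, hF, hF', h0, h1⟩ := H
  obtain ⟨G, hG, hG', k0, k1⟩ := H'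
  have := eventuallyEq_along_path p hF hG hF' hG' (s₀ := 0)
    (by rw [p.source]; exact h0.trans (hg.trans k0.symm)) 1
  rw [p.target] at this
  exact h1.symm.trans (this.trans k1)

theorem congr (H : IsContinuationAlong p g h) (hg : g =ᶠ[𝓝 a₀] g') (hh : h =ᶠ[𝓝 a₁] h') :
    IsContinuationAlong p g' h' := by
  obtain ⟨F, hF, hF', h0, h1⟩ := H
  exact ⟨F, hF, hF', h0.trans hg, h1.trans hh⟩

theorem of_analyticAt {f : ℂ → ℂ} (hf : ∀ s, AnalyticAt ℂ f (p s)) : IsContinuationAlong p f f :=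
  ⟨fun _ => f, hf, fun _ => Filter.Eventually.of_forall fun _ => Filter.EventuallyEq.rfl,
    Filter.EventuallyEq.rfl, Filter.EventuallyEq.rfl⟩

protected theorem deriv (H : IsContinuationAlong p g h) :
    IsContinuationAlong p (deriv g) (deriv h) := by
  obtain ⟨F, hF, hF', h0, h1⟩ := H
  exact ⟨fun s => deriv (F s), fun s => (hF s).deriv,
    fun s => (hF' s).mono fun s' hs' => hs'.deriv, h0.deriv, h1.deriv⟩

protected theorem sub (H : IsContinuationAlong p g h) (H' : IsContinuationAlong p g' h') :
    IsContinuationAlong p (fun z => g z - g' z) (fun z => h z - h' z) := by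
  obtain ⟨F, hF, hF', h0, h1⟩ := H
  obtain ⟨G, hG, hG', k0, k1⟩ := H'
  exact ⟨fun s z => F s z - G s z, fun s => (hF s).sub (hG s), fun s =>
    (hF' s).mp ((hG' s).mono fun s' e e' => e'.sub e), h0.sub k0, h1.sub k1⟩

protected theorem mul (H : IsContinuationAlong p g h) (H' : IsContinuationAlong p g' h') :
    IsContinuationAlong p (fun z => g z * g' z) (fun z => h z * h' z) := by
  obtain ⟨F, hF, hF', h0, h1⟩ := H
  obtain ⟨G, hG, hG', k0, k1⟩ := H'
  exact ⟨fun s z => F s z * G s z, fun s => (hF s).mul (hG s), fun s =>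
    (hF' s).mp ((hG' s).mono fun s' e e' => e'.mul e), h0.mul k0, h1.mul k1⟩

protected theorem const_mul (c : ℂ) (H : IsContinuationAlong p g h) :
    IsContinuationAlong p (fun z => c * g z) (fun z => c * h z) :=
  (of_analyticAt fun _ => analyticAt_const).mul H

protected theorem id_mul (H : IsContinuationAlong p g h) :
    IsContinuationAlong p (fun z => z * g z) (fun z => z * h z) :=
  (of_analyticAt fun _ => analyticAt_id).mul H

end IsContinuationAlong

section Existence

variable {X : Type*} [NormedAddCommGroup X] [NormedSpace ℂ X] [CompleteSpace X]

/-- Solutions of a linear differential equation can be continued along a path. -/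
theorem exists_solution_along {A : ℂ → X →L[ℂ] X} {a₀ a₁ : ℂ} (p : Path a₀ a₁)
    (hA : ∀ s, AnalyticAt ℂ A (p s)) {Y : ℂ → X} (hY : IsSolutionNear A Y a₀) :
    ∃ F : unitInterval → ℂ → X, (∀ s, IsSolutionNear A (F s) (p s)) ∧
      (∀ s, ∀ᶠ s' in 𝓝 s, F s' =ᶠ[𝓝 (p s')] F s) ∧ F 0 =ᶠ[𝓝 a₀] Y := by
  choose r hr Φ hΦ0 hΦ hloc using fun s => exists_local_solutions (hA s)
  -- Subdivide the path so that each piece lies in one ball with a fundamental solution, then extend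
  -- the solution piece by piece.
  obtain ⟨t, ht0, htm, ⟨N, hN⟩, ht⟩ := exists_monotone_Icc_subset_open_cover_unitInterval
    (c := fun s => p ⁻¹' Metric.ball (p s) (r s))
    (fun s => Metric.isOpen_ball.preimage p.continuous)
    (fun s _ => Set.mem_iUnion.2 ⟨s, Metric.mem_ball_self (hr s)⟩)
  have key : ∀ k : ℕ, ∃ F : unitInterval → ℂ → X, (∀ s ≤ t k, IsSolutionNear A (F s) (p s)) ∧
      (∀ s ≤ t k, ∀ᶠ s' in 𝓝 s, s' ≤ t k → F s' =ᶠ[𝓝 (p s')] F s) ∧ F 0 =ᶠ[𝓝 a₀] Y := by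
    intro k
    induction k with
    | zero =>
      refine ⟨fun _ => Y, fun s hs => ?_, fun s _ => ?_, Filter.EventuallyEq.rfl⟩
      · have : s = 0 := le_antisymm (ht0 ▸ hs) unitInterval.nonneg'
        rw [this, p.source]
        exact hY
      · exact Filter.Eventually.of_forall fun s' _ => Filter.EventuallyEq.rfl
    | succ k ih =>
      obtain ⟨F, hF, hF', hF0⟩ := ih
      obtain ⟨i, hi⟩ := ht k
      have hk : t k ≤ t (k + 1) := htm (Nat.le_succ k)
      obtain ⟨c, hc⟩ := hloc i (p (t k)) (hi ⟨le_rfl, hk⟩) (F (t k)) (hF _ le_rfl)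
      -- On the new piece the solution is `Φ c`, with `c` chosen so that it has the same germ as the
      -- old one at the junction `t k`.
      refine ⟨fun s => if s ≤ t k then F s else fun z => Φ i z c, fun s hs => ?_, fun s hs => ?_, ?_⟩
      · by_cases h : s ≤ t k
        · simpa only [if_pos h] using hF s h
        · simp only [if_neg h]
          have hsb : p s ∈ Metric.ball (p i) (r i) := hi ⟨(not_le.1 h).le, hs⟩
          filter_upwards [Metric.isOpen_ball.mem_nhds hsb] with z hz
          exact hΦ i z hz c
      · rcases lt_trichotomy s (t k) with h | rfl | h
        · filter_upwards [hF' s h.le, isOpen_Iio.mem_nhds h] with s' h1 h2 _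
          have h2 : s' ≤ t k := le_of_lt h2
          simpa only [if_pos h.le, if_pos h2] using h1 h2
        · filter_upwards [hF' _ le_rfl, p.eventually_eventually_nhds hc] with s' h1 h2 _
          by_cases h : s' ≤ t k
          · simpa only [if_pos h, if_pos le_rfl] using h1 h
          · simp only [if_neg h, if_pos le_rfl]
            exact Filter.EventuallyEq.symm h2
        · filter_upwards [isOpen_Ioi.mem_nhds h] with s' h1 _
          have h1 : ¬ s' ≤ t k := not_le.2 h1
          simp only [if_neg h1, if_neg (not_le.2 h)]
          rfl
      · simpa only [if_pos (show (0 : unitInterval) ≤ t k from unitInterval.nonneg')] using hF0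
  obtain ⟨F, hF, hF', hF0⟩ := key N
  have h1 : ∀ s, s ≤ t N := fun s => (hN N le_rfl).symm ▸ unitInterval.le_one'
  exact ⟨F, fun s => hF s (h1 s), fun s => (hF' s (h1 s)).mono fun s' h => h (h1 s'), hF0⟩

/-- The solution is known at the end of the path: continue it along the reversed path, reverse the
time, and apply the functional `l`. -/
theorem exists_isContinuationAlong {A : ℂ → X →L[ℂ] X} {a₀ a₁ : ℂ} (p : Path a₀ a₁)
    (hA : ∀ s, AnalyticAt ℂ A (p s)) {Y : ℂ → X} (hY : IsSolutionNear A Y a₁) (l : X →L[ℂ] ℂ) :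
    ∃ g, IsContinuationAlong p g fun z => l (Y z) := by
  obtain ⟨F, hF, hF', hF0⟩ := exists_solution_along p.symm (fun s => hA _) hY
  refine ⟨fun z => l (F 1 z), fun s z => l (F (unitInterval.symm s) z), fun s => ?_, fun s => ?_,
    ?_, ?_⟩
  · rw [Complex.analyticAt_iff_eventually_differentiableAt]
    have := hF (unitInterval.symm s)
    rw [Path.symm_apply, Function.comp_apply, unitInterval.symm_symm] at this
    filter_upwards [this] with z hz
    exact l.differentiableAt.comp z hz.differentiableAt
  · have h1 := unitInterval.continuous_symm.continuousAt.eventually (hF' (unitInterval.symm s))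
    filter_upwards [h1] with s' hs'
    rw [Path.symm_apply, Function.comp_apply, unitInterval.symm_symm] at hs'
    exact hs'.fun_comp l
  · simp only [unitInterval.symm_zero]
    rfl
  · simp only [unitInterval.symm_one]
    exact hF0.fun_comp l

end Existence

/-! ### The relations between normalized periods -/

/-- The relations that the normalized period integrals satisfy at a parameter `a`. -/
structure PeriodRelations (n : ℕ) (h : (Fin (n + 1) → ℕ) → ℂ → ℂ) (a : ℂ) : Prop where
  hasDerivAt : ∀ m, HasDerivAt (h m) (h (m + 1) a) a
  rel : ∀ m p, ((m p : ℂ) + 1) * h m a =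
    ((n : ℂ) + 1) * h (m + Pi.single p (n + 1)) a - a * h (m + 1) a
  rel_zero : ∀ q p, q p = 0 →
    ((n : ℂ) + 1) * h (q + Pi.single p n) a = a * h (Function.update (q + 1) p 0) a

/-- Normalizing factors `κ_j = Γ(j / (n + 1) + 1) t ^ (- j / (n + 1))`. -/
theorem exists_normalization (n : ℕ) {t : ℂ} (ht : t ≠ 0) :
    ∃ κ : ℕ → ℂ, (∀ j, κ j ≠ 0) ∧
      ∀ j, κ (j + (n + 1)) = ((j : ℂ) + n + 1) / (((n : ℂ) + 1) * t) * κ j := by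
  -- `τ` is a root of order `n + 1` of `t`, so that `τ ^ (-j)` serves as `t ^ (-j/(n+1))`.
  obtain ⟨τ, hτ⟩ := IsAlgClosed.exists_pow_nat_eq t n.succ_pos
  have hτ0 : τ ≠ 0 := by
    rintro rfl
    rw [zero_pow n.succ_ne_zero] at hτ
    exact ht hτ.symm
  have hn : ((n : ℂ) + 1) ≠ 0 := by exact_mod_cast Nat.succ_ne_zero n
  have hpos : ∀ j : ℕ, 0 < (((j : ℂ) / ((n : ℂ) + 1)) + 1).re := by
    intro j
    have : ((j : ℂ) / ((n : ℂ) + 1)) = ((j / (n + 1) : ℝ) : ℂ) := by push_cast; rfl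
    rw [this, Complex.add_re, Complex.ofReal_re, Complex.one_re]
    positivity
  refine ⟨fun j => Complex.Gamma ((j : ℂ) / ((n : ℂ) + 1) + 1) / τ ^ j, fun j => ?_, fun j => ?_⟩
  · exact div_ne_zero (Complex.Gamma_ne_zero_of_re_pos (hpos j)) (pow_ne_zero _ hτ0)
  · have h1 : (((j + (n + 1) : ℕ) : ℂ) / ((n : ℂ) + 1) + 1) =
        ((j : ℂ) / ((n : ℂ) + 1) + 1) + 1 := by
      push_cast
      field_simp
    have h2 : ((j : ℂ) / ((n : ℂ) + 1) + 1) ≠ 0 := by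
      intro h0
      have := hpos j
      rw [h0] at this
      simp at this
    simp only [h1]
    rw [Complex.Gamma_add_one _ h2, pow_add, hτ]
    field_simp
    ring

/-- The functional equation of `Γ` makes `κ` absorb the factors in `|m|` and `t`, leaving relations
with coefficients free of both. -/
theorem FlatCycle.exists_periodRelations {n : ℕ} (hn : 1 ≤ n) {t : ℂ} (ht : t ≠ 0) {V : Set ℂ}
    (hV : IsOpen V) (γ : FlatCycle n t V) :
    ∃ κ : ℕ → ℂ, (∀ j, κ j ≠ 0) ∧
      ∀ a ∈ V, PeriodRelations n (fun m a => κ (∑ i, m i) * γ.period m a) a := by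
  -- `1 ≤ n` enters here: the twice contracted volume form has degree `n - 1`.
  obtain ⟨k, rfl⟩ : ∃ k, n = k + 1 := ⟨n - 1, by omega⟩
  obtain ⟨κ, hκ0, hκ⟩ := exists_normalization (k + 1) ht
  have hk : ((k : ℂ) + 2) ≠ 0 := by exact_mod_cast Nat.succ_ne_zero (k + 1)
  have hsum1 : ∀ m : Fin (k + 1 + 1) → ℕ, ∑ i, (m + 1) i = (∑ i, m i) + (k + 1 + 1) := by
    intro m
    simp [Finset.sum_add_distrib]
  have hsum2 : ∀ (m : Fin (k + 1 + 1) → ℕ) p r, ∑ i, (m + Pi.single p r : Fin (k + 1 + 1) → ℕ) i =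
      (∑ i, m i) + r := by
    intro m p r
    simp [Finset.sum_add_distrib]
  have hκ' : ∀ j : ℕ, ((j : ℂ) + k + 2) * κ j = ((k : ℂ) + 2) * t * κ (j + (k + 1 + 1)) := by
    intro j
    rw [hκ j]
    push_cast
    have : ((k : ℂ) + 1 + 1) ≠ 0 := by rw [add_assoc, one_add_one_eq_two]; exact hk
    field_simp
    ring
  refine ⟨κ, hκ0, fun a ha => ⟨fun m => ?_, fun m p => ?_, fun q p hq => ?_⟩⟩
  · refine ((γ.hasDerivAt_period hV ht m ha).const_mul _).congr_deriv ?_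
    simp only [hsum1]
    rw [← mul_assoc, ← mul_div_assoc, mul_comm (κ _), hκ']
    field_simp
  · have h := γ.period_relation hV ht m p ha
    simp only [hsum1, hsum2]
    have h3 := hκ' (∑ i, m i)
    apply mul_left_cancel₀ (mul_ne_zero hk ht)
    push_cast
    have e1 : ((k : ℂ) + 1 + 1) = k + 2 := by ring
    rw [e1]
    linear_combination (-κ (∑ i, m i)) * h + (((k : ℂ) + 2) * γ.period (m + Pi.single p (k + 2)) a
      - a * γ.period (m + 1) a) * h3
  · have h := γ.period_relation_of_eq_zero hV ht q p hq ha
    have hs : ∑ i, Function.update (q + 1) p 0 i = (∑ i, q i) + (k + 1) := by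
      have h1 := hsum1 q
      rw [← Finset.add_sum_erase _ _ (Finset.mem_univ p)] at h1 ⊢
      rw [Function.update_self, zero_add]
      have h2 : ∑ i ∈ Finset.univ.erase p, Function.update (q + 1) p 0 i =
          ∑ i ∈ Finset.univ.erase p, (q + 1) i :=
        Finset.sum_congr rfl fun i hi => Function.update_of_ne (Finset.ne_of_mem_erase hi) _ _
      rw [h2]
      have h3 : (q + 1) p = 1 := by simp [hq]
      omega
    simp only [hsum2, hs]
    push_cast
    have e1 : ((k : ℂ) + 1 + 1) = k + 2 := by ring
    rw [e1]
    linear_combination κ (∑ i, q i + (k + 1)) * h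

/-- `m + k (1, …, 1)`. -/
def shiftExp {n : ℕ} (m : Fin (n + 1) → ℕ) (k : ℕ) : Fin (n + 1) → ℕ := fun i => m i + k

theorem shiftExp_add_one {n : ℕ} (m : Fin (n + 1) → ℕ) (k : ℕ) :
    shiftExp m k + 1 = shiftExp m (k + 1) := rfl

/-- Repeated use of the relations expresses `h_{m + (n + 1) 1_T}` by the `h_{m + k (1, …, 1)}`. -/
theorem exists_coeff_of_rel (n : ℕ) (T : Finset (Fin (n + 1))) (m : Fin (n + 1) → ℕ) :
    ∃ s : ℕ → ℂ, s T.card = 1 ∧ ∀ (h : (Fin (n + 1) → ℕ) → ℂ → ℂ) (a : ℂ),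
      (∀ m p, ((m p : ℂ) + 1) * h m a =
        ((n : ℂ) + 1) * h (m + Pi.single p (n + 1)) a - a * h (m + 1) a) →
      ((n : ℂ) + 1) ^ T.card * h (fun i => m i + if i ∈ T then n + 1 else 0) a =
        ∑ k ∈ Finset.range (T.card + 1), s k * a ^ k * h (shiftExp m k) a := by
  induction T using Finset.induction_on generalizing m with
  | empty =>
    refine ⟨fun _ => 1, rfl, fun h a _ => ?_⟩
    have : (fun i => m i + if i ∈ (∅ : Finset (Fin (n + 1))) then n + 1 else 0) = shiftExp m 0 := by
      funext i
      simp [shiftExp]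
    rw [this]
    simp
  | insert p T hp ih =>
    obtain ⟨s, hs1, hs⟩ := ih (m + Pi.single p (n + 1))
    -- The relation at `m + k 1` turns the `k`-th term into `(m_p + k + 1) s k` at index `k` and `s
    -- k` at index `k + 1`. The top coefficient is passed on unchanged and stays `1`.
    refine ⟨fun k => (if k ≤ T.card then s k * ((m p : ℂ) + k + 1) else 0) +
      if k = 0 then 0 else s (k - 1), ?_, fun h a hrel => ?_⟩
    · simp [Finset.card_insert_of_notMem hp, hs1]
    · have h1 : (fun i => m i + if i ∈ insert p T then n + 1 else 0) =
          fun i => (m + Pi.single p (n + 1) : Fin (n + 1) → ℕ) i + if i ∈ T then n + 1 else 0 := by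
        funext i
        rcases eq_or_ne i p with rfl | hi
        · simp [hp]
        · simp [hi]
      have h2 : ∀ k, ((n : ℂ) + 1) * h (shiftExp (m + Pi.single p (n + 1)) k) a =
          ((m p : ℂ) + k + 1) * h (shiftExp m k) a + a * h (shiftExp m (k + 1)) a := by
        intro k
        have h3 := hrel (shiftExp m k) p
        have h4 : shiftExp m k + Pi.single p (n + 1) = shiftExp (m + Pi.single p (n + 1)) k := by
          funext i
          simp only [shiftExp, Pi.add_apply]
          ring
        rw [h4, shiftExp_add_one] at h3
        have h5 : ((shiftExp m k p : ℕ) : ℂ) = (m p : ℂ) + k := by simp [shiftExp]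
        rw [h5] at h3
        linear_combination -h3
      rw [Finset.card_insert_of_notMem hp, pow_succ', h1, mul_assoc, hs h a hrel, Finset.mul_sum]
      simp only [add_mul, Finset.sum_add_distrib]
      rw [Finset.sum_range_succ (fun k => (if k ≤ T.card then s k * ((m p : ℂ) + k + 1) else 0) *
        a ^ k * h (shiftExp m k) a) (T.card + 1)]
      rw [Finset.sum_range_succ' (fun k => (if k = 0 then 0 else s (k - 1)) * a ^ k *
        h (shiftExp m k) a)]
      simp only [if_true, zero_mul, add_zero, Nat.succ_ne_zero, if_false, Nat.add_sub_cancel,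
        show ¬ T.card + 1 ≤ T.card by omega]
      rw [← Finset.sum_add_distrib (s := Finset.range (T.card + 1)) (M := ℂ),
        ← Finset.sum_add_distrib (s := Finset.range (T.card + 1)) (M := ℂ)]
      apply Finset.sum_congr rfl
      intro k hk
      have hk : k ≤ T.card := Nat.lt_succ_iff.1 (Finset.mem_range.1 hk)
      rw [if_pos hk]
      linear_combination s k * a ^ k * h2 k

/-- The companion matrix with last row `s`, as a linear map. -/
def companionMap (n : ℕ) (s : Fin (n + 1) → ℂ) : (Fin (n + 1) → ℂ) →L[ℂ] (Fin (n + 1) → ℂ) :=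
  ContinuousLinearMap.pi (fun k : Fin (n + 1) => if h : (k : ℕ) + 1 < n + 1 then
    (ContinuousLinearMap.proj (R := ℂ) (φ := fun _ : Fin (n + 1) => ℂ) ⟨k + 1, h⟩ :
      (Fin (n + 1) → ℂ) →L[ℂ] ℂ) else 0) +
  ∑ j : Fin (n + 1), s j •
    (ContinuousLinearMap.proj (R := ℂ) (φ := fun _ : Fin (n + 1) => ℂ) j).smulRight
      (Pi.single (Fin.last n) (1 : ℂ) : Fin (n + 1) → ℂ)

theorem companionMap_apply (n : ℕ) (s Y : Fin (n + 1) → ℂ) (k : Fin (n + 1)) :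
    companionMap n s Y k = if h : (k : ℕ) + 1 < n + 1 then Y ⟨k + 1, h⟩ else ∑ j, s j * Y j := by
  simp only [companionMap, add_apply, Pi.add_apply, ContinuousLinearMap.coe_pi', sum_apply,
    smul_apply, Finset.sum_apply, Pi.smul_apply, ContinuousLinearMap.smulRight_apply, smul_eq_mul,
    ContinuousLinearMap.proj_apply]
  by_cases hk : (k : ℕ) + 1 < n + 1
  · have hkl : k ≠ Fin.last n := by
      rintro rfl
      simp at hk
    simp [hk, Pi.single_eq_of_ne hkl]
  · obtain rfl : k = Fin.last n := by
      apply Fin.ext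
      have := k.2
      simp only [Fin.val_last]
      omega
    simp

theorem analyticAt_companionMap (n : ℕ) {s : ℂ → Fin (n + 1) → ℂ} {a : ℂ}
    (hs : ∀ j, AnalyticAt ℂ (fun z => s z j) a) :
    AnalyticAt ℂ (fun z => companionMap n (s z)) a := by
  unfold companionMap
  refine AnalyticAt.fun_add analyticAt_const ?_
  exact Finset.analyticAt_fun_sum _ fun j _ => (hs j).fun_smul analyticAt_const

/-- The matrix of the linear differential equation satisfied by
`(h_m, h_{m + (1, …, 1)}, …, h_{m + n (1, …, 1)})`. -/
def periodMatrix (n : ℕ) (s : ℕ → ℂ) (a : ℂ) : (Fin (n + 1) → ℂ) →L[ℂ] (Fin (n + 1) → ℂ) :=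
  companionMap n fun j => s j * a ^ (j : ℕ) / (((n : ℂ) + 1) ^ (n + 1) - a ^ (n + 1))

theorem analyticAt_periodMatrix (n : ℕ) (s : ℕ → ℂ) {a : ℂ} (ha : a ∈ dworkBase n) :
    AnalyticAt ℂ (periodMatrix n s) a := by
  have h0 : ((n : ℂ) + 1) ^ (n + 1) - a ^ (n + 1) ≠ 0 := sub_ne_zero.2 (Ne.symm ha)
  exact analyticAt_companionMap n fun j => AnalyticAt.fun_div (by fun_prop) (by fun_prop) h0

/-- With all coordinates raised, `h_{m+(n+1)1}` occurs on both sides of the relation, with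
coefficients `(n+1)^(n+1)` and `a^(n+1)`. On the base it can be solved for, which closes the chain
of derivatives. -/
theorem exists_isSolutionNear (n : ℕ) (m : Fin (n + 1) → ℕ) :
    ∃ s : ℕ → ℂ, ∀ (h : (Fin (n + 1) → ℕ) → ℂ → ℂ) (a : ℂ), a ∈ dworkBase n →
      (∀ᶠ z in 𝓝 a, PeriodRelations n h z) →
      IsSolutionNear (periodMatrix n s) (fun z k => h (shiftExp m k) z) a := by
  obtain ⟨s, hs1, hs⟩ := exists_coeff_of_rel n Finset.univ m
  refine ⟨s, fun h a ha hrel => ?_⟩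
  have hbase : ∀ᶠ z in 𝓝 a, z ∈ dworkBase n :=
    (continuous_pow (n + 1)).continuousAt.eventually_ne ha
  filter_upwards [hrel, hbase] with z hz hzb
  have h0 : ((n : ℂ) + 1) ^ (n + 1) - z ^ (n + 1) ≠ 0 := sub_ne_zero.2 (Ne.symm hzb)
  refine hasDerivAt_pi.2 fun k => (hz.hasDerivAt (shiftExp m k)).congr_deriv ?_
  rw [shiftExp_add_one]
  rw [periodMatrix, companionMap_apply]
  split_ifs with hk
  · rfl
  · obtain rfl : k = Fin.last n := by
      apply Fin.ext
      have := k.2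
      simp only [Fin.val_last]
      omega
    have h1 := hs h z hz.rel
    simp only [Finset.mem_univ, if_true, Finset.card_univ, Fintype.card_fin] at h1 hs1
    rw [Finset.sum_range_succ, hs1, one_mul] at h1
    have h2 : (fun i => m i + (n + 1)) = shiftExp m (n + 1) := rfl
    rw [h2, Finset.sum_range] at h1
    have h3 : h (shiftExp m (n + 1)) z = (∑ j : Fin (n + 1), s j * z ^ (j : ℕ) *
        h (shiftExp m j) z) / (((n : ℂ) + 1) ^ (n + 1) - z ^ (n + 1)) := by
      rw [eq_div_iff h0]
      linear_combination h1
    rw [Fin.val_last, h3, Finset.sum_div]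
    exact Finset.sum_congr rfl fun j _ => by ring

/-- Families of functions with the period relations can be continued along paths in the base. -/
theorem PeriodRelations.exists_continuation {n : ℕ} {h : (Fin (n + 1) → ℕ) → ℂ → ℂ} {a₀ a₁ : ℂ}
    (hrel : ∀ᶠ z in 𝓝 a₁, PeriodRelations n h z) (p : Path a₀ a₁) (hp : ∀ s, p s ∈ dworkBase n) :
    ∃ g : (Fin (n + 1) → ℕ) → ℂ → ℂ, (∀ m, IsContinuationAlong p (g m) (h m)) ∧
      (∀ m, deriv (g m) =ᶠ[𝓝 a₀] g (m + 1)) ∧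
      (∀ m p, ((m p : ℂ) + 1) * g m a₀ =
        ((n : ℂ) + 1) * g (m + Pi.single p (n + 1)) a₀ - a₀ * g (m + 1) a₀) ∧
      ∀ q p, q p = 0 →
        ((n : ℂ) + 1) * g (q + Pi.single p n) a₀ = a₀ * g (Function.update (q + 1) p 0) a₀ := by
  have hex : ∀ m, ∃ g, IsContinuationAlong p g (h m) := by
    intro m
    obtain ⟨s, hs⟩ := exists_isSolutionNear n m
    have ha₁ : a₁ ∈ dworkBase n := by simpa using hp 1
    exact exists_isContinuationAlong p (fun r => analyticAt_periodMatrix n s (hp r))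
      (hs h a₁ ha₁ hrel) (ContinuousLinearMap.proj (R := ℂ) (φ := fun _ : Fin (n + 1) => ℂ) 0)
  choose g hg using hex
  -- Each `h m` was continued by its own system. The relations linking different `m` hold near `a₁`;
  -- both sides continue along `p`, so they agree near `a₀`.
  refine ⟨g, hg, fun m => ?_, fun m i => ?_, fun q i hq => ?_⟩
  · exact (hg m).deriv.unique_left (hg (m + 1)) (hrel.mono fun z hz => (hz.hasDerivAt m).deriv)
  · have h1 := ((hg m).const_mul ((m i : ℂ) + 1)).unique_left
      (((hg (m + Pi.single i (n + 1))).const_mul ((n : ℂ) + 1)).sub (hg (m + 1)).id_mul)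
      (hrel.mono fun z hz => hz.rel m i)
    exact h1.self_of_nhds
  · have h1 := ((hg (q + Pi.single i n)).const_mul ((n : ℂ) + 1)).unique_left
      (hg (Function.update (q + 1) i 0)).id_mul (hrel.mono fun z hz => hz.rel_zero q i hq)
    exact h1.self_of_nhds

/-! ### The coefficients of the series -/

/-- The coefficients of the series in `periodFun`. -/
def gCoeff (n : ℕ) (m : Fin (n + 1) → ℕ) (δ j : ℕ) : ℂ :=
  (∏ i, (ascPochhammer ℂ j).eval (upperParam n m δ i)) /
    ∏ i, (ascPochhammer ℂ j).eval (lowerParam n δ i)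

theorem gTerm_eq (n : ℕ) (m : Fin (n + 1) → ℕ) (δ : ℕ) (b : ℂ) (j : ℕ) :
    gTerm (upperParam n m δ) (lowerParam n δ) b j = gCoeff n m δ j * b ^ j := rfl

theorem gCoeff_zero (n : ℕ) (m : Fin (n + 1) → ℕ) (δ : ℕ) : gCoeff n m δ 0 = 1 := by
  simp [gCoeff]

theorem add_one_ne_zero_cast (n : ℕ) : (n : ℂ) + 1 ≠ 0 := by
  exact_mod_cast n.succ_ne_zero

theorem prod_lower_ne_zero (n k : ℕ) : ∏ l : Fin (n + 1), ((k : ℂ) + (l : ℕ) + 1) ≠ 0 := by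
  refine Finset.prod_ne_zero_iff.2 fun l _ => ?_
  exact_mod_cast (k + l).succ_ne_zero

theorem lowerParam_add (n δ j : ℕ) (l : Fin (n + 1)) :
    lowerParam n δ l + j = ((δ + (n + 1) * j : ℕ) + (l : ℕ) + 1) / ((n : ℂ) + 1) := by
  have := add_one_ne_zero_cast n
  rw [lowerParam]
  push_cast
  field_simp
  ring

theorem upperParam_add (n : ℕ) (m : Fin (n + 1) → ℕ) (δ j : ℕ) (l : Fin (n + 1)) :
    upperParam n m δ l + j = ((δ + (n + 1) * j : ℕ) + m l + 1) / ((n : ℂ) + 1) := by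
  have := add_one_ne_zero_cast n
  rw [upperParam]
  push_cast
  field_simp
  ring

theorem gCoeff_succ (n : ℕ) (m : Fin (n + 1) → ℕ) (δ j : ℕ) :
    gCoeff n m δ (j + 1) * ∏ l : Fin (n + 1), (((δ + (n + 1) * j : ℕ) : ℂ) + (l : ℕ) + 1) =
      gCoeff n m δ j * ∏ i, (((δ + (n + 1) * j : ℕ) : ℂ) + m i + 1) := by
  have h0 := prod_lower_ne_zero n (δ + (n + 1) * j)
  have hn := pow_ne_zero (n + 1) (add_one_ne_zero_cast n)
  simp only [gCoeff, ascPochhammer_succ_eval, Finset.prod_mul_distrib, lowerParam_add,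
    upperParam_add, Finset.prod_div_distrib, Finset.prod_const, Finset.card_univ, Fintype.card_fin]
  field_simp

/-! ### Expansion at the origin -/

section Expansion

variable {n : ℕ} {g : (Fin (n + 1) → ℕ) → ℂ → ℂ}

theorem iteratedDeriv_eventuallyEq_shiftExp (hd : ∀ m, deriv (g m) =ᶠ[𝓝 0] g (m + 1))
    (m : Fin (n + 1) → ℕ) (k : ℕ) : iteratedDeriv k (g m) =ᶠ[𝓝 0] g (shiftExp m k) := by
  induction k with
  | zero => rw [iteratedDeriv_zero]; rfl
  | succ k ih =>
    rw [iteratedDeriv_succ]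
    exact ih.deriv.trans (hd (shiftExp m k))

variable (hrel : ∀ m p, ((m p : ℂ) + 1) * g m 0 = ((n : ℂ) + 1) * g (m + Pi.single p (n + 1)) 0)
include hrel

/-- Lowering `m p` by `n + 1` changes the value by a factor only; the descent ends at `m p = n`,
where the relation for a missing variable applies. -/
theorem apply_zero_eq_zero (hrel0 : ∀ (q : Fin (n + 1) → ℕ) p, q p = 0 → g (q + Pi.single p n) 0 = 0)
    (m : Fin (n + 1) → ℕ) (p : Fin (n + 1)) (hp : n + 1 ∣ m p + 1) : g m 0 = 0 := by
  obtain ⟨j, hj⟩ := hp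
  induction j generalizing m with
  | zero => omega
  | succ j ih =>
    rcases Nat.eq_zero_or_pos j with rfl | hj0
    · have h1 : Function.update m p 0 + Pi.single p n = m := by
        funext i
        rcases eq_or_ne i p with rfl | hi
        · simp; omega
        · simp [hi]
      rw [← h1]
      exact hrel0 _ p (by simp)
    · have h1 : Function.update m p (m p - (n + 1)) + Pi.single p (n + 1) = m := by
        funext i
        rcases eq_or_ne i p with rfl | hi
        · have : n + 1 ≤ m i := by nlinarith
          simp; omega
        · simp [hi]
      have h2 := hrel (Function.update m p (m p - (n + 1))) p
      rw [h1, ih _ (by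
        have : n + 1 ≤ m p := by nlinarith
        simp only [Function.update_self]
        rw [mul_add] at hj
        omega), mul_zero] at h2
      exact (mul_eq_zero.1 h2.symm).resolve_left (add_one_ne_zero_cast n)

theorem prod_mul_apply_zero (T : Finset (Fin (n + 1))) (m : Fin (n + 1) → ℕ) :
    ((n : ℂ) + 1) ^ T.card * g (fun i => m i + if i ∈ T then n + 1 else 0) 0 =
      (∏ i ∈ T, ((m i : ℂ) + 1)) * g m 0 := by
  induction T using Finset.induction_on with
  | empty => simp
  | insert p T hp ih =>
    have h1 := hrel (fun i => m i + if i ∈ T then n + 1 else 0) p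
    have h2 : (fun i => m i + if i ∈ T then n + 1 else 0) + Pi.single p (n + 1) =
        fun i => m i + if i ∈ insert p T then n + 1 else 0 := by
      funext i
      rcases eq_or_ne i p with rfl | hi
      · simp [hp]
      · simp [hi]
    rw [h2] at h1
    simp only [hp, if_false, add_zero] at h1
    rw [Finset.card_insert_of_notMem hp, Finset.prod_insert hp]
    linear_combination ((m p : ℂ) + 1) * ih - ((n : ℂ) + 1) ^ T.card * h1

/-- Raising every exponent by `n + 1` amounts to `n + 1` derivatives in `a`, so this is a recursion
between Taylor coefficients at `0`. -/
theorem apply_zero_shiftExp_add (m : Fin (n + 1) → ℕ) (k : ℕ) :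
    ((n : ℂ) + 1) ^ (n + 1) * g (shiftExp m (k + (n + 1))) 0 =
      (∏ i, ((k : ℂ) + m i + 1)) * g (shiftExp m k) 0 := by
  have h := prod_mul_apply_zero hrel Finset.univ (shiftExp m k)
  simp only [Finset.mem_univ, if_true, Finset.card_univ, Fintype.card_fin] at h
  have h1 : (fun i => shiftExp m k i + (n + 1)) = shiftExp m (k + (n + 1)) := by
    funext i
    simp [shiftExp, add_assoc]
  rw [h1] at h
  rw [h]
  congr 1
  refine Finset.prod_congr rfl fun i _ => ?_
  simp only [shiftExp]
  push_cast
  ring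

/-- Division by the factorials puts `∏ (k + l)`, `1 ≤ l ≤ n + 1`, in the denominator of the
recursion, as for `gCoeff`. The remaining powers of `(n+1)^(n+1)` are the denominator of `b`. -/
theorem apply_zero_shiftExp_div_factorial (m : Fin (n + 1) → ℕ) (δ j : ℕ) :
    g (shiftExp m (δ + (n + 1) * j)) 0 / ((δ + (n + 1) * j).factorial : ℂ) =
      g (shiftExp m δ) 0 / (δ.factorial : ℂ) * (gCoeff n m δ j /
        (((n : ℂ) + 1) ^ (n + 1)) ^ j) := by
  have hn := pow_ne_zero (n + 1) (add_one_ne_zero_cast n)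
  induction j with
  | zero => simp [gCoeff_zero]
  | succ j ih =>
    set k := δ + (n + 1) * j with hk
    have h0 := prod_lower_ne_zero n k
    have h1 : δ + (n + 1) * (j + 1) = k + (n + 1) := by rw [hk]; ring
    have h2 : ((k + (n + 1)).factorial : ℂ) =
        k.factorial * ∏ l : Fin (n + 1), ((k : ℂ) + (l : ℕ) + 1) := by
      rw [← Nat.factorial_mul_ascFactorial, Nat.ascFactorial_eq_prod_range, Finset.prod_range]
      push_cast
      congr 1
      exact Finset.prod_congr rfl fun l _ => by ring
    have h3 := apply_zero_shiftExp_add hrel m k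
    have h4 := gCoeff_succ n m δ j
    rw [← hk] at h4
    have h5 : (k.factorial : ℂ) ≠ 0 := by exact_mod_cast k.factorial_ne_zero
    have h6 : (δ.factorial : ℂ) ≠ 0 := by exact_mod_cast δ.factorial_ne_zero
    rw [h1, h2]
    have h7 : gCoeff n m δ (j + 1) = gCoeff n m δ j * (∏ i, ((k : ℂ) + m i + 1)) /
        ∏ l : Fin (n + 1), ((k : ℂ) + (l : ℕ) + 1) := by
      rw [eq_div_iff h0, h4]
    have h8 : g (shiftExp m (k + (n + 1))) 0 = (∏ i, ((k : ℂ) + m i + 1)) *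
        g (shiftExp m k) 0 / ((n : ℂ) + 1) ^ (n + 1) := by
      rw [eq_div_iff hn, ← h3, mul_comm]
    have h9 : g (shiftExp m k) 0 = k.factorial * (g (shiftExp m δ) 0 / (δ.factorial : ℂ) *
        (gCoeff n m δ j / (((n : ℂ) + 1) ^ (n + 1)) ^ j)) := by
      rw [← ih]
      field_simp
    rw [h8, h9, h7, pow_succ (((n : ℂ) + 1) ^ (n + 1))]
    generalize ∏ l : Fin (n + 1), ((k : ℂ) + (l : ℕ) + 1) = L at *
    generalize ((n : ℂ) + 1) ^ (n + 1) = M at *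
    field_simp

/-- Split the Taylor series by the residue of the exponent modulo `n + 1`: class `δ` sums to its
first coefficient times `periodFun n m δ`, and that coefficient vanishes for inadmissible `δ`. -/
theorem eventuallyEq_sum_periodFun (hrel0 : ∀ (q : Fin (n + 1) → ℕ) p, q p = 0 → g (q + Pi.single p n) 0 = 0)
    (hd : ∀ m, deriv (g m) =ᶠ[𝓝 0] g (m + 1)) (m : Fin (n + 1) → ℕ) (ha : AnalyticAt ℂ (g m) 0) :
    ∃ c : ℕ → ℂ, g m =ᶠ[𝓝 0] fun a => ∑ δ ∈ admissible n m, c δ * periodFun n m δ a := by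
  refine ⟨fun δ => g (shiftExp m δ) 0 / (δ.factorial : ℂ), ?_⟩
  have h1 := hasFPowerSeriesAt_iff.1 ha.hasFPowerSeriesAt
  filter_upwards [h1] with a hs
  simp only [zero_add, FormalMultilinearSeries.coeff_ofScalars, smul_eq_mul,
    (iteratedDeriv_eventuallyEq_shiftExp hd m _).self_of_nhds] at hs
  rw [← hs.tsum_eq, Nat.sumByResidueClasses hs.summable (n + 1)]
  have h2 : ∀ δ : ℕ, ∑' j, a ^ (δ + (n + 1) * j) * (g (shiftExp m (δ + (n + 1) * j)) 0 /
      ((δ + (n + 1) * j).factorial : ℂ)) =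
      g (shiftExp m δ) 0 / (δ.factorial : ℂ) * periodFun n m δ a := by
    intro δ
    rw [periodFun, gSeries, ← mul_assoc, ← tsum_mul_left]
    refine tsum_congr fun j => ?_
    rw [apply_zero_shiftExp_div_factorial hrel, gTerm_eq, bCoord, div_pow, pow_add, pow_mul]
    ring
  simp only [h2]
  -- The residue classes are indexed by `ZMod (n + 1)`, which is `Fin (n + 1)` by definition.
  change ∑ j : Fin (n + 1), g (shiftExp m (j : ℕ)) 0 / ((j : ℕ).factorial : ℂ) *
    periodFun n m j a = _
  rw [Fin.sum_univ_eq_sum_range (fun j => g (shiftExp m j) 0 / (j.factorial : ℂ) *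
    periodFun n m j a), admissible, Finset.sum_filter]
  refine Finset.sum_congr rfl fun δ _ => ?_
  split_ifs with h
  · rfl
  · push Not at h
    obtain ⟨i, hi⟩ := h
    rw [ZMod.natCast_eq_zero_iff] at hi
    rw [apply_zero_eq_zero hrel hrel0 (shiftExp m δ) i (by
      simpa only [shiftExp, add_comm δ] using hi)]
    simp

end Expansion

/-- A member of a family with the period relations is, continued to the origin, a combination of
the functions `periodFun`. -/
theorem PeriodRelations.exists_continuation_sum {n : ℕ} {h : (Fin (n + 1) → ℕ) → ℂ → ℂ} {a₁ : ℂ}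
    (hrel : ∀ᶠ z in 𝓝 a₁, PeriodRelations n h z) (p : Path 0 a₁) (hp : ∀ s, p s ∈ dworkBase n)
    (m : Fin (n + 1) → ℕ) : ∃ c : ℕ → ℂ, IsContinuationAlong p
      (fun a => ∑ δ ∈ admissible n m, c δ * periodFun n m δ a) (h m) := by
  obtain ⟨g, hg, hd, h1, h2⟩ := PeriodRelations.exists_continuation hrel p hp
  obtain ⟨c, hc⟩ := eventuallyEq_sum_periodFun (g := g) (fun m i => by simpa using h1 m i)
    (fun q i hq => by simpa [add_one_ne_zero_cast n] using h2 q i hq) hd m (hg m).analyticAt_left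
  exact ⟨c, (hg m).congr hc Filter.EventuallyEq.rfl⟩

theorem FlatCycle.exists_isContinuationAlong {n : ℕ} (hn : 1 ≤ n) {t : ℂ} (ht : t ≠ 0) {V : Set ℂ}
    (hV : IsOpen V) (γ : FlatCycle n t V) (m : Fin (n + 1) → ℕ) {a₁ : ℂ} (ha₁ : a₁ ∈ V)
    (p : Path 0 a₁) (hp : ∀ s, p s ∈ dworkBase n) : ∃ c : ℕ → ℂ, IsContinuationAlong p
      (fun a => ∑ δ ∈ admissible n m, c δ * periodFun n m δ a) (γ.period m) := by
  obtain ⟨κ, hκ, hrel⟩ := γ.exists_periodRelations hn ht hV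
  obtain ⟨c, hc⟩ := PeriodRelations.exists_continuation_sum
    ((hV.eventually_mem ha₁).mono hrel) p hp m
  have hκm := hκ (∑ i, m i)
  refine ⟨fun δ => (κ (∑ i, m i))⁻¹ * c δ, (hc.const_mul (κ (∑ i, m i))⁻¹).congr ?_ ?_⟩
  · refine Filter.Eventually.of_forall fun a => ?_
    simp only [Finset.mul_sum, mul_assoc]
  · refine Filter.Eventually.of_forall fun a => ?_
    simp [hκm]

/-! ### Convergence of the series -/

theorem gCoeff_ne_zero (n : ℕ) (m : Fin (n + 1) → ℕ) (δ j : ℕ) : gCoeff n m δ j ≠ 0 := by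
  induction j with
  | zero => simp [gCoeff_zero]
  | succ j ih =>
    intro h
    have h1 := gCoeff_succ n m δ j
    rw [h, zero_mul] at h1
    refine mul_ne_zero ih (Finset.prod_ne_zero_iff.2 fun i _ => ?_) h1.symm
    exact_mod_cast (δ + (n + 1) * j + m i).succ_ne_zero

/-- Upper and lower parameters are equal in number, so the ratio is a product of `n + 1` factors
tending to `1`; the radius of convergence is therefore at least `1`. -/
theorem tendsto_gCoeff_ratio (n : ℕ) (m : Fin (n + 1) → ℕ) (δ : ℕ) :
    Filter.Tendsto (fun j => gCoeff n m δ (j + 1) / gCoeff n m δ j) Filter.atTop (𝓝 1) := by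
  have h1 : ∀ j, gCoeff n m δ (j + 1) / gCoeff n m δ j =
      ∏ i : Fin (n + 1), (1 + ((m i : ℂ) - (i : ℕ)) *
        (((δ + (n + 1) * j + i + 1 : ℕ) : ℂ))⁻¹) := by
    intro j
    have h2 : ∀ i : Fin (n + 1), 1 + ((m i : ℂ) - (i : ℕ)) *
        (((δ + (n + 1) * j + i + 1 : ℕ) : ℂ))⁻¹ =
        (((δ + (n + 1) * j : ℕ) : ℂ) + m i + 1) / (((δ + (n + 1) * j : ℕ) : ℂ) + (i : ℕ) + 1) := by
      intro i
      have h3 : ((δ + (n + 1) * j : ℕ) : ℂ) + (i : ℕ) + 1 ≠ 0 := by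
        exact_mod_cast (δ + (n + 1) * j + i).succ_ne_zero
      have h4 : ((δ + (n + 1) * j + i + 1 : ℕ) : ℂ) = ((δ + (n + 1) * j : ℕ) : ℂ) + (i : ℕ) + 1 := by
        push_cast
        ring
      rw [h4]
      field_simp
      ring
    simp only [h2]
    rw [Finset.prod_div_distrib, div_eq_div_iff (gCoeff_ne_zero n m δ j) (prod_lower_ne_zero n _),
      gCoeff_succ, mul_comm]
  simp only [h1]
  have h2 : ∀ i : Fin (n + 1), Filter.Tendsto (fun j : ℕ => 1 + ((m i : ℂ) - (i : ℕ)) *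
      (((δ + (n + 1) * j + i + 1 : ℕ) : ℂ))⁻¹) Filter.atTop (𝓝 1) := by
    intro i
    have h3 : Filter.Tendsto (fun j : ℕ => (((δ + (n + 1) * j + i + 1 : ℕ) : ℂ))⁻¹)
        Filter.atTop (𝓝 0) := by
      refine (tendsto_inv_atTop_nhds_zero_nat (𝕜 := ℂ)).comp ?_
      refine Filter.tendsto_atTop_mono (fun j => ?_) Filter.tendsto_id
      simp only [id]
      nlinarith
    simpa using (h3.const_mul ((m i : ℂ) - (i : ℕ))).const_add 1
  simpa using tendsto_finsetProd Finset.univ fun i _ => h2 i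

/-- `∑ w_j b ^ j` converges in the unit disc. -/
def ConvergesInDisc (w : ℕ → ℂ) : Prop := ∀ b : ℂ, ‖b‖ < 1 → Summable fun j => w j * b ^ j

theorem convergesInDisc_gCoeff (n : ℕ) (m : Fin (n + 1) → ℕ) (δ : ℕ) :
    ConvergesInDisc (gCoeff n m δ) := by
  intro b hb
  rcases eq_or_ne b 0 with rfl | hb0
  · exact summable_of_ne_finset_zero (s := {0}) fun k hk => by
      rw [zero_pow (by simpa using hk), mul_zero]
  · refine summable_of_ratio_test_tendsto_lt_one hb (Filter.Eventually.of_forall fun j =>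
      mul_ne_zero (gCoeff_ne_zero n m δ j) (pow_ne_zero j hb0)) ?_
    have h1 := ((tendsto_gCoeff_ratio n m δ).norm.mul_const ‖b‖)
    rw [norm_one, one_mul] at h1
    refine h1.congr fun j => ?_
    have h2 : ‖b‖ ≠ 0 := norm_ne_zero_iff.2 hb0
    rw [norm_mul, norm_mul, norm_div, norm_pow, norm_pow, pow_succ]
    field_simp

namespace ConvergesInDisc

variable {w w' : ℕ → ℂ}

/-- The terms of the convergent series at `b = r` are bounded. -/
theorem exists_norm_le (hw : ConvergesInDisc w) {r : ℝ} (hr : 0 < r) (hr1 : r < 1) :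
    ∃ C, ∀ j, ‖w j‖ ≤ C * (1 / r) ^ j := by
  have h1 := (hw r (by rwa [Complex.norm_real, Real.norm_of_nonneg hr.le])).tendsto_atTop_zero
  obtain ⟨C, hC⟩ := (Metric.isBounded_range_of_tendsto _ h1).exists_norm_le
  refine ⟨C, fun j => ?_⟩
  have h2 := hC _ ⟨j, rfl⟩
  rw [norm_mul, norm_pow, Complex.norm_real, Real.norm_of_nonneg hr.le] at h2
  rw [one_div, inv_pow, ← div_eq_mul_inv, le_div_iff₀ (pow_pos hr j)]
  exact h2

theorem nat_mul (hw : ConvergesInDisc w) : ConvergesInDisc fun j => (j : ℂ) * w j := by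
  intro b hb
  obtain ⟨r, hbr, hr1⟩ := exists_between hb
  have hr : 0 < r := (norm_nonneg b).trans_lt hbr
  obtain ⟨C, hC⟩ := hw.exists_norm_le hr hr1
  have h1 : ‖b‖ / r < 1 := (div_lt_one hr).2 hbr
  have h2 : Summable fun j : ℕ => C * ((j : ℝ) ^ 1 * (‖b‖ / r) ^ j) :=
    (summable_pow_mul_geometric_of_norm_lt_one 1 (by
      rwa [Real.norm_of_nonneg (by positivity)])).mul_left C
  refine Summable.of_norm_bounded h2 fun j => ?_
  rw [norm_mul, norm_mul, norm_pow, Complex.norm_natCast, div_pow]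
  calc (j : ℝ) * ‖w j‖ * ‖b‖ ^ j ≤ j * (C * (1 / r) ^ j) * ‖b‖ ^ j := by gcongr; exact hC j
    _ = _ := by rw [one_div, inv_pow]; ring

theorem const_mul (c : ℂ) (hw : ConvergesInDisc w) : ConvergesInDisc fun j => c * w j :=
  fun b hb => by simpa only [mul_assoc] using (hw b hb).mul_left c

theorem add (hw : ConvergesInDisc w) (hw' : ConvergesInDisc w') :
    ConvergesInDisc fun j => w j + w' j :=
  fun b hb => by simpa only [add_mul] using (hw b hb).add (hw' b hb)

theorem affine_mul (hw : ConvergesInDisc w) (n δ : ℕ) :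
    ConvergesInDisc fun j => ((δ + (n + 1) * j : ℕ) : ℂ) * w j := by
  have := (hw.const_mul (δ : ℂ)).add (hw.nat_mul.const_mul ((n : ℂ) + 1))
  convert this using 2 with j
  push_cast
  ring

theorem affine_pow_mul (hw : ConvergesInDisc w) (n δ k : ℕ) :
    ConvergesInDisc fun j => ((δ + (n + 1) * j : ℕ) : ℂ) ^ k * w j := by
  induction k with
  | zero => simpa using hw
  | succ k ih => simpa only [pow_succ', mul_assoc] using ih.affine_mul n δ

theorem hasDerivAt (hw : ConvergesInDisc w) {b : ℂ} (hb : ‖b‖ < 1) :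
    ∃ D, HasDerivAt (fun b : ℂ => ∑' j : ℕ, w j * b ^ j) D b ∧ b * D = ∑' j : ℕ, (j : ℂ) * w j * b ^ j := by
  obtain ⟨r, hbr, hr1⟩ := exists_between hb
  have hr : 0 < r := (norm_nonneg b).trans_lt hbr
  obtain ⟨C, hC⟩ := hw.exists_norm_le hr hr1
  have h1 := hasDerivAt_tsum_pow_smul (z := b) (one_div_pos.2 hr) hC (by rwa [one_div_one_div])
  simp only [smul_eq_mul] at h1
  refine ⟨_, by simpa only [mul_comm] using h1, ?_⟩
  rw [Summable.tsum_eq_zero_add (f := fun j : ℕ => (j : ℂ) * w j * b ^ j) (hw.nat_mul b hb),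
    Nat.cast_zero, zero_mul, zero_mul, zero_add,
    ← tsum_mul_left]
  refine tsum_congr fun j => ?_
  push_cast
  ring

end ConvergesInDisc

/-! ### The operator `θ` on series -/

/-- The function `a ^ δ ∑ w_j b ^ j`. -/
def diskSeries (n δ : ℕ) (w : ℕ → ℂ) (a : ℂ) : ℂ := a ^ δ * ∑' j, w j * bCoord n a ^ j

theorem periodFun_eq_diskSeries (n : ℕ) (m : Fin (n + 1) → ℕ) (δ : ℕ) :
    periodFun n m δ = diskSeries n δ (gCoeff n m δ) := rfl

theorem norm_bCoord_lt_one (n : ℕ) {a : ℂ} (ha : a ∈ Metric.ball (0 : ℂ) ((n : ℝ) + 1)) :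
    ‖bCoord n a‖ < 1 := by
  have h1 : ‖(n : ℂ) + 1‖ = n + 1 := by
    have : ((n : ℂ) + 1) = ((n + 1 : ℕ) : ℂ) := by push_cast; rfl
    rw [this, Complex.norm_natCast]
    push_cast
    rfl
  rw [bCoord, norm_div, norm_pow, norm_pow, h1, ← div_pow]
  refine pow_lt_one₀ (by positivity) ?_ n.succ_ne_zero
  rw [div_lt_one (by positivity)]
  simpa using ha

theorem hasDerivAt_bCoord (n : ℕ) (a : ℂ) :
    HasDerivAt (bCoord n) (((n : ℂ) + 1) * a ^ n / ((n : ℂ) + 1) ^ (n + 1)) a := by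
  refine ((hasDerivAt_pow (n + 1) a).div_const (((n : ℂ) + 1) ^ (n + 1))).congr_deriv ?_
  simp

/-- `θ` multiplies `a^δ b^j` by `δ + (n+1) j`, since `b` is a constant times `a^(n+1)`. -/
theorem exists_hasDerivAt_diskSeries {n δ : ℕ} {w : ℕ → ℂ} (hw : ConvergesInDisc w) {a : ℂ}
    (ha : a ∈ Metric.ball (0 : ℂ) ((n : ℝ) + 1)) :
    ∃ D, HasDerivAt (diskSeries n δ w) D a ∧
      a * D = diskSeries n δ (fun j => ((δ + (n + 1) * j : ℕ) : ℂ) * w j) a := by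
  have hb := norm_bCoord_lt_one n ha
  obtain ⟨D, hD, hbD⟩ := hw.hasDerivAt hb
  refine ⟨_, (hasDerivAt_pow δ a).mul (hD.comp a (hasDerivAt_bCoord n a)), ?_⟩
  have h1 : a * ((δ : ℂ) * a ^ (δ - 1)) = δ * a ^ δ := by
    rcases δ with _ | δ
    · simp
    · rw [Nat.add_sub_cancel, pow_succ]
      ring
  have h2 : a * (((n : ℂ) + 1) * a ^ n / ((n : ℂ) + 1) ^ (n + 1)) = ((n : ℂ) + 1) * bCoord n a := by
    rw [bCoord, pow_succ]
    ring
  have h3 : ∑' j, ((δ + (n + 1) * j : ℕ) : ℂ) * w j * bCoord n a ^ j =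
      δ * (∑' j, w j * bCoord n a ^ j) + ((n : ℂ) + 1) * (bCoord n a * D) := by
    rw [hbD, ← tsum_mul_left, ← tsum_mul_left, ← ((hw _ hb).mul_left _).tsum_add
      ((hw.nat_mul _ hb).mul_left _)]
    refine tsum_congr fun j => ?_
    push_cast
    ring
  rw [diskSeries, h3]
  linear_combination (∑' j, w j * bCoord n a ^ j) * h1 + a ^ δ * D * h2

theorem analyticOnNhd_diskSeries (n δ : ℕ) {w : ℕ → ℂ} (hw : ConvergesInDisc w) :
    AnalyticOnNhd ℂ (diskSeries n δ w) (Metric.ball 0 ((n : ℝ) + 1)) :=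
  DifferentiableOn.analyticOnNhd (fun _ ha => (exists_hasDerivAt_diskSeries hw ha).choose_spec.1
    |>.differentiableAt.differentiableWithinAt) Metric.isOpen_ball

theorem analyticOnNhd_periodFun (n : ℕ) (m : Fin (n + 1) → ℕ) (δ : ℕ) :
    AnalyticOnNhd ℂ (periodFun n m δ) (Metric.ball 0 ((n : ℝ) + 1)) :=
  analyticOnNhd_diskSeries n δ (convergesInDisc_gCoeff n m δ)

theorem theta_eqOn {U : Set ℂ} (hU : IsOpen U) {y y' : ℂ → ℂ} (h : Set.EqOn y y' U) :
    Set.EqOn (theta y) (theta y') U := fun a ha => by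
  rw [theta, theta, (h.eventuallyEq_of_mem (hU.mem_nhds ha)).deriv_eq]

theorem iterate_theta_eqOn {U : Set ℂ} (hU : IsOpen U) {y y' : ℂ → ℂ} (h : Set.EqOn y y' U)
    (k : ℕ) : Set.EqOn (theta^[k] y) (theta^[k] y') U := by
  induction k with
  | zero => exact h
  | succ k ih =>
    rw [Function.iterate_succ_apply', Function.iterate_succ_apply']
    exact theta_eqOn hU ih

theorem thetaPoly_eqOn {U : Set ℂ} (hU : IsOpen U) {y y' : ℂ → ℂ} (h : Set.EqOn y y' U)
    (p : Polynomial ℂ) : Set.EqOn (thetaPoly p y) (thetaPoly p y') U := fun a ha => by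
  simp only [thetaPoly, Polynomial.sum, fun k => iterate_theta_eqOn hU h k ha]

theorem iterate_theta_diskSeries (n δ : ℕ) {w : ℕ → ℂ} (hw : ConvergesInDisc w) (k : ℕ) :
    Set.EqOn (theta^[k] (diskSeries n δ w))
      (diskSeries n δ fun j => ((δ + (n + 1) * j : ℕ) : ℂ) ^ k * w j)
      (Metric.ball 0 ((n : ℝ) + 1)) := by
  induction k with
  | zero => intro a _; simp
  | succ k ih =>
    intro a ha
    rw [Function.iterate_succ_apply', theta_eqOn Metric.isOpen_ball ih ha]
    obtain ⟨D, hD, haD⟩ := exists_hasDerivAt_diskSeries (n := n) (δ := δ)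
      (hw.affine_pow_mul n δ k) ha
    rw [theta, hD.deriv, haD]
    simp only [pow_succ', mul_assoc]

theorem thetaPoly_diskSeries (n δ : ℕ) {w : ℕ → ℂ} (hw : ConvergesInDisc w) (p : Polynomial ℂ)
    {a : ℂ} (ha : a ∈ Metric.ball (0 : ℂ) ((n : ℝ) + 1)) :
    thetaPoly p (diskSeries n δ w) a =
      diskSeries n δ (fun j => p.eval ((δ + (n + 1) * j : ℕ) : ℂ) * w j) a ∧
    Summable fun j => p.eval ((δ + (n + 1) * j : ℕ) : ℂ) * w j * bCoord n a ^ j := by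
  have hb := norm_bCoord_lt_one n ha
  have hs : ∀ k ∈ p.support, Summable fun j => p.coeff k *
      (((δ + (n + 1) * j : ℕ) : ℂ) ^ k * w j * bCoord n a ^ j) :=
    fun k _ => (hw.affine_pow_mul n δ k _ hb).mul_left _
  have he : ∀ j : ℕ, p.eval ((δ + (n + 1) * j : ℕ) : ℂ) * w j * bCoord n a ^ j =
      ∑ k ∈ p.support, p.coeff k * (((δ + (n + 1) * j : ℕ) : ℂ) ^ k * w j * bCoord n a ^ j) := by
    intro j
    rw [Polynomial.eval_eq_sum, Polynomial.sum, Finset.sum_mul, Finset.sum_mul]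
    exact Finset.sum_congr rfl fun k _ => by ring
  refine ⟨?_, (summable_sum hs).congr fun j => (he j).symm⟩
  rw [diskSeries, tsum_congr he, Summable.tsum_finsetSum hs, thetaPoly, Polynomial.sum,
    Finset.mul_sum]
  refine Finset.sum_congr rfl fun k _ => ?_
  rw [iterate_theta_diskSeries n δ hw k ha, diskSeries, tsum_mul_left]
  ring

/-! ### The polynomials in the reduced Picard-Fuchs equation -/

/-- The left polynomial of the reduced Picard-Fuchs equation. -/
def pfLeft (n : ℕ) (m : Fin (n + 1) → ℕ) : Polynomial ℂ :=
  ∏ δ ∈ admissible n m, (Polynomial.X - Polynomial.C (δ : ℂ))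

/-- The right polynomial of the reduced Picard-Fuchs equation. -/
def pfRight (n : ℕ) (m : Fin (n + 1) → ℕ) : Polynomial ℂ :=
  ((Finset.univ.val.map m - (Finset.univ.val.map m).dedup).map
    fun v : ℕ => Polynomial.X + Polynomial.C ((v : ℂ) + 1)).prod

theorem reducedPicardFuchs_eq (n : ℕ) (m : Fin (n + 1) → ℕ) (y : ℂ → ℂ) (a : ℂ) :
    reducedPicardFuchs n m y a =
      thetaPoly (pfLeft n m) y a - bCoord n a * thetaPoly (pfRight n m) y a := by
  -- The `bind` and `pure` stem from the coercion of the multiset of naturals to complex numbers in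
  -- `reducedPicardFuchs`.
  simp only [reducedPicardFuchs, pfLeft, pfRight, Multiset.bind_def, Multiset.pure_def,
    Multiset.bind_singleton, Multiset.map_map, Function.comp_def]

theorem monic_pfLeft (n : ℕ) (m : Fin (n + 1) → ℕ) : (pfLeft n m).Monic :=
  Polynomial.monic_prod_of_monic _ _ fun _ _ => Polynomial.monic_X_sub_C _

theorem natDegree_pfLeft (n : ℕ) (m : Fin (n + 1) → ℕ) :
    (pfLeft n m).natDegree = (admissible n m).card := by
  rw [pfLeft, Polynomial.natDegree_prod_of_monic _ _ fun _ _ => Polynomial.monic_X_sub_C _]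
  simp only [Polynomial.natDegree_X_sub_C, Finset.sum_const, smul_eq_mul, mul_one]

theorem monic_pfRight (n : ℕ) (m : Fin (n + 1) → ℕ) : (pfRight n m).Monic :=
  Polynomial.monic_multiset_prod_of_monic _ _ fun _ _ => Polynomial.monic_X_add_C _

theorem natDegree_pfRight (n : ℕ) (m : Fin (n + 1) → ℕ) :
    (pfRight n m).natDegree + (Finset.univ.image m).card = n + 1 := by
  rw [pfRight, Polynomial.natDegree_multiset_prod_of_monic _ (by
    intro p hp
    obtain ⟨v, -, rfl⟩ := Multiset.mem_map.1 hp
    exact Polynomial.monic_X_add_C _)]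
  have h1 : (Finset.univ.image m).card = ((Finset.univ.val.map m).dedup).card := rfl
  have h2 := Multiset.card_le_card (Multiset.dedup_le (Finset.univ.val.map m))
  rw [h1, Multiset.map_map]
  simp only [Function.comp_def, Polynomial.natDegree_X_add_C, Multiset.map_const',
    Multiset.sum_replicate, smul_eq_mul, mul_one]
  rw [Multiset.card_sub (Multiset.dedup_le _), Nat.sub_add_cancel h2]
  simp

theorem eval_pfRight_mul (n : ℕ) (m : Fin (n + 1) → ℕ) (e : ℂ) :
    (pfRight n m).eval e * ∏ v ∈ Finset.univ.image m, (e + v + 1) = ∏ i, (e + m i + 1) := by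
  have h1 : ∏ v ∈ Finset.univ.image m, (e + v + 1) =
      (((Finset.univ.val.map m).dedup).map fun v : ℕ => e + v + 1).prod := rfl
  have h2 : (pfRight n m).eval e = ((Finset.univ.val.map m - (Finset.univ.val.map m).dedup).map
      fun v : ℕ => e + v + 1).prod := by
    rw [pfRight, Polynomial.eval_multiset_prod, Multiset.map_map]
    simp [Function.comp_def, add_assoc]
  rw [h1, h2, ← Multiset.prod_add, ← Multiset.map_add,
    tsub_add_cancel_of_le (Multiset.dedup_le _), Multiset.map_map]
  rfl

theorem image_sub_subset (n : ℕ) (m : Fin (n + 1) → ℕ) :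
    (Finset.univ.image m).image (n - ·) ⊆ Finset.range (n + 1) := by
  intro δ hδ
  obtain ⟨v, -, rfl⟩ := Finset.mem_image.1 hδ
  simp only [Finset.mem_range]
  omega

section Small

variable {n : ℕ} {m : Fin (n + 1) → ℕ} (hm : ∀ i, m i < n)
include hm

/-- For `δ ≤ n` and `m i < n`, `δ + m i + 1` lies strictly between `0` and `2 (n + 1)`; it is a
multiple of `n + 1` only for `δ = n - m i`. -/
theorem admissible_eq_sdiff :
    admissible n m = Finset.range (n + 1) \ (Finset.univ.image m).image (n - ·) := by
  ext δ
  simp only [admissible, Finset.mem_filter, Finset.mem_sdiff, Finset.mem_range, Finset.mem_image,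
    Finset.mem_univ, true_and, exists_exists_eq_and, not_exists]
  refine and_congr_right fun hδ => forall_congr' fun i => not_congr ?_
  rw [ZMod.natCast_eq_zero_iff]
  have := hm i
  constructor
  · rintro ⟨k, hk⟩
    have h1 : 0 < k := Nat.pos_of_ne_zero (by rintro rfl; omega)
    have h2 : k < 2 := by
      by_contra h
      have : (n + 1) * 2 ≤ (n + 1) * k := Nat.mul_le_mul_left _ (not_lt.1 h)
      omega
    obtain rfl : k = 1 := by omega
    omega
  · intro h
    exact ⟨1, by omega⟩

theorem injOn_sub : Set.InjOn (n - ·) (Finset.univ.image m : Set ℕ) := by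
  intro v hv v' hv' h
  simp only [Finset.coe_image, Finset.coe_univ, Set.image_univ, Set.mem_range] at hv hv'
  obtain ⟨i, rfl⟩ := hv
  obtain ⟨i', rfl⟩ := hv'
  have := hm i
  have := hm i'
  simp only at h
  omega

/-- Both numbers are `n + 1` minus the number of distinct `m i`. With equal degrees, the coefficient
of the top power of `θ` in the equation is `1 - b`. -/
theorem card_admissible : (admissible n m).card = (pfRight n m).natDegree := by
  have h1 := natDegree_pfRight n m
  have h2 := Finset.card_image_of_injOn (injOn_sub hm)
  rw [admissible_eq_sdiff hm, Finset.card_sdiff_of_subset (image_sub_subset n m), h2,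
    Finset.card_range]
  omega

theorem card_admissible_pos : 0 < (admissible n m).card := by
  have h1 := natDegree_pfRight n m
  have h2 : (Finset.univ.image m).card ≤ n := by
    have : Finset.univ.image m ⊆ Finset.range n := by
      intro v hv
      obtain ⟨i, -, rfl⟩ := Finset.mem_image.1 hv
      exact Finset.mem_range.2 (hm i)
    simpa using Finset.card_le_card this
  rw [card_admissible hm]
  omega

/-- At `e + n + 1` the missing factor for `δ = n - v` equals `e + v + 1`; restoring these factors
gives the product over all `δ ≤ n`. -/
theorem eval_pfLeft_mul (e : ℂ) :
    (pfLeft n m).eval (e + (n + 1)) * ∏ v ∈ Finset.univ.image m, (e + v + 1) =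
      ∏ l : Fin (n + 1), (e + (l : ℕ) + 1) := by
  have h1 : ∏ v ∈ Finset.univ.image m, (e + v + 1) =
      ∏ δ ∈ (Finset.univ.image m).image (n - ·), (e + (n + 1) - (δ : ℂ)) := by
    rw [Finset.prod_image (injOn_sub hm)]
    refine Finset.prod_congr rfl fun v hv => ?_
    obtain ⟨i, -, rfl⟩ := Finset.mem_image.1 hv
    rw [Nat.cast_sub (hm i).le]
    ring
  have h2 : (pfLeft n m).eval (e + (n + 1)) =
      ∏ δ ∈ admissible n m, (e + (n + 1) - (δ : ℂ)) := by
    simp [pfLeft, Polynomial.eval_prod]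
  rw [h1, h2, admissible_eq_sdiff hm, Finset.prod_sdiff (image_sub_subset n m),
    ← Finset.prod_range_reflect, Finset.prod_range]
  refine Finset.prod_congr rfl fun l _ => ?_
  have : (l : ℕ) ≤ n := Nat.lt_succ_iff.1 l.2
  rw [Nat.add_sub_cancel, Nat.cast_sub this]
  ring

/-- The recursion for `gCoeff` with the factors `e + v + 1` of the distinct exponents cancelled;
these are nonzero since `e` and `v` are natural numbers. -/
theorem eval_pfLeft_mul_gCoeff_succ (δ j : ℕ) :
    (pfLeft n m).eval ((δ + (n + 1) * (j + 1) : ℕ) : ℂ) * gCoeff n m δ (j + 1) =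
      (pfRight n m).eval ((δ + (n + 1) * j : ℕ) : ℂ) * gCoeff n m δ j := by
  set e : ℂ := ((δ + (n + 1) * j : ℕ) : ℂ) with he
  have h0 : ∏ v ∈ Finset.univ.image m, (e + v + 1) ≠ 0 := by
    refine Finset.prod_ne_zero_iff.2 fun v _ => ?_
    rw [he]
    exact_mod_cast (δ + (n + 1) * j + v).succ_ne_zero
  have h1 : ((δ + (n + 1) * (j + 1) : ℕ) : ℂ) = e + (n + 1) := by
    rw [he]
    push_cast
    ring
  have h2 := gCoeff_succ n m δ j
  rw [← he, ← eval_pfLeft_mul hm, ← eval_pfRight_mul] at h2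
  rw [h1]
  refine mul_right_cancel₀ h0 ?_
  linear_combination h2

/-- Multiplication by `b` shifts the index, so the coefficients cancel by the recursion; the
unmatched initial term vanishes because `δ` is a root of the left polynomial. -/
theorem reducedPicardFuchs_periodFun {δ : ℕ} (hδ : δ ∈ admissible n m) {a : ℂ}
    (ha : a ∈ Metric.ball (0 : ℂ) ((n : ℝ) + 1)) :
    reducedPicardFuchs n m (periodFun n m δ) a = 0 := by
  have hw := convergesInDisc_gCoeff n m δ
  obtain ⟨h1, h1'⟩ := thetaPoly_diskSeries n δ hw (pfLeft n m) ha
  obtain ⟨h2, -⟩ := thetaPoly_diskSeries n δ hw (pfRight n m) ha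
  have h3 : (pfLeft n m).eval ((δ + (n + 1) * 0 : ℕ) : ℂ) = 0 := by
    rw [pfLeft, Polynomial.eval_prod]
    exact Finset.prod_eq_zero hδ (by simp)
  rw [reducedPicardFuchs_eq, periodFun_eq_diskSeries, h1, h2, diskSeries, diskSeries,
    h1'.tsum_eq_zero_add, h3]
  simp only [eval_pfLeft_mul_gCoeff_succ hm, pow_succ, ← mul_assoc, tsum_mul_right]
  ring

end Small

/-! ### Linearity and analyticity -/

theorem AnalyticOnNhd.theta {y : ℂ → ℂ} {U : Set ℂ} (hy : AnalyticOnNhd ℂ y U) :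
    AnalyticOnNhd ℂ (theta y) U := fun a ha => analyticAt_id.mul (hy a ha).deriv

theorem AnalyticOnNhd.iterate_theta {y : ℂ → ℂ} {U : Set ℂ} (hy : AnalyticOnNhd ℂ y U) (k : ℕ) :
    AnalyticOnNhd ℂ (_root_.theta^[k] y) U := by
  induction k with
  | zero => exact hy
  | succ k ih =>
    rw [Function.iterate_succ_apply']
    exact ih.theta

theorem iterate_theta_sum {ι : Type*} (s : Finset ι) (c : ι → ℂ) {y : ι → ℂ → ℂ} {U : Set ℂ}
    (hU : IsOpen U) (hy : ∀ i ∈ s, AnalyticOnNhd ℂ (y i) U) (k : ℕ) :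
    Set.EqOn (theta^[k] fun a => ∑ i ∈ s, c i * y i a) (fun a => ∑ i ∈ s, c i * (theta^[k] (y i)) a)
      U := by
  induction k with
  | zero => intro a _; rfl
  | succ k ih =>
    intro a ha
    rw [Function.iterate_succ_apply', theta_eqOn hU ih ha, theta, (HasDerivAt.fun_sum fun i hi =>
      (((hy i hi).iterate_theta k a ha).differentiableAt.hasDerivAt.const_mul (c i))).deriv,
      Finset.mul_sum]
    refine Finset.sum_congr rfl fun i _ => ?_
    rw [Function.iterate_succ_apply', theta]
    ring

theorem thetaPoly_sum {ι : Type*} (s : Finset ι) (c : ι → ℂ) {y : ι → ℂ → ℂ} {U : Set ℂ}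
    (hU : IsOpen U) (hy : ∀ i ∈ s, AnalyticOnNhd ℂ (y i) U) (p : Polynomial ℂ) {a : ℂ}
    (ha : a ∈ U) : thetaPoly p (fun a => ∑ i ∈ s, c i * y i a) a =
      ∑ i ∈ s, c i * thetaPoly p (y i) a := by
  simp only [thetaPoly, Polynomial.sum, fun k => iterate_theta_sum s c hU hy k ha, Finset.mul_sum]
  rw [Finset.sum_comm]
  exact Finset.sum_congr rfl fun i _ => Finset.sum_congr rfl fun k _ => by ring

theorem reducedPicardFuchs_sum {n : ℕ} {m : Fin (n + 1) → ℕ} (hm : ∀ i, m i < n) (c : ℕ → ℂ)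
    {a : ℂ} (ha : a ∈ Metric.ball (0 : ℂ) ((n : ℝ) + 1)) :
    reducedPicardFuchs n m (fun a => ∑ δ ∈ admissible n m, c δ * periodFun n m δ a) a = 0 := by
  have hy : ∀ δ ∈ admissible n m, AnalyticOnNhd ℂ (periodFun n m δ) _ :=
    fun δ _ => analyticOnNhd_periodFun n m δ
  rw [reducedPicardFuchs_eq, thetaPoly_sum _ c Metric.isOpen_ball hy _ ha,
    thetaPoly_sum _ c Metric.isOpen_ball hy _ ha, Finset.mul_sum, ← Finset.sum_sub_distrib]
  refine Finset.sum_eq_zero fun δ hδ => ?_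
  have := reducedPicardFuchs_periodFun hm hδ ha
  rw [reducedPicardFuchs_eq] at this
  linear_combination c δ * this

theorem analyticOnNhd_sum_periodFun (n : ℕ) (m : Fin (n + 1) → ℕ) (c : ℕ → ℂ) :
    AnalyticOnNhd ℂ (fun a => ∑ δ ∈ admissible n m, c δ * periodFun n m δ a)
      (Metric.ball 0 ((n : ℝ) + 1)) := fun a ha =>
  Finset.analyticAt_fun_sum _ fun δ _ =>
    analyticAt_const.fun_mul (analyticOnNhd_periodFun n m δ a ha)

/-! ### Linear independence -/

/-- The functions start with distinct powers `a^δ`. Once all coefficients below `k` vanish, dividing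
by `a^k` and letting `a → 0` isolates `c k`. -/
theorem eq_zero_of_sum_periodFun_eq_zero {n : ℕ} {m : Fin (n + 1) → ℕ} {c : ℕ → ℂ}
    (h : ∀ᶠ a in 𝓝 (0 : ℂ), ∑ δ ∈ admissible n m, c δ * periodFun n m δ a = 0) :
    ∀ δ ∈ admissible n m, c δ = 0 := by
  intro δ
  induction δ using Nat.strong_induction_on with
  | _ k ih =>
  intro hk
  -- `G δ` is `periodFun n m δ` divided by `a ^ k`. The truncated subtraction is harmless, as only
  -- `δ ≥ k` enter `F`.
  set G : ℕ → ℂ → ℂ := fun δ a => a ^ (δ - k) * diskSeries n 0 (gCoeff n m δ) a with hG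
  have hG0 : ∀ δ, diskSeries n 0 (gCoeff n m δ) 0 = 1 := by
    intro δ
    rw [diskSeries, pow_zero, one_mul, bCoord, zero_pow n.succ_ne_zero, zero_div,
      tsum_eq_single 0 fun j hj => by rw [zero_pow hj, mul_zero], gCoeff_zero]
    simp
  set F : ℂ → ℂ := fun a => ∑ δ ∈ (admissible n m).filter (k ≤ ·), c δ * G δ a with hF
  have hFc : ContinuousAt F 0 := by
    refine AnalyticAt.continuousAt (𝕜 := ℂ) (Finset.analyticAt_fun_sum _ fun δ _ =>
      analyticAt_const.fun_mul (AnalyticAt.fun_mul (by fun_prop)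
        (analyticOnNhd_diskSeries n 0 (convergesInDisc_gCoeff n m δ) 0 ?_)))
    simp only [Metric.mem_ball, dist_self]
    positivity
  have h1 : ∀ᶠ a in 𝓝[≠] (0 : ℂ), F a = 0 := by
    filter_upwards [nhdsWithin_le_nhds h, self_mem_nhdsWithin] with a ha ha0
    have h2 : ∑ δ ∈ admissible n m, c δ * periodFun n m δ a = a ^ k * F a := by
      rw [hF, Finset.mul_sum, Finset.sum_filter]
      refine Finset.sum_congr rfl fun δ hδ => ?_
      split_ifs with hkδ
      · simp only [hG, periodFun_eq_diskSeries, diskSeries, pow_zero, one_mul]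
        rw [show a ^ δ = a ^ (δ - k) * a ^ k by rw [← pow_add, Nat.sub_add_cancel hkδ]]
        ring
      · rw [ih δ (not_le.1 hkδ) hδ, zero_mul]
    rw [h2] at ha
    exact (mul_eq_zero.1 ha).resolve_left (pow_ne_zero k ha0)
  have h2 : F 0 = 0 := by
    refine tendsto_nhds_unique (l := 𝓝[≠] (0 : ℂ)) (hFc.tendsto.mono_left nhdsWithin_le_nhds) ?_
    exact tendsto_const_nhds.congr' (h1.mono fun a ha => ha.symm)
  have h3 : F 0 = c k := by
    rw [hF]
    simp only
    rw [Finset.sum_eq_single_of_mem k (Finset.mem_filter.2 ⟨hk, le_rfl⟩)]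
    · rw [hG]
      simp [hG0]
    · intro δ hδ hδk
      have : δ - k ≠ 0 := by
        have := (Finset.mem_filter.1 hδ).2
        omega
      rw [hG]
      simp [zero_pow this]
  rw [← h3, h2]

/-! ### Solutions of the reduced Picard-Fuchs equation -/

theorem thetaPoly_of_monic {p : Polynomial ℂ} (hp : p.Monic) {d : ℕ} (hd : p.natDegree = d)
    (y : ℂ → ℂ) (a : ℂ) :
    thetaPoly p y a = ∑ k : Fin d, p.coeff k * (theta^[k] y) a + (theta^[d] y) a := by
  rw [thetaPoly, Polynomial.sum_over_range _ fun k => zero_mul _, hd, Finset.sum_range_succ,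
    Finset.sum_range, ← hd, hp.coeff_natDegree, one_mul]

/-- The matrix of the linear differential equation satisfied by `(y, θ y, …, θ ^ e y)` for a
solution `y` of the reduced Picard-Fuchs equation of order `e + 1`. -/
def pfMatrix (n : ℕ) (m : Fin (n + 1) → ℕ) (e : ℕ) (a : ℂ) :
    (Fin (e + 1) → ℂ) →L[ℂ] (Fin (e + 1) → ℂ) :=
  a⁻¹ • companionMap e fun k =>
    (bCoord n a * (pfRight n m).coeff k - (pfLeft n m).coeff k) / (1 - bCoord n a)

theorem one_sub_bCoord_ne_zero (n : ℕ) {a : ℂ} (ha : a ∈ Metric.ball (0 : ℂ) ((n : ℝ) + 1)) :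
    1 - bCoord n a ≠ 0 := by
  intro h
  have h1 := norm_bCoord_lt_one n ha
  rw [← sub_eq_zero.1 h, norm_one] at h1
  exact lt_irrefl _ h1

theorem analyticAt_pfMatrix (n : ℕ) (m : Fin (n + 1) → ℕ) (e : ℕ) {a : ℂ}
    (ha : a ∈ Metric.ball (0 : ℂ) ((n : ℝ) + 1)) (ha0 : a ≠ 0) :
    AnalyticAt ℂ (pfMatrix n m e) a := by
  have hb : AnalyticAt ℂ (bCoord n) a := by
    unfold bCoord
    fun_prop
  refine (analyticAt_id.inv ha0).fun_smul (analyticAt_companionMap e fun k => ?_)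
  exact ((hb.fun_mul analyticAt_const).fun_sub analyticAt_const).fun_div
    (analyticAt_const.fun_sub hb) (one_sub_bCoord_ne_zero n ha)

/-- Both polynomials are monic of degree `e + 1`, so the equation can be solved for `θ^(e+1) y`
after division by `1 - b`. Passing from `θ` to `d/da` requires `a ≠ 0`. -/
theorem isSolutionNear_of_reducedPicardFuchs {n : ℕ} {m : Fin (n + 1) → ℕ} (hm : ∀ i, m i < n)
    {e : ℕ} (he : (admissible n m).card = e + 1) {y : ℂ → ℂ} {V : Set ℂ} (hV : IsOpen V)
    (hVb : V ⊆ Metric.ball 0 ((n : ℝ) + 1)) (hy : AnalyticOnNhd ℂ y V)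
    (hpf : ∀ a ∈ V, reducedPicardFuchs n m y a = 0) {a : ℂ} (ha : a ∈ V) (ha0 : a ≠ 0) :
    IsSolutionNear (pfMatrix n m e) (fun z (k : Fin (e + 1)) => (theta^[k] y) z) a := by
  filter_upwards [hV.mem_nhds ha, isOpen_ne.mem_nhds ha0] with z hz hz0
  refine hasDerivAt_pi.2 fun k =>
    ((hy.iterate_theta k z hz).differentiableAt.hasDerivAt).congr_deriv ?_
  have h1 : deriv (theta^[k] y) z = z⁻¹ * (theta^[k + 1] y) z := by
    rw [Function.iterate_succ_apply', theta, inv_mul_cancel_left₀ hz0]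
  rw [h1, pfMatrix, smul_apply, Pi.smul_apply, companionMap_apply, smul_eq_mul]
  congr 1
  split_ifs with hk
  · rfl
  · have hk : (k : ℕ) + 1 = e + 1 := by
      have := k.2
      omega
    have h2 := hpf z hz
    have hb := one_sub_bCoord_ne_zero n (hVb hz)
    rw [reducedPicardFuchs_eq, thetaPoly_of_monic (monic_pfLeft n m)
      ((natDegree_pfLeft n m).trans he), thetaPoly_of_monic (monic_pfRight n m)
      ((card_admissible hm).symm.trans he)] at h2
    rw [hk]
    refine mul_left_cancel₀ hb ?_
    rw [Finset.mul_sum]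
    have h3 : ∀ j : Fin (e + 1), (1 - bCoord n z) * ((bCoord n z * (pfRight n m).coeff j -
        (pfLeft n m).coeff j) / (1 - bCoord n z) * (theta^[j] y) z) =
        bCoord n z * ((pfRight n m).coeff j * (theta^[j] y) z) -
          (pfLeft n m).coeff j * (theta^[j] y) z := by
      intro j
      field_simp
    rw [Finset.sum_congr rfl fun j _ => h3 j, Finset.sum_sub_distrib, ← Finset.mul_sum]
    linear_combination h2

/-- A solution of the reduced Picard-Fuchs equation is determined by its initial values. -/
theorem eventuallyEq_of_reducedPicardFuchs {n : ℕ} {m : Fin (n + 1) → ℕ} (hm : ∀ i, m i < n)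
    {e : ℕ} (he : (admissible n m).card = e + 1) {y y' : ℂ → ℂ} {V : Set ℂ} (hV : IsOpen V)
    (hVb : V ⊆ Metric.ball 0 ((n : ℝ) + 1)) (hy : AnalyticOnNhd ℂ y V)
    (hpf : ∀ a ∈ V, reducedPicardFuchs n m y a = 0) (hy' : AnalyticOnNhd ℂ y' V)
    (hpf' : ∀ a ∈ V, reducedPicardFuchs n m y' a = 0) {a : ℂ} (ha : a ∈ V) (ha0 : a ≠ 0)
    (heq : ∀ k : Fin (e + 1), (theta^[k] y) a = (theta^[k] y') a) : y =ᶠ[𝓝 a] y' := by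
  have h1 := isSolutionNear_of_reducedPicardFuchs hm he hV hVb hy hpf ha ha0
  have h2 := isSolutionNear_of_reducedPicardFuchs hm he hV hVb hy' hpf' ha ha0
  have h3 : IsSolutionNear (pfMatrix n m e) (fun z => (fun k : Fin (e + 1) => (theta^[k] y) z) -
      fun k : Fin (e + 1) => (theta^[k] y') z) a := by
    filter_upwards [h1, h2] with z hz hz'
    exact (hz.fun_sub hz').congr_deriv (by rw [map_sub])
  have h4 := h3.eventuallyEq_zero (analyticAt_pfMatrix n m e (hVb ha) ha0)
    (sub_eq_zero.2 (funext heq))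
  filter_upwards [h4] with z hz
  exact sub_eq_zero.1 (congrFun hz 0)

/-- The initial values depend linearly on `|A|` coefficients and lie in a space of the same
dimension. A combination with zero initial values vanishes near `a`, hence on the disc, hence has
zero coefficients by comparison at `0`; injectivity gives surjectivity. -/
theorem exists_initial_values {n : ℕ} {m : Fin (n + 1) → ℕ} (hm : ∀ i, m i < n) {e : ℕ}
    (he : (admissible n m).card = e + 1) {a : ℂ} (ha : a ∈ Metric.ball (0 : ℂ) ((n : ℝ) + 1))
    (ha0 : a ≠ 0) (v : Fin (e + 1) → ℂ) : ∃ c : ℕ → ℂ, ∀ k : Fin (e + 1),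
      (theta^[k] fun a => ∑ δ ∈ admissible n m, c δ * periodFun n m δ a) a = v k := by
  classical
  let T : (admissible n m → ℂ) →ₗ[ℂ] (Fin (e + 1) → ℂ) :=
    Fintype.linearCombination ℂ fun δ (k : Fin (e + 1)) => (theta^[k] (periodFun n m δ)) a
  let ext : (admissible n m → ℂ) → ℕ → ℂ := fun c δ => if h : δ ∈ admissible n m then c ⟨δ, h⟩ else 0
  have hT : ∀ (c : admissible n m → ℂ) (k : Fin (e + 1)),
      (theta^[k] fun a => ∑ δ ∈ admissible n m, ext c δ * periodFun n m δ a) a = T c k := by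
    intro c k
    rw [iterate_theta_sum _ _ Metric.isOpen_ball (fun δ _ => analyticOnNhd_periodFun n m δ) k ha]
    simp only
    rw [← Finset.sum_coe_sort]
    simp [T, ext, Fintype.linearCombination_apply]
  have hinj : Function.Injective T := by
    refine (injective_iff_map_eq_zero T).2 fun c hc => ?_
    have h1 : (fun a => ∑ δ ∈ admissible n m, ext c δ * periodFun n m δ a) =ᶠ[𝓝 a]
        fun a => ∑ δ ∈ admissible n m, (0 : ℂ) * periodFun n m δ a := by
      refine eventuallyEq_of_reducedPicardFuchs hm he Metric.isOpen_ball subset_rfl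
        (analyticOnNhd_sum_periodFun n m _) (fun z hz => reducedPicardFuchs_sum hm _ hz)
        (analyticOnNhd_sum_periodFun n m fun _ => 0)
        (fun z hz => reducedPicardFuchs_sum hm (fun _ => 0) hz) ha ha0 fun k => ?_
      have h0 : ext 0 = fun _ => 0 := by
        funext δ
        simp [ext]
      have h2 := hT 0 k
      rw [h0] at h2
      rw [hT, hc, h2, map_zero]
    have h2 := (analyticOnNhd_sum_periodFun n m (ext c)).eqOn_of_preconnected_of_eventuallyEq
      (analyticOnNhd_sum_periodFun n m fun _ => 0) (convex_ball _ _).isPreconnected ha h1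
    have h3 : (0 : ℂ) ∈ Metric.ball (0 : ℂ) ((n : ℝ) + 1) := Metric.mem_ball_self (by positivity)
    have h4 := eq_zero_of_sum_periodFun_eq_zero (n := n) (m := m) (c := ext c) (by
      filter_upwards [Metric.isOpen_ball.mem_nhds h3] with z hz
      simpa using h2 hz)
    funext δ
    simpa [ext] using h4 δ δ.2
  have hsurj : Function.Surjective T := by
    refine (LinearMap.injective_iff_surjective_of_finrank_eq_finrank ?_).1 hinj
    simp [he]
  obtain ⟨c, hc⟩ := hsurj v
  exact ⟨ext c, fun k => by rw [hT, hc]⟩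

theorem exists_eqOn_sum_periodFun {n : ℕ} {m : Fin (n + 1) → ℕ} (hm : ∀ i, m i < n)
    {V : Set ℂ} (hV : IsOpen V) (hVc : IsPreconnected V) (hVb : V ⊆ Metric.ball 0 ((n : ℝ) + 1))
    {y : ℂ → ℂ} (hy : DifferentiableOn ℂ y V) (hpf : ∀ a ∈ V, reducedPicardFuchs n m y a = 0) :
    ∃ c : ℕ → ℂ, ∀ a ∈ V, y a = ∑ δ ∈ admissible n m, c δ * periodFun n m δ a := by
  rcases V.eq_empty_or_nonempty with rfl | hne
  · exact ⟨0, by simp⟩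
  -- The first-order system is singular at `0`, so initial values are matched at another point of
  -- `V`; the identity theorem covers the rest.
  obtain ⟨a, ha, ha0⟩ := (dense_compl_singleton (0 : ℂ)).inter_open_nonempty V hV hne
  have ha0 : a ≠ 0 := ha0
  obtain ⟨e, he⟩ := Nat.exists_eq_succ_of_ne_zero (card_admissible_pos hm).ne'
  obtain ⟨c, hc⟩ := exists_initial_values hm he (hVb ha) ha0
    fun k : Fin (e + 1) => (theta^[k] y) a
  refine ⟨c, ?_⟩
  have hya := hy.analyticOnNhd hV
  have hs := (analyticOnNhd_sum_periodFun n m c).mono hVb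
  exact hya.eqOn_of_preconnected_of_eventuallyEq hs hVc ha
    (eventuallyEq_of_reducedPicardFuchs hm he hV hVb hya hpf hs
      (fun z hz => reducedPicardFuchs_sum hm c (hVb hz)) ha ha0 fun k => (hc k).symm)

theorem reducedPicardFuchs_of_eqOn {n : ℕ} {m : Fin (n + 1) → ℕ} (hm : ∀ i, m i < n)
    {V : Set ℂ} (hV : IsOpen V) (hVb : V ⊆ Metric.ball 0 ((n : ℝ) + 1)) {y : ℂ → ℂ} {c : ℕ → ℂ}
    (hyc : ∀ a ∈ V, y a = ∑ δ ∈ admissible n m, c δ * periodFun n m δ a) :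
    DifferentiableOn ℂ y V ∧ ∀ a ∈ V, reducedPicardFuchs n m y a = 0 := by
  refine ⟨((analyticOnNhd_sum_periodFun n m c).mono hVb).differentiableOn.congr hyc,
    fun a ha => ?_⟩
  rw [← reducedPicardFuchs_sum hm c (hVb ha), reducedPicardFuchs_eq, reducedPicardFuchs_eq,
    thetaPoly_eqOn hV hyc _ ha, thetaPoly_eqOn hV hyc _ ha]

/-! ### Periods over the disc -/

theorem ball_subset_dworkBase (n : ℕ) : Metric.ball (0 : ℂ) ((n : ℝ) + 1) ⊆ dworkBase n := by
  intro a ha h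
  have h1 := one_sub_bCoord_ne_zero n ha
  rw [bCoord, h, div_self (pow_ne_zero _ (add_one_ne_zero_cast n)), sub_self] at h1
  exact h1 rfl

/-- Join `0` to a point of `V` inside the disc. A combination of the `periodFun` is holomorphic
there and is its own continuation, so it agrees with the period near that point, and on all of `V`
by the identity theorem. -/
theorem FlatCycle.exists_period_eq_sum {n : ℕ} (hn : 1 ≤ n) {t : ℂ} (ht : t ≠ 0) {V : Set ℂ}
    (hV : IsOpen V) (hVc : IsPreconnected V) (hVb : V ⊆ Metric.ball 0 ((n : ℝ) + 1))
    (γ : FlatCycle n t V) (m : Fin (n + 1) → ℕ) :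
    ∃ c : ℕ → ℂ, ∀ a ∈ V, γ.period m a = ∑ δ ∈ admissible n m, c δ * periodFun n m δ a := by
  rcases V.eq_empty_or_nonempty with rfl | ⟨a₁, ha₁⟩
  · exact ⟨0, by simp⟩
  have h0 : (0 : ℂ) ∈ Metric.ball (0 : ℂ) ((n : ℝ) + 1) := Metric.mem_ball_self (by positivity)
  have hjoin : JoinedIn (Metric.ball (0 : ℂ) ((n : ℝ) + 1)) 0 a₁ :=
    ((convex_ball (0 : ℂ) ((n : ℝ) + 1)).isPathConnected ⟨0, h0⟩).joinedIn 0 h0 a₁ (hVb ha₁)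
  obtain ⟨p, hp⟩ := hjoin
  obtain ⟨c, hc⟩ := γ.exists_isContinuationAlong hn ht hV m ha₁ p
    fun s => ball_subset_dworkBase n (hp s)
  have hs := analyticOnNhd_sum_periodFun n m c
  have h1 := hc.unique_right (IsContinuationAlong.of_analyticAt fun s => hs _ (hp s))
    Filter.EventuallyEq.rfl
  obtain ⟨κ, hκ, hrel⟩ := γ.exists_periodRelations hn ht hV
  have hd : DifferentiableOn ℂ (γ.period m) V := by
    intro a ha
    have h2 := (((hrel a ha).hasDerivAt m).const_mul (κ (∑ i, m i))⁻¹).differentiableAt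
    simp only [inv_mul_cancel_left₀ (hκ _)] at h2
    exact h2.differentiableWithinAt
  exact ⟨c, (hd.analyticOnNhd hV).eqOn_of_preconnected_of_eventuallyEq (hs.mono hVb) hVc ha₁ h1⟩

end

theorem mainTheorem6 (n : ℕ) (hn : 1 ≤ n) (m : Fin (n + 1) → ℕ) :
    -- the series that occur converge for `|b| < 1`, that is, for `|a| < n + 1`
    (∀ δ ∈ admissible n m, ∀ b : ℂ, ‖b‖ < 1 →
      Summable (gTerm (upperParam n m δ) (lowerParam n δ) b)) ∧
    -- period integrals over `|a| < n + 1`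
    (∀ t : ℂ, t ≠ 0 → ∀ V : Set ℂ, IsOpen V → IsPreconnected V →
      V ⊆ Metric.ball 0 ((n : ℝ) + 1) → ∀ γ : FlatCycle n t V,
        ∃ c : ℕ → ℂ, ∀ a ∈ V, γ.period m a = ∑ δ ∈ admissible n m, c δ * periodFun n m δ a) ∧
    -- period integrals near an arbitrary point of `S`, as multivalued functions
    (∀ t : ℂ, t ≠ 0 → ∀ V : Set ℂ, IsOpen V → V ⊆ dworkBase n → ∀ γ : FlatCycle n t V,
      ∀ a₁ ∈ V, ∀ p : Path (0 : ℂ) a₁, (∀ s, p s ∈ dworkBase n) →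
        ∃ c : ℕ → ℂ, IsContinuationAlong p
          (fun a => ∑ δ ∈ admissible n m, c δ * periodFun n m δ a) (γ.period m)) ∧
    -- the functions span the solution space of the reduced Picard-Fuchs equation
    ((∀ i, m i < n) → ∀ V : Set ℂ, IsOpen V → IsPreconnected V →
      V ⊆ Metric.ball 0 ((n : ℝ) + 1) → ∀ y : ℂ → ℂ,
        ((DifferentiableOn ℂ y V ∧ ∀ a ∈ V, reducedPicardFuchs n m y a = 0) ↔
          ∃ c : ℕ → ℂ, ∀ a ∈ V, y a = ∑ δ ∈ admissible n m, c δ * periodFun n m δ a)) := by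
  refine ⟨fun δ _ => convergesInDisc_gCoeff n m δ, fun t ht V hV hVc hVb γ =>
    γ.exists_period_eq_sum hn ht hV hVc hVb m, fun t ht V hV _ γ a₁ ha₁ p hp =>
    γ.exists_isContinuationAlong hn ht hV m ha₁ p hp, fun hm V hV hVc hVb y => ⟨?_, ?_⟩⟩
  · rintro ⟨hy, hpf⟩
    exact exists_eqOn_sum_periodFun hm hV hVc hVb hy hpf
  · rintro ⟨_, hyc⟩
    exact reducedPicardFuchs_of_eqOn hm hV hVb hyc
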